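/- Let $S$ be a commutative $\mathbb{Q}$-algebra. A \emph{Lie pair} (self-contained Lie atom) $\mathfrak g^\sharp=(\mathfrak g,\mathfrak h,i)$ over $S$ is a homomorphism $i:\mathfrak g\to\mathfrak h$ of Lie algebras over $S$; it is regarded as a complex with $\mathfrak g$ in degree $0$ and $\mathfrak h$ in degree $1$. Morphisms are commutative squares of Lie homomorphisms; a quasi-isomorphism is a morphism that induces isomorphisms on $\ker i$ and $\operatorname{coker} i$. Put $x_@b=[x,b]$, $x_@b^{t}=(x_@b^{t-1})_@b$, let $c_t=B_t/t!$ where $\sum_t c_tx^t=x/(e^x-1)$, and let $x.b^{k}=\sum_{j=0}^{k}b^j\,x\,b^{k-j}\in\mathrm{Sym}^{k+1}\mathfrak h$. Let $K^{-n}=\bigoplus_{m\ge 0}\bigwedge^n\mathfrak g\otimes\mathrm{Sym}^m\mathfrak h$ for $n>0$ and $K^0=\bigoplus_{m>0}\mathrm{Sym}^m\mathfrak h$, with the linear maps $d:K^{-n}\to K^{-n+1}$ $$a_1\wedge\dots\wedge a_n\otimes b^m\mapsto\sum_{i=1}^n(-1)^{n-i}\sum_{t=0}^m c_t\;a_1\wedge\dots\widehat{a_i}\dots\wedge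 a_n\otimes (i(a_i)_@b^t).b^{m-t}+\sum_{i<j}(-1)^{n-j}a_1\wedge\dots\wedge[a_i,a_j]\wedge\dots\widehat{a_j}\dots\wedge a_n\otimes b^m ,$$ so that $a\otimes b^m\mapsto\sum_t c_t\,(i(a)_@b^t).b^{m-t}$ and $a_1\wedge a_2\mapsto[a_1,a_2]$; with the increasing filtration $(F_rK)^{-n}=\bigoplus_{m\le r-n}\bigwedge^n\mathfrak g\otimes\mathrm{Sym}^m\mathfrak h$; and with the comultiplication $K\to K\otimes K$ $$a_1\wedge\dots\wedge a_n\otimes b^m\mapsto\sum_{I\sqcup I'=\{1,\dots,n\}}\ \sum_{k+l=m}\pm\,(a_I\otimes b^k)\otimes(a_{I'}\otimes b^l),$$ where terms with a factor in $\bigwedge^0\mathfrak g\otimes\mathrm{Sym}^0\mathfrak h$ are omitted and the sign is that of the permutation listing $I'$ before $I$. Then these data are well defined and: (i) $d^2=0$, and $J^\sharp(\mathfrak g^\sharp)=(K,d)$ with $F_\cdot$ and the comultiplication is a filtered complex of $S$-modules with a coassociative, graded cocommutative comultiplication that is a map of complexes (with $d(x\otimes y)=dx\otimes y+(-1)^{|x|}x\otimes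 dy$); it is a functor from Lie pairs over $S$ to such complexes, a morphism $(\varphi,\psi)$ inducing $a_1\wedge\dots\wedge a_n\otimes b^m\mapsto\varphi(a_1)\wedge\dots\wedge\varphi(a_n)\otimes\psi(b)^m$. (ii) The comultiplication maps $F_r$ into $\sum_{s+t=r}F_s\otimes F_t$ (that is, into the sum of the images); $F_r=0$ for $r\le 0$, and for $r\ge 1$ the complex $F_r/F_{r-1}$ is naturally isomorphic, up to a shift by $r$, to the $r$-th exterior power $\bigwedge^r(\mathfrak g^\sharp)$ of the complex $\mathfrak g\to\mathfrak h$: the term $\bigwedge^n\mathfrak g\otimes\mathrm{Sym}^{r-n}\mathfrak h$ of $F_r/F_{r-1}$ in degree $-n$ corresponds to the part of $\bigwedge^r(\mathfrak g^\sharp)$ of degree $r-n$. (iii) If $f:\mathfrak g_1^\sharp\to\mathfrak g_2^\sharp$ is a quasi-isomorphism of Lie pairs whose terms are flat $S$-modules (for example, if $S$ is a field), then $J^\sharp(f)$ is a quasi-isomorphism. Consequently, if $\mathfrak g_1^\sharp$ and $\mathfrak g_2^\sharp$ are connected by a chain of quasi-isomorphisms (in either direction) of Lie pairs with flat terms, then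 $J^\sharp(\mathfrak g_1^\sharp)$ and $J^\sharp(\mathfrak g_2^\sharp)$ are connected by a chain of quasi-isomorphisms of filtered complexes with comultiplication. -/

import Mathlib

open CategoryTheory TensorProduct

universe u v w

noncomputable section

/-! ## Lie pairs

A Lie pair (a self-contained Lie atom, i.e. one whose target is its own hull) over `S` consists of
Lie algebras `g`, `h` and a Lie homomorphism `i : g → h`; `h` is a `g`-module through
`⟨a, b⟩ = ⁅i a, b⁆`, and `i` is then a homomorphism of `g`-modules. -/

/-- A Lie pair over `S`, viewed as the complex `i : g → h` with `g` in degree `0` and `h` in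
degree `1`. -/
structure LiePair (S : Type u) [CommRing S] where
  g : Type v
  h : Type w
  [lieRingG : LieRing g]
  [lieAlgebraG : LieAlgebra S g]
  [lieRingH : LieRing h]
  [lieAlgebraH : LieAlgebra S h]
  i : g →ₗ⁅S⁆ h

namespace LiePair

attribute [instance] lieRingG lieAlgebraG lieRingH lieAlgebraH

variable {S : Type u} [CommRing S]

/-- Morphisms of Lie pairs: commutative squares of Lie algebra homomorphisms. -/
@[ext]
structure Hom (P Q : LiePair.{u, v, w} S) where
  φ : P.g →ₗ⁅S⁆ Q.g
  ψ : P.h →ₗ⁅S⁆ Q.h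
  comm : ∀ a, ψ (P.i a) = Q.i (φ a)

instance : Category (LiePair.{u, v, w} S) where
  Hom := Hom
  id P := ⟨LieHom.id, LieHom.id, fun _ => rfl⟩
  comp f f' := ⟨f'.φ.comp f.φ, f'.ψ.comp f.ψ, fun a => by simp [f.comm, f'.comm]⟩

/-- A morphism of Lie pairs is a quasi-isomorphism if it induces isomorphisms on the cohomology of
the two-term complexes `g → h`, that is, on `ker i` and on `coker i`. -/
def IsQuasiIso {P Q : LiePair.{u, v, w} S} (f : P ⟶ Q) : Prop :=
  (∀ a, P.i a = 0 → f.φ a = 0 → a = 0) ∧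
  (∀ c, Q.i c = 0 → ∃ a, P.i a = 0 ∧ f.φ a = c) ∧
  (∀ b, (∃ c, f.ψ b = Q.i c) → ∃ a, b = P.i a) ∧
  (∀ y, ∃ b c, y = f.ψ b + Q.i c)

/-- Both terms of the Lie pair are flat `S`-modules (automatic when `S` is a field). -/
def IsFlat (P : LiePair.{u, v, w} S) : Prop :=
  Module.Flat S P.g ∧ Module.Flat S P.h

/-- `P` and `Q` are quasi-isomorphic: they are connected by a chain of quasi-isomorphisms, in either
direction, of Lie pairs with flat terms. -/
def QuasiIsomorphic : LiePair.{u, v, w} S → LiePair.{u, v, w} S → Prop :=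
  Relation.EqvGen fun P Q => P.IsFlat ∧ Q.IsFlat ∧ ∃ f : P ⟶ Q, IsQuasiIso f

end LiePair

/-! ## Filtered complexes with a comultiplication -/

/-- A filtered complex of `S`-modules in nonpositive degrees (`X n` is the term in degree `-n`)
with a filtered, coassociative, (graded) cocommutative comultiplication `C → C ⊗ C`.
The component of the comultiplication from `X n` to `X p ⊗ X q`, `p + q = n`, is `comul h`. -/
structure CoFiltComplex (S : Type u) [CommRing S] where
  X : ℕ → Type v
  [addCommGroup : ∀ n, AddCommGroup (X n)]
  [module : ∀ n, Module S (X n)]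
  /-- the differential -/
  d : ∀ n, X (n + 1) →ₗ[S] X n
  d_d : ∀ n x, d n (d (n + 1) x) = 0
  /-- the increasing filtration by subcomplexes: `fil r n` is the degree `-n` term of `F_r` -/
  fil : ℤ → ∀ n, Submodule S (X n)
  fil_mono : ∀ r n, fil r n ≤ fil (r + 1) n
  d_fil : ∀ r n, ∀ x ∈ fil r (n + 1), d n x ∈ fil r n
  /-- the comultiplication -/
  comul : ∀ {n p q : ℕ}, p + q = n → X n →ₗ[S] X p ⊗[S] X q
  /-- The comultiplication is a map of complexes, where
  `d (x ⊗ y) = d x ⊗ y + (-1) ^ |x| x ⊗ d y`. -/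
  comul_d : ∀ {n p q : ℕ} (h : p + q = n) (x : X (n + 1)),
    comul h (d n x) =
      (d p).rTensor (X q) (comul (by omega : (p + 1) + q = n + 1) x) +
      (-1 : S) ^ p • (d q).lTensor (X p) (comul (by omega : p + (q + 1) = n + 1) x)
  coassoc : ∀ {p q r a b n : ℕ} (hpq : p + q = a) (ha : a + r = n) (hqr : q + r = b)
    (hb : p + b = n) (x : X n),
    TensorProduct.assoc S (X p) (X q) (X r) ((comul hpq).rTensor (X r) (comul ha x)) =
      (comul hqr).lTensor (X p) (comul hb x)
  cocomm : ∀ {p q n : ℕ} (h : p + q = n) (h' : q + p = n) (x : X n),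
    TensorProduct.comm S (X p) (X q) (comul h x) = (-1 : S) ^ (p * q) • comul h' x
  /-- The comultiplication maps `F_r` to the sum of the images of `F_s ⊗ F_t`, `s + t = r`. -/
  comul_fil : ∀ {n p q : ℕ} (h : p + q = n) (r : ℤ), ∀ x ∈ fil r n,
    comul h x ∈ ⨆ s : ℤ, LinearMap.range
      (TensorProduct.map (fil s p).subtype (fil (r - s) q).subtype)

namespace CoFiltComplex

attribute [instance] addCommGroup module

variable {S : Type u} [CommRing S]

/-- Morphisms: maps of filtered complexes commuting with the comultiplications. -/
@[ext]
structure Hom (C D : CoFiltComplex.{u, v} S) where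
  app : ∀ n, C.X n →ₗ[S] D.X n
  comm_d : ∀ n x, app n (C.d n x) = D.d n (app (n + 1) x)
  map_fil : ∀ r n, ∀ x ∈ C.fil r n, app n x ∈ D.fil r n
  comm_comul : ∀ {n p q : ℕ} (h : p + q = n) (x : C.X n),
    TensorProduct.map (app p) (app q) (C.comul h x) = D.comul h (app n x)

instance : Category (CoFiltComplex.{u, v} S) where
  Hom := Hom
  id C := ⟨fun _ => LinearMap.id, fun _ _ => rfl, fun _ _ _ hx => hx, fun _ _ => by simp⟩
  comp f f' :=
    { app := fun n => f'.app n ∘ₗ f.app n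
      comm_d := fun n x => by simp [f.comm_d, f'.comm_d]
      map_fil := fun r n x hx => f'.map_fil r n _ (f.map_fil r n x hx)
      comm_comul := fun h x => by
        simp [TensorProduct.map_comp, f.comm_comul, f'.comm_comul] }

/-- Cocycles in degree `-n`. -/
def cycles (C : CoFiltComplex.{u, v} S) : ∀ n, Submodule S (C.X n)
  | 0 => ⊤
  | n + 1 => LinearMap.ker (C.d n)

/-- Coboundaries in degree `-n`. -/
def boundaries (C : CoFiltComplex.{u, v} S) (n : ℕ) : Submodule S (C.X n) :=
  LinearMap.range (C.d n)

/-- A morphism is a quasi-isomorphism if it induces injective and surjective maps on the cohomology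
of the underlying complexes. -/
def IsQuasiIso {C D : CoFiltComplex.{u, v} S} (f : C ⟶ D) : Prop :=
  ∀ n, (∀ x ∈ C.cycles n, f.app n x ∈ D.boundaries n → x ∈ C.boundaries n) ∧
    (∀ y ∈ D.cycles n, ∃ x ∈ C.cycles n, y - f.app n x ∈ D.boundaries n)

/-- `C` and `D` are quasi-isomorphic: they are connected by a chain of quasi-isomorphisms, in either
direction, of filtered complexes with comultiplication. -/
def QuasiIsomorphic : CoFiltComplex.{u, v} S → CoFiltComplex.{u, v} S → Prop :=
  Relation.EqvGen fun C D => ∃ f : C ⟶ D, IsQuasiIso f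

/-- The degree `-n` term of the associated graded complex `F_r / F_{r-1}`. -/
abbrev Gr (C : CoFiltComplex.{u, v} S) (r : ℤ) (n : ℕ) : Type v :=
  C.fil r n ⧸ (C.fil (r - 1) n).submoduleOf (C.fil r n)

/-- The differential of `F_r / F_{r-1}`. -/
def grD (C : CoFiltComplex.{u, v} S) (r : ℤ) (n : ℕ) : C.Gr r (n + 1) →ₗ[S] C.Gr r n :=
  Submodule.mapQ _ _ ((C.d n).restrict (C.d_fil r n)) fun x hx => C.d_fil (r - 1) n x hx

/-- The map `F_r / F_{r-1} → F_r / F_{r-1}` induced by a morphism. -/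
def grMap {C D : CoFiltComplex.{u, v} S} (f : C ⟶ D) (r : ℤ) (n : ℕ) :
    C.Gr r n →ₗ[S] D.Gr r n :=
  Submodule.mapQ _ _ ((f.app n).restrict (f.map_fil r n)) fun x hx => f.map_fil (r - 1) n x hx

end CoFiltComplex

/-! ## Symmetric powers -/

section SymPow

variable (S : Type u) [CommRing S] (M : Type w) [AddCommGroup M] [Module S M]

/-- The `m`-th symmetric power of `M`, the degree `m` part of the symmetric algebra. -/
abbrev SymPow (m : ℕ) : Submodule S (SymmetricAlgebra S M) :=
  LinearMap.range (SymmetricAlgebra.ι S M) ^ m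

variable {M}

/-- The element `b ^ m` of `Sym^m M`. -/
def symPow (b : M) (m : ℕ) : SymPow S M m :=
  ⟨SymmetricAlgebra.ι S M b ^ m, Submodule.pow_mem_pow _ (LinearMap.mem_range_self _ b) m⟩

/-- The element `x . b ^ k = ∑_{j = 0}^k b^j x b^{k-j}` of `Sym^{k+1} M`. -/
def symDot (x b : M) (k : ℕ) : SymPow S M (k + 1) :=
  ⟨∑ j ∈ Finset.range (k + 1), SymmetricAlgebra.ι S M b ^ j * SymmetricAlgebra.ι S M x *
      SymmetricAlgebra.ι S M b ^ (k - j), by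
    refine Submodule.sum_mem _ fun j hj => ?_
    have hk : k + 1 = j + 1 + (k - j) := by
      have := Finset.mem_range.1 hj
      omega
    rw [SymPow, hk, pow_add, pow_succ]
    exact Submodule.mul_mem_mul (Submodule.mul_mem_mul
      (Submodule.pow_mem_pow _ (LinearMap.mem_range_self _ b) j) (LinearMap.mem_range_self _ x))
      (Submodule.pow_mem_pow _ (LinearMap.mem_range_self _ b) (k - j))⟩

end SymPow

/-! ## The Jacobi-Bernoulli complex of a Lie pair -/

namespace LiePair

variable {S : Type u} [CommRing S]

/-- The term of the Jacobi-Bernoulli complex in degree `-n`: the direct sum of the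
`⋀^n g ⊗ Sym^m h` over all `m ≥ 0`, respectively over all `m > 0` if `n = 0`. -/
abbrev JB (P : LiePair.{u, v, w} S) (n : ℕ) : Type (max u v w) :=
  DirectSum {m : ℕ // 0 < n + m} fun m => (⋀[S]^n P.g) ⊗[S] (SymPow S P.h m.1)

namespace JB

variable (P : LiePair.{u, v, w} S)

/-- The inclusion of the summand `⋀^n g ⊗ Sym^m h`, by convention zero for `n = m = 0`. -/
def of (n m : ℕ) : (⋀[S]^n P.g) ⊗[S] (SymPow S P.h m) →ₗ[S] P.JB n :=
  if hm : 0 < n + m then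
    DirectSum.lof S {m : ℕ // 0 < n + m} (fun m => (⋀[S]^n P.g) ⊗[S] (SymPow S P.h m.1)) ⟨m, hm⟩
  else 0

/-- The filtration: `F_r` is in degree `-n` the sum of the `⋀^n g ⊗ Sym^m h` with `m ≤ -n + r`. -/
def fil (r : ℤ) (n : ℕ) : Submodule S (P.JB n) :=
  ⨆ m : {m : ℕ // (m : ℤ) ≤ -(n : ℤ) + r}, LinearMap.range (of P n m.1)

/-- The element `a_0 ∧ ⋯ ∧ a_{n-1} ⊗ b ^ m`. These elements span, since `S` is a `ℚ`-algebra. -/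
def mon {n : ℕ} (m : ℕ) (a : Fin n → P.g) (b : P.h) : P.JB n :=
  of P n m (exteriorPower.ιMulti S n a ⊗ₜ[S] symPow S b m)

/-- The iterated bracket `x @ b ^ t`, where `x @ b = ⁅x, b⁆`. -/
def iterBracket (x b : P.h) : ℕ → P.h
  | 0 => x
  | t + 1 => ⁅iterBracket x b t, b⁆

/-- The value of the differential on `a_0 ∧ ⋯ ∧ a_n ⊗ b ^ m`, with `c_t = B_t / t!`:
`∑_i (-1)^(n-i) ∑_t c_t a_0 ∧ ⋯ âᵢ ⋯ ∧ a_n ⊗ (i(a_i) @ b ^ t) . b ^ (m - t)`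
`+ ∑_{i<j} (-1)^(n-j) a_0 ∧ ⋯ ∧ [a_i, a_j] ∧ ⋯ âⱼ ⋯ ∧ a_n ⊗ b ^ m`.
The signs are those of the (co)derivation extending
`a ⊗ b ^ m ↦ ∑_t c_t (i(a) @ b ^ t) . b ^ (m - t)` and `a_0 ∧ a_1 ↦ [a_0, a_1]`. -/
def dMon [Algebra ℚ S] {n : ℕ} (m : ℕ) (a : Fin (n + 1) → P.g) (b : P.h) : P.JB n :=
  (∑ i : Fin (n + 1), ∑ t ∈ Finset.range (m + 1),
    ((-1 : S) ^ (n - (i : ℕ)) * algebraMap ℚ S (bernoulli t / (t.factorial : ℚ))) •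
      of P n (m - t + 1) (exteriorPower.ιMulti S n (i.removeNth a) ⊗ₜ[S]
        symDot S (iterBracket P (P.i (a i)) b t) b (m - t))) +
  ∑ i : Fin (n + 1), ∑ j ∈ Finset.Ioi i,
    (-1 : S) ^ (n - (j : ℕ)) •
      mon P m (j.removeNth (Function.update a i ⁅a i, a j⁆)) b

/-- The value of the `(p, q)`-component of the comultiplication on `a_0 ∧ ⋯ ∧ a_{n-1} ⊗ b ^ m`,
`n = p + q`: the sum over all `I ⊔ I' = {0, …, n-1}` with `|I| = p` and all `k + l = m` of
`± (a_I ⊗ b ^ k) ⊗ (a_{I'} ⊗ b ^ l)`, the sign being that of the permutation that lists `I'`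
before `I`. -/
def comulMon {n p q : ℕ} (h : p + q = n) (m : ℕ) (a : Fin n → P.g) (b : P.h) :
    P.JB p ⊗[S] P.JB q :=
  ∑ I : {I : Finset (Fin n) // I.card = p}, ∑ k ∈ Finset.range (m + 1),
    (-1 : S) ^ (((I.1 ×ˢ I.1ᶜ).filter fun x => x.1 < x.2).card) •
      (mon P k (a ∘ I.1.orderEmbOfFin I.2) b ⊗ₜ[S]
        mon P (m - k) (a ∘ I.1ᶜ.orderEmbOfFin (by
          rw [Finset.card_compl, I.2, Fintype.card_fin]; omega)) b)

end JB

/-! ## The exterior powers of a Lie pair, as a two-term complex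

The `r`-th exterior power of the complex `g → h` (degrees `0`, `1`) is the quotient of its `r`-th
tensor power by the relations `⋯ x ⊗ y ⋯ = -(-1) ^ (|x||y|) ⋯ y ⊗ x ⋯` for homogeneous `x`, `y`. -/

/-- A homogeneous element of the complex `g → h`, as an element of `g × h`. -/
def tot {P : LiePair.{u, v, w} S} : P.g ⊕ P.h → P.g × P.h :=
  Sum.elim (fun a => (a, 0)) fun b => (0, b)

/-- The sign `(-1) ^ (|x||y|)` of homogeneous elements `x`, `y` of `g → h`. -/
def koszul {P : LiePair.{u, v, w} S} : P.g ⊕ P.h → P.g ⊕ P.h → S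
  | .inr _, .inr _ => -1
  | _, _ => 1

namespace ExtPow

variable (P : LiePair.{u, v, w} S) (r : ℕ)

/-- The total module of the `r`-th tensor power of the complex `g → h`. -/
abbrev T : Type (max u v w) := ⨂[S]^r (P.g × P.h)

/-- The tensor `x_0 ⊗ ⋯ ⊗ x_{r-1}` of homogeneous elements. -/
def mono (x : Fin r → P.g ⊕ P.h) : T P r := PiTensorProduct.tprod S fun k => tot (x k)

/-- The relations `⋯ x ⊗ y ⋯ = -(-1) ^ (|x||y|) ⋯ y ⊗ x ⋯` of the exterior power. -/
def rel : Submodule S (T P r) :=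
  Submodule.span S {z | ∃ (x : Fin r → P.g ⊕ P.h) (k l : Fin r), (l : ℕ) = k + 1 ∧
    z = mono P r x + koszul (x k) (x l) • mono P r (x ∘ Equiv.swap k l)}

/-- The differential `(a, b) ↦ (0, i a)` of `g → h`. -/
def bd : P.g × P.h →ₗ[S] P.g × P.h :=
  LinearMap.prod 0 ((P.i : P.g →ₗ[S] P.h) ∘ₗ LinearMap.fst S P.g P.h)

/-- The sign operator `x ↦ (-1) ^ |x| x` on `g → h`. -/
def sg : P.g × P.h →ₗ[S] P.g × P.h :=
  LinearMap.prodMap LinearMap.id (-LinearMap.id)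

/-- The differential of the tensor power:
`x_0 ⊗ ⋯ ⊗ x_{r-1} ↦ ∑_k (-1) ^ (|x_0| + ⋯ + |x_{k-1}|) x_0 ⊗ ⋯ ⊗ d x_k ⊗ ⋯ ⊗ x_{r-1}`. -/
def tD : T P r →ₗ[S] T P r :=
  ∑ k : Fin r, PiTensorProduct.map fun l =>
    if l < k then sg P else if l = k then bd P else LinearMap.id

/-- `tD` is a sum over the positions `k`; on a homogeneous tensor the `k`-th summand is again a
homogeneous tensor, with the factors `step k x`. -/
def step (k : Fin r) (x : Fin r → P.g ⊕ P.h) (l : Fin r) : P.g ⊕ P.h :=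
  if l < k then (x l).map id Neg.neg
  else if l = k then .inr (Sum.elim (fun a => P.i a) (fun _ => 0) (x l)) else x l

variable {P r}

theorem tD_mono (x : Fin r → P.g ⊕ P.h) :
    tD P r (mono P r x) = ∑ k, mono P r (step P r k x) := by
  rw [tD, LinearMap.sum_apply]
  refine Finset.sum_congr rfl fun k _ => ?_
  rw [mono, PiTensorProduct.map_tprod, mono]
  congr 1
  funext l
  rcases lt_trichotomy l k with h | h | h
  · rcases hx : x l with a | b <;> simp [step, h, hx, tot, sg]
  · rcases hx : x l with a | b <;> simp [step, h, tot, bd]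
    all_goals subst h; simp [hx]
  · have h1 : ¬ l < k := not_lt.2 h.le
    have h2 : l ≠ k := h.ne'
    simp [step, h1, h2]

theorem mono_zero (x : Fin r → P.g ⊕ P.h) (k : Fin r) (h : x k = .inr 0) :
    mono P r x = 0 :=
  MultilinearMap.map_coord_zero _ k (by simp [h, tot])

theorem rel_mem (x : Fin r → P.g ⊕ P.h) (k l : Fin r) (h : (l : ℕ) = k + 1) :
    mono P r x + koszul (x k) (x l) • mono P r (x ∘ Equiv.swap k l) ∈ rel P r :=
  Submodule.subset_span ⟨x, k, l, h, rfl⟩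

theorem mono_neg (x y : Fin r → P.g ⊕ P.h) (k : Fin r) (b : P.h) (hx : x k = .inr (-b))
    (hy : y k = .inr b) (h : ∀ m, m ≠ k → x m = y m) : mono P r x = -mono P r y := by
  have e : (fun m => tot (x m)) =
      Function.update (fun m => tot (y m)) k ((-1 : S) • tot (y k)) := by
    funext m
    by_cases hm : m = k
    · subst hm
      simp [hx, hy, tot]
    · simp [hm, h m hm]
  rw [mono, e, MultilinearMap.map_update_smul, Function.update_eq_self, mono, neg_one_smul]

theorem step_swap (x : Fin r → P.g ⊕ P.h) (k l m : Fin r) (h : (l : ℕ) = k + 1) (hk : m ≠ k)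
    (hl : m ≠ l) : step P r m (x ∘ Equiv.swap k l) = step P r m x ∘ Equiv.swap k l := by
  have hk' : (m : ℕ) ≠ k := fun e => hk (Fin.ext e)
  have hl' : (m : ℕ) ≠ l := fun e => hl (Fin.ext e)
  funext t
  by_cases h1 : t = k
  · subst h1
    have e : (t < m) = (l < m) := by simp only [Fin.lt_def]; grind
    simp [step, e, hk.symm, hl.symm]
  · by_cases h2 : t = l
    · subst h2
      have e : (t < m) = (k < m) := by simp only [Fin.lt_def]; grind
      simp [step, e, hk.symm, hl.symm]
    · simp [step, Equiv.swap_apply_of_ne_of_ne h1 h2]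

theorem koszul_step (x : Fin r → P.g ⊕ P.h) (k l m : Fin r) (hk : m ≠ k) (hl : m ≠ l) :
    koszul (S := S) (step P r m x k) (step P r m x l) = koszul (x k) (x l) := by
  simp only [step, hk.symm, hl.symm, if_false]
  split_ifs <;> rcases x k with a | b <;> rcases x l with a' | b' <;> rfl

/-- The two summands at the exchanged positions. -/
theorem tD_rel_aux (x : Fin r → P.g ⊕ P.h) (k l : Fin r) (h : (l : ℕ) = k + 1) :
    (mono P r (step P r k x) + koszul (x k) (x l) • mono P r (step P r k (x ∘ Equiv.swap k l))) +
    (mono P r (step P r l x) + koszul (x k) (x l) • mono P r (step P r l (x ∘ Equiv.swap k l)))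
      ∈ rel P r := by
  have hkl : k < l := by simp [Fin.lt_def, h]
  have hlk : ¬ l < k := not_lt.2 hkl.le
  have mixed : ∀ (x : Fin r → P.g ⊕ P.h) (a : P.g) (b : P.h), x k = .inl a → x l = .inr b →
      mono P r (step P r k x) + mono P r (step P r l (x ∘ Equiv.swap k l)) ∈ rel P r := by
    intro x a b hx hy
    have h1 := rel_mem (step P r k x) k l h
    have h2 : mono P r (step P r l (x ∘ Equiv.swap k l)) =
        -mono P r (step P r k x ∘ Equiv.swap k l) := by
      refine mono_neg _ _ k b ?_ ?_ ?_
      · simp [step, hkl, hy]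
      · simp [step, hlk, hkl.ne', hy]
      · intro m hm
        by_cases h2 : m = l
        · subst h2
          simp [step, hx]
        · have e : (m < l) = (m < k) := by
            have h3 : (m : ℕ) ≠ k := fun e => hm (Fin.ext e)
            simp only [Fin.lt_def]
            grind
          simp [step, Equiv.swap_apply_of_ne_of_ne hm h2, e, hm, h2]
    have h3 : koszul (S := S) (step P r k x k) (step P r k x l) = -1 := by
      simp [step, hlk, hkl.ne', hy, koszul]
    rw [h3] at h1
    rw [h2, ← neg_one_smul S (mono P r (step P r k x ∘ Equiv.swap k l))]
    exact h1
  rcases hx : x k with a | a <;> rcases hy : x l with b | b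
  · have h1 := rel_mem (step P r k x) k l h
    have h2 := rel_mem (step P r l x) k l h
    have e1 : step P r k x ∘ Equiv.swap k l = step P r l (x ∘ Equiv.swap k l) := by
      funext m
      by_cases hm : m = k
      · subst hm
        simp [step, hkl, hlk, hkl.ne', hy]
      · by_cases h2 : m = l
        · subst h2
          simp [step, hx]
        · have e : (m < l) = (m < k) := by
            have h3 : (m : ℕ) ≠ k := fun e => hm (Fin.ext e)
            simp only [Fin.lt_def]
            grind
          simp [step, Equiv.swap_apply_of_ne_of_ne hm h2, e, hm, h2]
    have e2 : step P r l x ∘ Equiv.swap k l = step P r k (x ∘ Equiv.swap k l) := by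
      funext m
      by_cases hm : m = k
      · subst hm
        simp [step, hy]
      · by_cases h2 : m = l
        · subst h2
          simp [step, hkl, hlk, hkl.ne', hx]
        · have e : (m < l) = (m < k) := by
            have h3 : (m : ℕ) ≠ k := fun e => hm (Fin.ext e)
            simp only [Fin.lt_def]
            grind
          simp [step, Equiv.swap_apply_of_ne_of_ne hm h2, e, hm, h2]
    have k1 : koszul (S := S) (step P r k x k) (step P r k x l) = 1 := by
      simp [step, hlk, hkl.ne', hx, hy, koszul]
    have k2 : koszul (S := S) (step P r l x k) (step P r l x l) = 1 := by
      simp [step, hkl, hx, hy, koszul]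
    rw [e1, k1, one_smul] at h1
    rw [e2, k2, one_smul] at h2
    have := Submodule.add_mem _ h1 h2
    simp only [koszul, one_smul]
    convert this using 1
    abel
  · have h1 := mixed x a b hx hy
    have z1 : mono P r (step P r l x) = 0 := mono_zero _ l (by simp [step, hy])
    have z2 : mono P r (step P r k (x ∘ Equiv.swap k l)) = 0 :=
      mono_zero _ k (by simp [step, hy])
    rw [z1, z2]
    simpa [koszul] using h1
  · have h1 := mixed (x ∘ Equiv.swap k l) b a (by simp [hy]) (by simp [hx])
    have e : (x ∘ Equiv.swap k l) ∘ Equiv.swap k l = x := by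
      funext m
      simp
    rw [e] at h1
    have z1 : mono P r (step P r k x) = 0 := mono_zero _ k (by simp [step, hx])
    have z2 : mono P r (step P r l (x ∘ Equiv.swap k l)) = 0 :=
      mono_zero _ l (by simp [step, hx])
    rw [z1, z2]
    simpa [koszul, add_comm] using h1
  · have z1 : mono P r (step P r k x) = 0 := mono_zero _ k (by simp [step, hx])
    have z2 : mono P r (step P r l x) = 0 := mono_zero _ l (by simp [step, hy])
    have z3 : mono P r (step P r k (x ∘ Equiv.swap k l)) = 0 :=
      mono_zero _ k (by simp [step, hy])
    have z4 : mono P r (step P r l (x ∘ Equiv.swap k l)) = 0 :=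
      mono_zero _ l (by simp [step, hx])
    rw [z1, z2, z3, z4]
    simp

theorem tD_rel : rel P r ≤ (rel P r).comap (tD P r) := by
  rw [rel, Submodule.span_le]
  rintro _ ⟨x, k, l, h, rfl⟩
  have hne : l ≠ k := fun e => by simp [e] at h
  change tD P r _ ∈ rel P r
  rw [map_add, map_smul, tD_mono, tD_mono, Finset.smul_sum, ← Finset.sum_add_distrib,
    ← Finset.add_sum_erase _ _ (Finset.mem_univ k),
    ← Finset.add_sum_erase _ _ (Finset.mem_erase.2 ⟨hne, Finset.mem_univ l⟩), ← add_assoc]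
  refine Submodule.add_mem _ (tD_rel_aux x k l h) (Submodule.sum_mem _ fun m hm => ?_)
  simp only [Finset.mem_erase, Finset.mem_univ, and_true] at hm
  have := rel_mem (step P r m x) k l h
  rwa [koszul_step x k l m hm.2 hm.1, ← step_swap x k l m h hm.2 hm.1] at this

variable (P r)

/-- The total module of the `r`-th exterior power of the complex `g → h`. -/
abbrev Total : Type (max u v w) := T P r ⧸ rel P r

/-- The part of the exterior power spanned by the products of `r` homogeneous elements of which
exactly `n` belong to `g`, so that `r - n` belong to `h`; this is the part of degree `r - n`. -/
def piece (n : ℕ) : Submodule S (Total P r) :=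
  Submodule.span S {z | ∃ x : Fin r → P.g ⊕ P.h,
    (Finset.univ.filter fun k => (x k).isLeft).card = n ∧ z = (rel P r).mkQ (mono P r x)}

theorem piece_le (n : ℕ) :
    piece P r (n + 1) ≤ (piece P r n).comap ((rel P r).mapQ (rel P r) (tD P r) tD_rel) := by
  rw [piece, Submodule.span_le]
  rintro _ ⟨x, hx, rfl⟩
  change (rel P r).mapQ (rel P r) (tD P r) tD_rel _ ∈ piece P r n
  rw [Submodule.mkQ_apply, Submodule.mapQ_apply, tD_mono, ← Submodule.mkQ_apply, map_sum]
  refine Submodule.sum_mem _ fun k _ => ?_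
  rcases hk : x k with a | b
  · refine Submodule.subset_span ⟨_, ?_, rfl⟩
    have : (Finset.univ.filter fun l => (step P r k x l).isLeft) =
        (Finset.univ.filter fun l => (x l).isLeft).erase k := by
      ext l
      simp only [Finset.mem_filter, Finset.mem_erase, Finset.mem_univ, true_and]
      by_cases hl : l = k
      · subst hl
        simp [step]
      · by_cases h1 : l < k <;> simp [step, hl, h1]
    rw [this, Finset.card_erase_of_mem (by simp [hk]), hx]
    rfl
  · rw [mono_zero _ k (by simp [step, hk]), map_zero]
    exact Submodule.zero_mem _

/-- The differential of the `r`-th exterior power of the complex `g → h`, from degree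
`r - (n + 1)` to degree `r - n`. -/
def D (n : ℕ) : piece P r (n + 1) →ₗ[S] piece P r n :=
  ((rel P r).mapQ (rel P r) (tD P r) tD_rel).restrict (piece_le P r n)

variable {P} {Q : LiePair.{u, v, w} S} (f : P ⟶ Q)

/-- The map induced by a morphism on the tensor powers. -/
def tMap : T P r →ₗ[S] T Q r :=
  PiTensorProduct.map fun _ => LinearMap.prodMap (f.φ : P.g →ₗ[S] Q.g) (f.ψ : P.h →ₗ[S] Q.h)

theorem tMap_mono (x : Fin r → P.g ⊕ P.h) :
    tMap r f (mono P r x) = mono Q r fun k => (x k).map f.φ f.ψ := by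
  rw [tMap, mono, PiTensorProduct.map_tprod, mono]
  congr 1
  funext k
  rcases x k with a | b <;> simp [tot]

theorem tMap_rel : rel P r ≤ (rel Q r).comap (tMap r f) := by
  rw [rel, Submodule.span_le]
  rintro _ ⟨x, k, l, h, rfl⟩
  change tMap r f _ ∈ rel Q r
  rw [map_add, map_smul, tMap_mono, tMap_mono]
  have := rel_mem (P := Q) (fun k => (x k).map f.φ f.ψ) k l h
  convert this using 3
  · rcases x k with a | b <;> rcases x l with a' | b' <;> rfl
  · rfl

theorem map_le (n : ℕ) :
    piece P r n ≤ (piece Q r n).comap ((rel P r).mapQ (rel Q r) (tMap r f) (tMap_rel r f)) := by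
  rw [piece, Submodule.span_le]
  rintro _ ⟨x, hx, rfl⟩
  change (rel P r).mapQ (rel Q r) (tMap r f) (tMap_rel r f) _ ∈ piece Q r n
  rw [Submodule.mkQ_apply, Submodule.mapQ_apply, tMap_mono, ← Submodule.mkQ_apply]
  exact Submodule.subset_span ⟨_, by simpa using hx, rfl⟩

/-- The map induced by a morphism on the exterior powers. -/
def map (n : ℕ) : piece P r n →ₗ[S] piece Q r n :=
  ((rel P r).mapQ (rel Q r) (tMap r f) (tMap_rel r f)).restrict (map_le r f n)

end ExtPow

end LiePair

end

noncomputable section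

open Finset.HasAntidiagonal (antidiagonal mem_antidiagonal)

/-! ## Symmetric algebras over a `ℚ`-algebra -/


/-! Let the generator `b ^ m` of the complex correspond to the divided power `b ^ m / m!` of `Sym
h`. The part of the differential that involves `i` then comes from the operators `b ^ m / m! ↦ ∑ c_t
(x @ b ^ t) b ^ (m - t) / (m - t)!`. This is right multiplication by `x` on the enveloping algebra
of `h`, carried to `Sym h` by symmetrization. So `K` is, up to signs and up to the line spanned by
`1 ⊗ 1`, the Chevalley-Eilenberg complex of `g` with coefficients in the right module `Sym h`.

The enveloping algebra itself is not used. That the operators form a right action (`symAct_symAct`)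
is checked on divided powers. Terms in which `x` and `y` stay separate cancel, and the rest is the
image of the functional equation `f(u) (f(u+v) - f(v)) / u + f(v) (f(u+v) - f(u)) / v = -f(u+v)` of
`f = x / (e^x - 1)` (`bernoulli_functional_equation`, `bernoulli_bracket`). Then `d² = 0` is the
usual Chevalley-Eilenberg argument (`CEChain.ce_ce`). The operators are coderivations of `Sym h`
(`coprod_symAct`), so the product of the shuffle coproduct and the coproduct of `Sym h` is
compatible with the differential (`CEChain.comul_ce`). All identities are proved on chains and
descend along the surjections `Term.proj`.

On `F_r / F_{r-1}` only the leading term of `d` survives: brackets in `g` and the terms with `t ≥ 1`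
lower `n + m`, and `c_0 = 1`. What remains is the Koszul-type differential `Chain.symbol`. Iterated
multiplication identifies it with the differential of the `r`-th exterior power of `g → h`
(`ofChainAt_sgn_symbol`, `ofGr`).

For quasi-isomorphisms, the exterior powers come first (`totalMap_coneExact`), by induction on `r`.
Splitting off one factor and multiplying it back is `r + 1` times the identity, so over `ℚ` the
power `⋀^(r+1)` is a retract of `(g → h) ⊗ ⋀^r`. A tensor product of quasi-isomorphisms is treated
as a composite of two maps, one handled by flatness of the source terms, the other by flatness of
the target `h`. Everything is phrased as exactness of mapping cones (`LinearMap.ConeExact`). An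
induction along the filtration, which is exhaustive and zero for `r ≤ 0`, lifts the result from the
graded pieces to the complexes. -/

/-- The symmetric algebra of `M`, sealed so that its instances are cheap to compare. -/
def SymmAlg (S : Type*) [CommRing S] (M : Type*) [AddCommGroup M] [Module S M] : Type _ :=
  SymmetricAlgebra S M

namespace SymmAlg

variable {S : Type*} [CommRing S] {M : Type*} [AddCommGroup M] [Module S M]

instance : CommRing (SymmAlg S M) := inferInstanceAs (CommRing (SymmetricAlgebra S M))

instance : Algebra S (SymmAlg S M) := inferInstanceAs (Algebra S (SymmetricAlgebra S M))

variable (S M) in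
/-- The identity. -/
def equiv : SymmAlg S M ≃ₐ[S] SymmetricAlgebra S M :=
  { Equiv.refl (SymmetricAlgebra S M) with
    map_mul' := fun _ _ => rfl
    map_add' := fun _ _ => rfl
    commutes' := fun _ => rfl }

variable (S M) in
/-- The inclusion of the generators. -/
def ι : M →ₗ[S] SymmAlg S M := (equiv S M).symm.toLinearMap ∘ₗ SymmetricAlgebra.ι S M

@[simp]
theorem equiv_ι (b : M) : equiv S M (ι S M b) = SymmetricAlgebra.ι S M b := by
  simp [ι]

/-- The universal property. -/
def lift {A : Type*} [CommSemiring A] [Algebra S A] (f : M →ₗ[S] A) : SymmAlg S M →ₐ[S] A :=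
  (SymmetricAlgebra.lift f).comp (equiv S M : SymmAlg S M →ₐ[S] SymmetricAlgebra S M)

@[simp]
theorem lift_ι_apply {A : Type*} [CommSemiring A] [Algebra S A] (f : M →ₗ[S] A) (b : M) :
    lift f (ι S M b) = f b := by
  simp [lift]

@[elab_as_elim]
theorem induction {motive : SymmAlg S M → Prop} (algebraMap : ∀ r, motive (algebraMap S _ r))
    (ι : ∀ b, motive (ι S M b)) (mul : ∀ u v, motive u → motive v → motive (u * v))
    (add : ∀ u v, motive u → motive v → motive (u + v)) (u : SymmAlg S M) : motive u :=
  SymmetricAlgebra.induction S M (motive := motive) algebraMap ι mul add u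

variable {N : Type*} [AddCommGroup N] [Module S N]

/-- The universal property asks for a commutative target. Commuting operators generate a commutative
subalgebra of `End N`, so the lift goes there and is then included. -/
theorem exists_endHom (f : M →ₗ[S] Module.End S N)
    (hf : ∀ a b, f a * f b = f b * f a) :
    ∃ F : SymmAlg S M →ₐ[S] Module.End S N, ∀ b, F (ι S M b) = f b := by
  let hc : ∀ a ∈ Set.range f, ∀ b ∈ Set.range f, a * b = b * a := by
    rintro _ ⟨a, rfl⟩ _ ⟨b, rfl⟩
    exact hf a b
  let _ : CommRing (Algebra.adjoin S (Set.range f)) :=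
    { (inferInstance : Ring (Algebra.adjoin S (Set.range f))) with
      mul_comm := (Algebra.isMulCommutative_adjoin S hc).is_comm.comm }
  let f' : M →ₗ[S] Algebra.adjoin S (Set.range f) :=
    { toFun := fun b => ⟨f b, Algebra.subset_adjoin ⟨b, rfl⟩⟩
      map_add' := fun a b => Subtype.ext (map_add f a b)
      map_smul' := fun c b => Subtype.ext (map_smul f c b) }
  refine ⟨(Algebra.adjoin S (Set.range f)).val.comp (lift f'), fun b => ?_⟩
  rw [AlgHom.comp_apply, lift_ι_apply]
  rfl

/-- The algebra homomorphism `Sym M → End N` extending a family of commuting operators. -/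
def endHom (f : M →ₗ[S] Module.End S N) (hf : ∀ a b, f a * f b = f b * f a) :
    SymmAlg S M →ₐ[S] Module.End S N :=
  (exists_endHom f hf).choose

/-- The linear map `F` with `F 1 = n` and `F (b * u) = f b (F u)`, for commuting operators `f b`. -/
def fold (f : M →ₗ[S] Module.End S N) (hf : ∀ a b, f a * f b = f b * f a) (n : N) :
    SymmAlg S M →ₗ[S] N :=
  (endHom f hf).toLinearMap.flip n

section fold

variable (f : M →ₗ[S] Module.End S N) (hf : ∀ a b, f a * f b = f b * f a) (n : N)

@[simp]
theorem fold_one : fold f hf n 1 = n := by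
  simp [fold]

@[simp]
theorem fold_ι_mul (b : M) (u : SymmAlg S M) :
    fold f hf n (ι S M b * u) = f b (fold f hf n u) := by
  simp [fold, endHom, (exists_endHom f hf).choose_spec b]

end fold

-- Induction adapted to the recursion of `fold`: one generator at a time is multiplied on the left.
-- Proving the claim for `u * v` with arbitrary `v` makes the case of a product formal.
@[elab_as_elim]
theorem ι_mul_induction {motive : SymmAlg S M → Prop} (one : motive 1)
    (smul : ∀ (c : S) u, motive u → motive (c • u))
    (add : ∀ u v, motive u → motive v → motive (u + v))
    (ι_mul : ∀ b u, motive u → motive (ι S M b * u)) (u : SymmAlg S M) : motive u := by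
  suffices h : ∀ v, motive v → motive (u * v) by simpa using h 1 one
  induction u using SymmAlg.induction with
  | algebraMap r => intro v hv; rw [← Algebra.smul_def]; exact smul r v hv
  | ι b => exact ι_mul b
  | mul a b ha hb => intro v hv; rw [mul_assoc]; exact ha _ (hb _ hv)
  | add a b ha hb => intro v hv; rw [add_mul]; exact add _ _ (ha _ hv) (hb _ hv)

/-! ### Derivation, coproduct and grading of the symmetric algebra -/

/-- Multiplication by an element of `M`. -/
def mulι : M →ₗ[S] Module.End S (SymmAlg S M) :=
  (LinearMap.mul S (SymmAlg S M)) ∘ₗ ι S M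

@[simp]
theorem mulι_apply (b : M) (u : SymmAlg S M) : mulι b u = ι S M b * u := rfl

/-- The universal derivation `Sym M → Sym M ⊗ M`, together with the identity of `Sym M`. -/
def derAux : SymmAlg S M →ₗ[S]
    SymmAlg S M × (SymmAlg S M ⊗[S] M) :=
  -- `fold` passes on only the previous value, whereas the Leibniz rule also needs the element
  -- itself; hence a pair is folded.
  fold (M := M)
    { toFun := fun b => LinearMap.prod ((mulι b) ∘ₗ LinearMap.fst _ _ _)
        ((TensorProduct.mk S _ M).flip b ∘ₗ LinearMap.fst _ _ _ +
          (mulι b).rTensor M ∘ₗ LinearMap.snd _ _ _)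
      map_add' := fun a b => by
        ext x <;> simp
      map_smul' := fun c b => by
        ext x <;> simp [smul_tmul'] }
    (fun a b => by
      ext x
      · simp [mul_left_comm]
      · simp [add_comm]
      · simp
      · simp [mul_left_comm]) (1, 0)

/-- The universal derivation `Sym M → Sym M ⊗ M`. -/
def der : SymmAlg S M →ₗ[S] SymmAlg S M ⊗[S] M :=
  LinearMap.snd _ _ _ ∘ₗ derAux

@[simp]
theorem der_one : der (1 : SymmAlg S M) = 0 := by
  simp [der, derAux]

theorem fst_derAux (u : SymmAlg S M) : (derAux u).1 = u := by
  induction u using ι_mul_induction with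
  | one => simp [derAux]
  | smul c u h => simp [h]
  | add u v hu hv => simp [hu, hv]
  | ι_mul b u h =>
    rw [derAux, fold_ι_mul, ← derAux]
    simp [h]

@[simp]
theorem der_ι_mul (b : M) (u : SymmAlg S M) :
    der (ι S M b * u) = u ⊗ₜ b + (mulι b).rTensor M (der u) := by
  rw [der, LinearMap.comp_apply, derAux, fold_ι_mul, ← derAux]
  simp [fst_derAux]

/-- The comultiplication of the symmetric algebra. -/
def coprod : SymmAlg S M →ₗ[S] SymmAlg S M ⊗[S] SymmAlg S M :=
  fold (LinearMap.rTensorHom _ ∘ₗ mulι + LinearMap.lTensorHom _ ∘ₗ mulι)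
    (fun a b => by
      ext x y
      simp [mul_left_comm]
      abel) (1 ⊗ₜ 1)

@[simp]
theorem coprod_one : coprod (1 : SymmAlg S M) = 1 ⊗ₜ 1 := by
  simp [coprod]

theorem coprod_ι_mul (b : M) (u : SymmAlg S M) :
    coprod (ι S M b * u) = (mulι b).rTensor _ (coprod u) + (mulι b).lTensor _ (coprod u) := by
  rw [coprod, fold_ι_mul]
  rfl

theorem comm_coprod (u : SymmAlg S M) : TensorProduct.comm S _ _ (coprod u) = coprod u := by
  induction u using ι_mul_induction with
  | one => simp
  | smul c u h => simp [h]
  | add u v hu hv => simp [hu, hv]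
  | ι_mul b u h =>
    rw [coprod_ι_mul, map_add]
    have h1 : ∀ z : SymmAlg S M ⊗[S] SymmAlg S M,
        TensorProduct.comm S _ _ ((mulι b).rTensor _ z) =
          (mulι b).lTensor _ (TensorProduct.comm S _ _ z) := fun z => by
      induction z using TensorProduct.induction_on <;> simp_all
    have h2 : ∀ z : SymmAlg S M ⊗[S] SymmAlg S M,
        TensorProduct.comm S _ _ ((mulι b).lTensor _ z) =
          (mulι b).rTensor _ (TensorProduct.comm S _ _ z) := fun z => by
      induction z using TensorProduct.induction_on <;> simp_all
    rw [h1, h2, h, add_comm]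

/-- The homogeneous components of an element of `Sym M`. -/
def comps : SymmAlg S M →ₗ[S] ℕ →₀ SymmAlg S M :=
  fold (M := M)
    { toFun := fun b => Finsupp.lmapDomain _ S Nat.succ ∘ₗ Finsupp.mapRange.linearMap (mulι b)
      map_add' := fun a b => by
        ext : 2
        simp [add_mul, Finsupp.mapDomain_add, -Finsupp.single_mul]
      map_smul' := fun c b => by
        ext : 2
        simp [Finsupp.mapDomain_single, -Finsupp.single_mul] }
    (fun a b => by
      ext : 2
      simp [Finsupp.mapDomain_single, mul_left_comm, -Finsupp.single_mul]) (Finsupp.single 0 1)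

@[simp]
theorem comps_one : comps (1 : SymmAlg S M) = Finsupp.single 0 1 := by
  simp [comps]

theorem comps_ι_mul (b : M) (u : SymmAlg S M) :
    comps (ι S M b * u) = Finsupp.mapDomain Nat.succ
      (Finsupp.mapRange (mulι b) (map_zero _) (comps u)) := by
  simp [comps]

theorem comps_ι_mul_of_single {r : ℕ} {u : SymmAlg S M}
    (h : comps u = Finsupp.single r u) (b : M) :
    comps (ι S M b * u) = Finsupp.single (r + 1) (ι S M b * u) := by
  rw [comps_ι_mul, h, Finsupp.mapRange_single, Finsupp.mapDomain_single]
  rfl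

section map

variable (f : M →ₗ[S] N)

/-- The functoriality of the symmetric algebra. -/
def map : SymmAlg S M →ₐ[S] SymmAlg S N :=
  lift (ι S N ∘ₗ f)

@[simp]
theorem map_ι (b : M) : map f (ι S M b) = ι S N (f b) := by
  simp [map]

end map

theorem span_pow_le_range_ι_pow (m : ℕ) :
    Submodule.span S (Set.range fun b : M => ι S M b ^ m) ≤ LinearMap.range (ι S M) ^ m := by
  rw [Submodule.span_le]
  rintro _ ⟨b, rfl⟩
  exact Submodule.pow_mem_pow _ (LinearMap.mem_range_self _ b) m

/-! ### Divided powers -/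

section divPow

variable [Algebra ℚ S]

variable (S) in
theorem algebraMap_factorial_mul (m : ℕ) :
    algebraMap ℚ S (1 / (m.factorial : ℚ)) * (m.factorial : S) = 1 := by
  rw [← map_natCast (algebraMap ℚ S), ← map_mul, one_div_mul_cancel, map_one]
  exact_mod_cast m.factorial_ne_zero

variable (S) in
/-- The divided power `b ^ m / m!`. -/
def divPow (m : ℕ) (b : M) : SymmAlg S M :=
  algebraMap ℚ S (1 / (m.factorial : ℚ)) • ι S M b ^ m

@[simp]
theorem divPow_zero (b : M) : divPow S 0 b = 1 := by
  simp [divPow]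

theorem ι_pow_eq (m : ℕ) (b : M) : ι S M b ^ m = (m.factorial : S) • divPow S m b := by
  rw [divPow, smul_smul, mul_comm, algebraMap_factorial_mul, one_smul]

theorem ι_mul_divPow (m : ℕ) (b : M) :
    ι S M b * divPow S m b = ((m : S) + 1) • divPow S (m + 1) b := by
  rw [divPow, divPow, mul_smul_comm, ← pow_succ', smul_smul]
  congr 1
  have : ((m : S) + 1) = algebraMap ℚ S (m + 1) := by simp
  rw [this, ← map_mul]
  congr 1
  have := Nat.factorial_ne_zero m
  rw [Nat.factorial_succ]
  push_cast
  field_simp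

variable (S) in
theorem algebraMap_one_div_mul (m : ℕ) :
    algebraMap ℚ S (1 / ((m : ℚ) + 1)) * ((m : S) + 1) = 1 := by
  have : ((m : S) + 1) = algebraMap ℚ S (m + 1) := by simp
  rw [this, ← map_mul, one_div_mul_cancel (by positivity), map_one]

variable (S) in
theorem smul_cancel (m : ℕ) {x y : M} (h : ((m : S) + 1) • x = ((m : S) + 1) • y) : x = y := by
  rw [← one_smul S x, ← one_smul S y, ← algebraMap_one_div_mul S m, mul_smul, mul_smul, h]

/-- Multiplying a divided power of `b` by `b` gives `m + 1` times the next one, and `m + 1` is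
invertible. This turns a recursion over generators into a closed formula on divided powers. -/
theorem divPow_induction {N : Type*} [AddCommGroup N] [Module S N] (m : ℕ) (b : M)
    (F : SymmAlg S M →ₗ[S] N) (z : N)
    (h : F (ι S M b * divPow S m b) = ((m : S) + 1) • z) : F (divPow S (m + 1) b) = z := by
  rw [ι_mul_divPow, map_smul] at h
  exact smul_cancel S m h

theorem der_divPow_succ (m : ℕ) (b : M) : der (divPow S (m + 1) b) = divPow S m b ⊗ₜ[S] b := by
  induction m with
  | zero =>
    refine divPow_induction 0 b der _ ?_
    rw [divPow_zero, der_ι_mul]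
    simp
  | succ m ih =>
    refine divPow_induction _ b der _ ?_
    rw [der_ι_mul, ih, LinearMap.rTensor_tmul, mulι_apply, ι_mul_divPow, ← smul_tmul', Nat.cast_succ,
      add_comm (_ ⊗ₜ _), add_smul (_ + 1) (1 : S), one_smul]

theorem coprod_divPow (m : ℕ) (b : M) :
    coprod (divPow S m b) = ∑ x ∈ antidiagonal m, divPow S x.1 b ⊗ₜ[S] divPow S x.2 b := by
  induction m with
  | zero => simp
  | succ m ih =>
    refine divPow_induction m b coprod _ ?_
    have h1 := Finset.Nat.sum_antidiagonal_succ (n := m)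
      (f := fun x => (x.1 : S) • divPow S x.1 b ⊗ₜ[S] divPow S x.2 b)
    have h2 := Finset.Nat.sum_antidiagonal_succ' (n := m)
      (f := fun x => (x.2 : S) • divPow S x.1 b ⊗ₜ[S] divPow S x.2 b)
    -- The factor `m + 1 = x.1 + x.2` is shared between the two tensor slots; each share is one of
    -- the two terms of `coprod_ι_mul`.
    have h3 : ∀ x ∈ antidiagonal (m + 1), ((m : S) + 1) • divPow S x.1 b ⊗ₜ[S] divPow S x.2 b =
        (x.1 : S) • divPow S x.1 b ⊗ₜ[S] divPow S x.2 b +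
          (x.2 : S) • divPow S x.1 b ⊗ₜ[S] divPow S x.2 b := fun x hx => by
      rw [mem_antidiagonal] at hx
      rw [← add_smul]
      congr 1
      exact_mod_cast (congrArg (Nat.cast : ℕ → S) hx).symm
    rw [coprod_ι_mul, ih, Finset.smul_sum, Finset.sum_congr rfl h3, Finset.sum_add_distrib, h1, h2]
    simp only [map_sum, LinearMap.rTensor_tmul, LinearMap.lTensor_tmul, mulι_apply, ι_mul_divPow,
      tmul_smul, ← smul_tmul', Nat.cast_zero, zero_smul, zero_add, Nat.cast_add,
      Nat.cast_one]

theorem comps_divPow (m : ℕ) (b : M) :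
    comps (divPow S m b) = Finsupp.single m (divPow S m b) := by
  induction m with
  | zero => simp
  | succ m ih =>
    refine divPow_induction m b comps _ ?_
    rw [comps_ι_mul_of_single ih, ι_mul_divPow, Finsupp.smul_single]

theorem map_divPow (f : M →ₗ[S] N) (m : ℕ) (b : M) :
    map f (divPow S m b) = divPow S m (f b) := by
  simp [divPow]

/-- Polarization: expand `(b + k c) ^ (m + 1)` for `k = 0, …, m + 1`. The Vandermonde matrix of
these nodes is invertible over `ℚ`, so each coefficient is a combination of pure powers. -/
theorem ι_mul_pow_mem_span (m : ℕ) (b c : M) :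
    ι S M c * ι S M b ^ m ∈
      Submodule.span S (Set.range fun d : M => ι S M d ^ (m + 1)) := by
  let V : Matrix (Fin (m + 2)) (Fin (m + 2)) ℚ := Matrix.vandermonde fun k => ((k : ℕ) : ℚ)
  have hV : IsUnit V.det := by
    rw [isUnit_iff_ne_zero, Matrix.det_vandermonde_ne_zero_iff]
    intro i j h
    exact Fin.ext (Nat.cast_injective h)
  have hinv := Matrix.nonsing_inv_mul V hV
  -- Row `1` of `V⁻¹` extracts the coefficient of `c ^ 1`.
  have key : ∑ k : Fin (m + 2), algebraMap ℚ S (V⁻¹ 1 k) •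
      ι S M (b + algebraMap ℚ S (k : ℕ) • c) ^ (m + 1) =
        ((m : S) + 1) • (ι S M c * ι S M b ^ m) := by
    have h1 : ∀ k : Fin (m + 2), algebraMap ℚ S (V⁻¹ 1 k) •
        ι S M (b + algebraMap ℚ S (k : ℕ) • c) ^ (m + 1) =
        ∑ i : Fin (m + 2), algebraMap ℚ S (V⁻¹ 1 k * V k i) •
          (ι S M c ^ (i : ℕ) * ι S M b ^ (m + 1 - i) * ((m + 1).choose i : SymmAlg S M)) := by
      intro k
      rw [map_add, map_smul, add_comm (ι S M b), add_pow, ← Fin.sum_univ_eq_sum_range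
        (fun i => (algebraMap ℚ S (k : ℕ) • ι S M c) ^ i * ι S M b ^ (m + 1 - i) *
          ((m + 1).choose i : SymmAlg S M)), Finset.smul_sum]
      refine Finset.sum_congr rfl fun i _ => ?_
      rw [smul_pow, smul_mul_assoc, smul_mul_assoc, smul_smul, map_mul, ← map_pow]
      rfl
    rw [Finset.sum_congr rfl fun k _ => h1 k, Finset.sum_comm]
    simp_rw [← Finset.sum_smul, ← map_sum, ← Matrix.mul_apply, hinv, Matrix.one_apply]
    rw [Finset.sum_eq_single 1]
    · rw [if_pos rfl, map_one, one_smul]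
      have : ((1 : Fin (m + 2)) : ℕ) = 1 := rfl
      rw [this, pow_one, Nat.choose_one_right, Nat.add_sub_cancel, mul_comm, Algebra.smul_def]
      simp
    · intro i _ hi
      rw [if_neg hi.symm, map_zero, zero_smul]
    · simp
  rw [← one_smul S (ι S M c * ι S M b ^ m), ← algebraMap_one_div_mul S m, mul_smul, ← key]
  exact Submodule.smul_mem _ _ (Submodule.sum_mem _ fun k _ => Submodule.smul_mem _ _
    (Submodule.subset_span ⟨_, rfl⟩))

theorem range_ι_pow_eq_span (m : ℕ) :
    LinearMap.range (ι S M) ^ m = Submodule.span S (Set.range fun b : M => ι S M b ^ m) := by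
  refine le_antisymm ?_ (span_pow_le_range_ι_pow m)
  · induction m with
    | zero =>
      rw [pow_zero, Submodule.one_eq_span, Submodule.span_le, Set.singleton_subset_iff]
      exact Submodule.subset_span ⟨0, by simp⟩
    | succ m ih =>
      rw [pow_succ', Submodule.mul_le]
      rintro _ ⟨c, rfl⟩ u hu
      induction ih hu using Submodule.span_induction with
      | mem x hx => obtain ⟨b, rfl⟩ := hx; exact ι_mul_pow_mem_span m b c
      | zero => simp
      | add x y hx hy h1 h2 =>
        rw [mul_add]
        exact Submodule.add_mem _ (h1 (span_pow_le_range_ι_pow m hx)) (h2 (span_pow_le_range_ι_pow m hy))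
      | smul r x hx h1 =>
        rw [mul_smul_comm]
        exact Submodule.smul_mem _ _ (h1 (span_pow_le_range_ι_pow m hx))

/-- Pure powers span each `Sym^m` by polarization, so linear identities on `Sym M` need checking
only on divided powers. Most formulas below are proved in this way. -/
theorem linearMap_ext_of_divPow {F G : SymmAlg S M →ₗ[S] N}
    (h : ∀ m b, F (divPow S m b) = G (divPow S m b)) : F = G := by
  have h1 : ∀ m, ∀ u ∈ LinearMap.range (ι S M) ^ m, F u = G u := by
    intro m u hu
    rw [range_ι_pow_eq_span] at hu
    induction hu using Submodule.span_induction with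
    | mem x hx => obtain ⟨b, rfl⟩ := hx; dsimp only; rw [ι_pow_eq, map_smul, map_smul, h]
    | zero => simp
    | add x y _ _ hx hy => rw [map_add, map_add, hx, hy]
    | smul r x _ hx => rw [map_smul, map_smul, hx]
  ext u
  suffices h : u ∈ ⨆ m : ℕ, LinearMap.range (ι S M) ^ m by
    induction h using Submodule.iSup_induction' with
    | mem m x hx => exact h1 m x hx
    | zero => simp
    | add x y _ _ hx hy => rw [map_add, map_add, hx, hy]
  induction u using ι_mul_induction with
  | one => exact Submodule.mem_iSup_of_mem 0 (by rw [pow_zero]; exact Submodule.one_le.1 le_rfl)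
  | smul c u h => exact Submodule.smul_mem _ _ h
  | add u v hu hv => exact Submodule.add_mem _ hu hv
  | ι_mul b u h =>
    induction h using Submodule.iSup_induction' with
    | mem m x hx =>
      refine Submodule.mem_iSup_of_mem (m + 1) ?_
      rw [pow_succ']
      exact Submodule.mul_mem_mul (LinearMap.mem_range_self _ b) hx
    | zero => simp
    | add x y _ _ hx hy => rw [mul_add]; exact Submodule.add_mem _ hx hy

end divPow

end SymmAlg

/-- Both sides run over the triples of natural numbers with sum `m`. -/
theorem sum_antidiagonal_assoc {N : Type*} [AddCommMonoid N] (f : ℕ → ℕ → ℕ → N) (m : ℕ) :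
    ∑ p ∈ antidiagonal m, ∑ q ∈ antidiagonal p.2, f p.1 q.1 q.2 =
      ∑ r ∈ antidiagonal m, ∑ p ∈ antidiagonal r.1, f p.1 p.2 r.2 := by
  rw [Finset.sum_sigma', Finset.sum_sigma']
  refine Finset.sum_nbij' (fun x => ⟨(x.1.1 + x.2.1, x.2.2), (x.1.1, x.2.1)⟩)
    (fun x => ⟨(x.2.1, x.2.2 + x.1.2), (x.2.2, x.1.2)⟩) ?_ ?_ ?_ ?_ ?_
  · rintro ⟨⟨a, b⟩, c, d⟩ h
    simp only [Finset.mem_sigma, mem_antidiagonal] at h ⊢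
    exact ⟨by omega, trivial⟩
  · rintro ⟨⟨a, b⟩, c, d⟩ h
    simp only [Finset.mem_sigma, mem_antidiagonal] at h ⊢
    exact ⟨by omega, trivial⟩
  · rintro ⟨⟨a, b⟩, c, d⟩ h
    simp only [Finset.mem_sigma, mem_antidiagonal] at h ⊢
    obtain ⟨rfl, rfl⟩ := h
    rfl
  · rintro ⟨⟨a, b⟩, c, d⟩ h
    simp only [Finset.mem_sigma, mem_antidiagonal] at h ⊢
    obtain ⟨rfl, rfl⟩ := h
    rfl
  · intros
    rfl

/-! ## A functional equation for the Bernoulli generating series -/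

section Bernoulli

/-- The coefficient `B_t / t!` of `x / (e ^ x - 1)`. -/
def bernoulliCoeff (t : ℕ) : ℚ := bernoulli t / (t.factorial : ℚ)

variable {A : Type*} [CommRing A] [Algebra ℚ A]

open PowerSeries in
/-- The functional equation of `f = x / (e ^ x - 1)`:
`f(u) (f(u + v) - f(v)) / u + f(v) (f(u + v) - f(u)) / v = - f(u + v)`. -/
theorem bernoulli_functional_equation [IsDomain A] (U V : A) (hU : U ≠ 0) (hV : V ≠ 0)
    (hUV : U + V ≠ 0) (N : ℕ) :
    ∑ x ∈ antidiagonal N, algebraMap ℚ A (bernoulliCoeff x.1 * bernoulliCoeff (x.2 + 1)) *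
      ∑ y ∈ antidiagonal x.2, (U ^ x.1 * V ^ y.1 + V ^ x.1 * U ^ y.1) * (U + V) ^ y.2 =
      -(algebraMap ℚ A (bernoulliCoeff N) * (U + V) ^ N) := by
  -- `F a` and `E a` are `f(aX)` and `e^(aX) - 1`. Rescaling by elements of `A` puts the part of
  -- degree `N` of the two-variable identity into the coefficient of `X ^ N`.
  let F : A → PowerSeries A := fun a => rescale a (bernoulliPowerSeries A)
  let E : A → PowerSeries A := fun a => rescale a (exp A) - 1
  have hF : ∀ a n, coeff n (F a) = algebraMap ℚ A (bernoulliCoeff n) * a ^ n := fun a n => by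
    simp [F, bernoulliPowerSeries, coeff_rescale, bernoulliCoeff, mul_comm]
  -- The divided difference `(F b - F a) / ((b - a) X)`, written out without division.
  let Q : A → A → PowerSeries A := fun a b => PowerSeries.mk fun s =>
    algebraMap ℚ A (bernoulliCoeff (s + 1)) * ∑ y ∈ antidiagonal s, a ^ y.1 * b ^ y.2
  have hFE : ∀ a, F a * E a = C a * X := fun a => by
    have := congrArg (rescale a) (bernoulliPowerSeries_mul_exp_sub_one A)
    rwa [map_mul, map_sub, map_one, rescale_X] at this
  have hE : ∀ a b, E (a + b) = E a + E b + E a * E b := fun a b => by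
    have := exp_mul_exp_eq_exp_add (A := A) a b
    simp only [E]
    rw [← this]
    ring
  have hE0 : ∀ a, a ≠ 0 → E a ≠ 0 := fun a ha h => by
    have := hFE a
    rw [h, mul_zero] at this
    have h1 := congrArg (coeff 1) this
    simp at h1
    exact ha h1.symm
  have hQ : ∀ a b, C (b - a) * X * Q a b = F b - F a := fun a b => by
    ext n
    rcases n with _ | n
    · rw [map_sub (coeff 0) (F b), hF, hF]
      simp
    · rw [mul_assoc, coeff_C_mul, coeff_succ_X_mul, map_sub, hF, hF, coeff_mk,
        mul_left_comm, ← mul_sub]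
      congr 1
      have := (Commute.all b a).mul_geom_sum₂ (n + 1)
      rw [← this, Finset.Nat.sum_antidiagonal_eq_sum_range_succ (fun i j => a ^ i * b ^ j),
        ← Finset.sum_range_reflect]
      congr 1
      refine Finset.sum_congr rfl fun i hi => ?_
      have := Finset.mem_range.1 hi
      rw [mul_comm]
      congr 2
      all_goals omega
  have key : F U * Q V (U + V) + F V * Q U (U + V) = - F (U + V) := by
    -- Power series over a domain form a domain, so denominators may be cleared. What is left
    -- follows from `F a * E a = a X`, from the definition of `Q` and from `e^(U+V) = e^U e^V`.
    have hne : C U * C V * X * E U * E V * E (U + V) ≠ (0 : PowerSeries A) := by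
      have hC : ∀ a : A, a ≠ 0 → C a ≠ (0 : PowerSeries A) := fun a ha h =>
        ha (by simpa using congrArg (coeff 0) h)
      exact mul_ne_zero (mul_ne_zero (mul_ne_zero (mul_ne_zero (mul_ne_zero (hC _ hU) (hC _ hV))
        X_ne_zero) (hE0 _ hU)) (hE0 _ hV)) (hE0 _ hUV)
    refine mul_left_cancel₀ hne ?_
    have h1 := hQ V (U + V)
    have h2 := hQ U (U + V)
    rw [add_sub_cancel_right] at h1
    rw [add_sub_cancel_left] at h2
    have e1 := hFE U
    have e2 := hFE V
    have e3 := hFE (U + V)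
    have e4 := hE U V
    rw [map_add] at e3
    linear_combination C V * E U * E V * E (U + V) * F U * h1 +
      C U * E U * E V * E (U + V) * F V * h2 +
      (C V * F U * E U * E V + C U * F V * E U * E V + C U * C V * X * E U * E V) * e3 +
      ((C U + C V) * X * C V * E V - (C U + C V) * F V * E V * E (U + V)) * e1 +
      ((C U + C V) * X * C U * E U - (C U + C V) * C U * X * E (U + V)) * e2 -
      (C U + C V) * C U * C V * X ^ 2 * e4
  have := congrArg (coeff N) key
  rw [map_add, map_neg, hF, coeff_mul, coeff_mul, ← Finset.sum_add_distrib] at this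
  rw [← this]
  refine Finset.sum_congr rfl fun x _ => ?_
  simp only [hF, Q, coeff_mk, map_mul, add_mul, Finset.sum_add_distrib, mul_add, mul_assoc,
    ← Finset.mul_sum]
  ring

end Bernoulli

/-! ## The right action of a Lie algebra on its symmetric algebra -/

section LieRight

variable {S : Type*} [CommRing S] {L : Type*} [LieRing L] [LieAlgebra S L]

variable (S) in
/-- The right adjoint action `x ↦ ⁅x, b⁆`. -/
def lieRight : L →ₗ[S] Module.End S L :=
  LinearMap.mk₂ S (fun b x => ⁅x, b⁆) (fun _ _ _ => lie_add _ _ _) (fun _ _ _ => lie_smul _ _ _)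
    (fun _ _ _ => add_lie _ _ _) (fun _ _ _ => smul_lie _ _ _)

@[simp]
theorem lieRight_apply (b x : L) : lieRight S b x = ⁅x, b⁆ := rfl

/-- The linear map `U ^ i * V ^ j ↦ ⁅x @ b ^ i, y @ b ^ j⁆`. -/
def bracketEval (b x y : L) : MvPolynomial (Fin 2) S →ₗ[S] L :=
  (MvPolynomial.basisMonomials (Fin 2) S).constr S fun m =>
    ⁅(lieRight S b ^ m 0) x, (lieRight S b ^ m 1) y⁆

theorem bracketEval_monomial (b x y : L) (m : Fin 2 →₀ ℕ) :
    bracketEval b x y (MvPolynomial.monomial m (1 : S)) =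
      ⁅(lieRight S b ^ m 0) x, (lieRight S b ^ m 1) y⁆ := by
  have := (MvPolynomial.basisMonomials (Fin 2) S).constr_basis S
    (fun m => ⁅(lieRight S b ^ m 0) x, (lieRight S b ^ m 1) y⁆) m
  rwa [MvPolynomial.coe_basisMonomials] at this

theorem bracketEval_X_pow_mul_X_pow (b x y : L) (i j : ℕ) :
    bracketEval b x y (MvPolynomial.X 0 ^ i * MvPolynomial.X 1 ^ j : MvPolynomial (Fin 2) S) =
      ⁅(lieRight S b ^ i) x, (lieRight S b ^ j) y⁆ := by
  rw [MvPolynomial.X_pow_eq_monomial, MvPolynomial.X_pow_eq_monomial, MvPolynomial.monomial_mul,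
    one_mul, bracketEval_monomial]
  simp

/-- Leibniz rule: bracketing `⁅x @ b ^ i, y @ b ^ j⁆` with `b` raises either `i` or `j` by one, so
`U + V` acts as `@ b`. -/
theorem bracketEval_X_add_X_mul (b x y : L) (p : MvPolynomial (Fin 2) S) :
    bracketEval b x y (p * (MvPolynomial.X 0 + MvPolynomial.X 1)) =
      lieRight S b (bracketEval b x y p) := by
  induction p using MvPolynomial.induction_on' with
  | monomial m a =>
    have h : MvPolynomial.monomial m a =
        a • (MvPolynomial.X 0 ^ m 0 * MvPolynomial.X 1 ^ m 1 : MvPolynomial (Fin 2) S) := by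
      rw [MvPolynomial.X_pow_eq_monomial, MvPolynomial.X_pow_eq_monomial,
        MvPolynomial.monomial_mul, MvPolynomial.smul_monomial, one_mul, smul_eq_mul, mul_one]
      have hm : m = Finsupp.single 0 (m 0) + Finsupp.single 1 (m 1) := by
        refine Finsupp.ext fun i => ?_
        fin_cases i <;> simp
      rw [← hm]
    rw [h, smul_mul_assoc, map_smul, map_smul, map_smul, bracketEval_X_pow_mul_X_pow, mul_add,
      mul_right_comm, mul_assoc _ _ (MvPolynomial.X 1), ← pow_succ, ← pow_succ, map_add,
      bracketEval_X_pow_mul_X_pow, bracketEval_X_pow_mul_X_pow, pow_succ', pow_succ']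
    simp only [Module.End.mul_apply, lieRight_apply]
    rw [lie_lie _ _ b, ← lie_skew ⁅_, b⁆]
    congr 1
    abel
  | add p q hp hq => rw [add_mul, map_add, map_add, map_add, hp, hq]

theorem bracketEval_X_add_X_pow_mul (b x y : L) (p : MvPolynomial (Fin 2) S) (n : ℕ) :
    bracketEval b x y (p * (MvPolynomial.X 0 + MvPolynomial.X 1) ^ n) =
      (lieRight S b ^ n) (bracketEval b x y p) := by
  induction n with
  | zero => simp
  | succ n ih => rw [pow_succ, ← mul_assoc, bracketEval_X_add_X_mul, ih, pow_succ']; rfl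

section Bernoulli

variable [Algebra ℚ S]

/-- The image of the functional equation under `bracketEval`. The equation is used in `ℚ[U, V]`, a
domain, and only then carried to `S`, which may have zero divisors. -/
theorem bernoulli_bracket (b x y : L) (N : ℕ) :
    ∑ p ∈ antidiagonal N, algebraMap ℚ S (bernoulliCoeff p.1 * bernoulliCoeff (p.2 + 1)) •
      ∑ q ∈ antidiagonal p.2, (lieRight S b ^ q.2)
        (⁅(lieRight S b ^ q.1) y, (lieRight S b ^ p.1) x⁆ -
          ⁅(lieRight S b ^ q.1) x, (lieRight S b ^ p.1) y⁆) =
      algebraMap ℚ S (bernoulliCoeff N) • (lieRight S b ^ N) ⁅x, y⁆ := by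
  have hne : (MvPolynomial.X 0 + MvPolynomial.X 1 : MvPolynomial (Fin 2) ℚ) ≠ 0 := fun h => by
    have := congrArg (MvPolynomial.eval fun _ => 1) h
    norm_num at this
  have h := bernoulli_functional_equation (A := MvPolynomial (Fin 2) ℚ) (MvPolynomial.X 0)
    (MvPolynomial.X 1) (MvPolynomial.X_ne_zero 0) (MvPolynomial.X_ne_zero 1) hne N
  have h1 := congrArg (fun p => -bracketEval b x y (MvPolynomial.map (algebraMap ℚ S) p)) h
  simp only [map_sum, map_mul, map_neg, map_add, map_pow, MvPolynomial.map_X, neg_neg,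
    MvPolynomial.algebraMap_eq, MvPolynomial.map_C] at h1
  simp only [← map_mul, ← MvPolynomial.smul_eq_C_mul, map_smul, ← Finset.sum_neg_distrib] at h1
  have h2 := bracketEval_X_add_X_pow_mul (S := S) b x y 1 N
  have h3 := bracketEval_X_pow_mul_X_pow (S := S) b x y 0 0
  rw [pow_zero, pow_zero, mul_one] at h3
  rw [one_mul, h3] at h2
  rw [h2] at h1
  simp only [pow_zero, Module.End.one_apply] at h1
  rw [← h1]
  refine Finset.sum_congr rfl fun p _ => ?_
  rw [← smul_neg]
  congr 1
  rw [map_sum, ← Finset.sum_neg_distrib]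
  refine Finset.sum_congr rfl fun q _ => ?_
  rw [bracketEval_X_add_X_pow_mul, ← map_neg]
  congr 1
  rw [map_add, bracketEval_X_pow_mul_X_pow, mul_comm, bracketEval_X_pow_mul_X_pow, neg_add,
    lie_skew, sub_eq_add_neg]

end Bernoulli

/-! ### The coderivations of the symmetric algebra -/

open SymmAlg

/-- The contraction `u ⊗ x ↦ ∑ u' ⊗ ⁅x, b'⁆`, where `∑ u' ⊗ b'` is the derivative of `u`. -/
def contr : Module.End S (SymmAlg S L ⊗[S] L) :=
  (TensorProduct.lift (lieRight S)).lTensor _ ∘ₗ (TensorProduct.assoc S _ _ _).toLinearMap ∘ₗ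
    der.rTensor L

theorem contr_one (x : L) : contr ((1 : SymmAlg S L) ⊗ₜ[S] x) = 0 := by
  simp [contr]

theorem contr_divPow_succ [Algebra ℚ S] (m : ℕ) (b x : L) :
    contr (divPow S (m + 1) b ⊗ₜ[S] x) = divPow S m b ⊗ₜ[S] ⁅x, b⁆ := by
  simp [contr, der_divPow_succ]

/-- The derivative of `z * u` hits either `u` or `z`; in the second case `z` enters the bracket. -/
theorem contr_mulι (z : L) (w : SymmAlg S L ⊗[S] L) :
    contr ((mulι z).rTensor L w) =
      (mulι z).rTensor L (contr w) + (lieRight S z).lTensor _ w := by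
  induction w using TensorProduct.induction_on with
  | zero => simp
  | add x y hx hy => simp only [map_add, hx, hy]; abel
  | tmul u x =>
    simp only [contr, LinearMap.rTensor_tmul, LinearMap.comp_apply, mulι_apply, der_ι_mul,
      add_tmul, map_add, LinearMap.lTensor_tmul, LinearEquiv.coe_coe, assoc_tmul, lift.tmul]
    rw [add_comm]
    congr 1
    generalize der u = v
    induction v using TensorProduct.induction_on with
    | zero => simp
    | add x y hx hy => simp only [map_add, add_tmul, hx, hy]
    | tmul u y => simp

/-- Each contraction moves one `b` from the divided power into the bracket, with no numerical
factor. Thus powers of one linear operator express `x @ b ^ t`, although this is not linear in `b`.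
-/
theorem contr_pow_divPow [Algebra ℚ S] (t k : ℕ) (b x : L) :
    (contr ^ t) (divPow S (t + k) b ⊗ₜ[S] x) = divPow S k b ⊗ₜ[S] (lieRight S b ^ t) x := by
  induction t generalizing x with
  | zero => simp
  | succ t ih =>
    rw [pow_succ, Module.End.mul_apply, add_right_comm, contr_divPow_succ, ih, pow_succ]
    rfl

/-- Among the `s + 1` contractions, `z` is used by none or by exactly one; the sum runs over the
position of that one. -/
theorem contr_pow_mulι (s : ℕ) (z : L) (w : SymmAlg S L ⊗[S] L) :
    (contr ^ (s + 1)) ((mulι z).rTensor L w) = (mulι z).rTensor L ((contr ^ (s + 1)) w) +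
      ∑ q ∈ antidiagonal s, (contr ^ q.2) ((lieRight S z).lTensor _ ((contr ^ q.1) w)) := by
  induction s with
  | zero => simp [contr_mulι]
  | succ s ih =>
    rw [pow_succ' contr (s + 1), Module.End.mul_apply, Module.End.mul_apply, ih, map_add,
      contr_mulι, add_assoc, Finset.Nat.sum_antidiagonal_succ', pow_zero, Module.End.one_apply,
      map_sum]
    simp only [pow_succ' contr (_ : ℕ), Module.End.mul_apply]

/-- The multiplication `u ⊗ x ↦ x * u`. -/
def mulTensor : SymmAlg S L ⊗[S] L →ₗ[S] SymmAlg S L :=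
  TensorProduct.lift mulι.flip

@[simp]
theorem mulTensor_tmul (u : SymmAlg S L) (x : L) :
    mulTensor (u ⊗ₜ[S] x) = ι S L x * u := rfl

theorem mulTensor_mulι (z : L) (w : SymmAlg S L ⊗[S] L) :
    mulTensor ((mulι z).rTensor L w) = ι S L z * mulTensor w := by
  induction w using TensorProduct.induction_on with
  | zero => simp
  | add x y hx hy => simp only [map_add, hx, hy, mul_add]
  | tmul u x => simp [mul_left_comm]

variable [Algebra ℚ S]

variable (S) in
/-- The right action of a Lie algebra `L` on `Sym L` by coderivations, corresponding to the right
multiplication on the enveloping algebra: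
`b ^ m / m! ↦ ∑_t (B_t / t!) * (x @ b ^ t) * b ^ (m - t) / (m - t)!`. -/
def symAct : L →ₗ[S] Module.End S (SymmAlg S L) :=
  -- The sum over `t` stops at the degree `r` of the argument, so the argument is first split by
  -- `comps`.
  ((Finsupp.lsum S fun r => TensorProduct.curry (∑ p ∈ antidiagonal r,
    algebraMap ℚ S (bernoulliCoeff p.1) • mulTensor ∘ₗ contr ^ p.1)) ∘ₗ comps).flip

theorem symAct_of_comps {r : ℕ} {u : SymmAlg S L} (h : comps u = Finsupp.single r u)
    (x : L) : symAct S x u = ∑ p ∈ antidiagonal r,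
      algebraMap ℚ S (bernoulliCoeff p.1) • mulTensor ((contr ^ p.1) (u ⊗ₜ x)) := by
  simp [symAct, h, LinearMap.sum_apply]

theorem symAct_divPow (m : ℕ) (b x : L) :
    symAct S x (divPow S m b) = ∑ p ∈ antidiagonal m,
      algebraMap ℚ S (bernoulliCoeff p.1) •
        (ι S L ((lieRight S b ^ p.1) x) * divPow S p.2 b) := by
  rw [symAct_of_comps (comps_divPow m b)]
  refine Finset.sum_congr rfl fun p hp => ?_
  rw [mem_antidiagonal] at hp
  rw [← hp, contr_pow_divPow, mulTensor_tmul]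

/-- Needed because one application of the action to a divided power yields products `z * b ^ k /
k!`, and a second one must be evaluated on these. Either `z` stays outside, or it enters the bracket
at one place, which uses up one more Bernoulli index. -/
theorem symAct_ι_mul_divPow (k : ℕ) (b y z : L) :
    symAct S y (ι S L z * divPow S k b) = ι S L z * symAct S y (divPow S k b) +
      ∑ p ∈ antidiagonal k, algebraMap ℚ S (bernoulliCoeff (p.1 + 1)) •
        ∑ q ∈ antidiagonal p.1,
          ι S L ((lieRight S b ^ q.2) ⁅(lieRight S b ^ q.1) y, z⁆) * divPow S p.2 b := by
  -- `z * b ^ k` has degree `k + 1`, one more than `b ^ k`; this vanishing removes the extra last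
  -- term from the part where `z` stays outside.
  have h0 : (contr ^ (k + 1)) (divPow S k b ⊗ₜ[S] y) = 0 := by
    have := contr_pow_divPow (S := S) k 0 b y
    rw [add_zero] at this
    rw [pow_succ', Module.End.mul_apply, this, divPow_zero, contr_one]
  have e : (ι S L z * divPow S k b) ⊗ₜ[S] y = (mulι z).rTensor L (divPow S k b ⊗ₜ y) := rfl
  rw [symAct_of_comps (comps_ι_mul_of_single (comps_divPow k b) z), e,
    Finset.Nat.sum_antidiagonal_succ]
  simp only [contr_pow_mulι, map_add, smul_add, Finset.sum_add_distrib]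
  rw [← add_assoc]
  congr 1
  · rw [symAct_of_comps (comps_divPow k b), Finset.mul_sum]
    have := Finset.Nat.sum_antidiagonal_succ (n := k) (f := fun p : ℕ × ℕ =>
      algebraMap ℚ S (bernoulliCoeff p.1) • mulTensor ((mulι z).rTensor L
        ((contr ^ p.1) (divPow S k b ⊗ₜ[S] y))))
    dsimp only at this ⊢
    rw [pow_zero, Module.End.one_apply] at this ⊢
    rw [← this, Finset.Nat.sum_antidiagonal_succ']
    dsimp only
    rw [h0, map_zero, map_zero, smul_zero, zero_add]
    refine Finset.sum_congr rfl fun p _ => ?_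
    rw [mulTensor_mulι, mul_smul_comm]
  · refine Finset.sum_congr rfl fun p hp => ?_
    rw [map_sum]
    congr 1
    refine Finset.sum_congr rfl fun q hq => ?_
    rw [mem_antidiagonal] at hp hq
    have h1 : k = q.1 + (q.2 + p.2) := by omega
    rw [h1, contr_pow_divPow, LinearMap.lTensor_tmul, contr_pow_divPow, mulTensor_tmul,
      lieRight_apply]

/-- The law of a right module. In the double action, the terms keeping `x` and `y` in different
factors are symmetric in them and cancel in the commutator. The terms with a bracket of `x` and `y`
are summed by `bernoulli_bracket`, for each remaining power of `b`. -/
theorem symAct_symAct (x y : L) (u : SymmAlg S L) :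
    symAct S y (symAct S x u) - symAct S x (symAct S y u) = symAct S ⁅x, y⁆ u := by
  suffices h : symAct S y ∘ₗ symAct S x - symAct S x ∘ₗ symAct S y = symAct S ⁅x, y⁆ from
    LinearMap.congr_fun h u
  refine linearMap_ext_of_divPow fun m b => ?_
  have key : ∀ x y : L, symAct S y (symAct S x (divPow S m b)) =
      (∑ r ∈ antidiagonal m, ∑ p ∈ antidiagonal r.1,
        algebraMap ℚ S (bernoulliCoeff p.1 * bernoulliCoeff p.2) •
          (ι S L ((lieRight S b ^ p.1) x) * (ι S L ((lieRight S b ^ p.2) y) * divPow S r.2 b))) +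
      ∑ r ∈ antidiagonal m, ι S L (∑ p ∈ antidiagonal r.1,
        algebraMap ℚ S (bernoulliCoeff p.1 * bernoulliCoeff (p.2 + 1)) •
          ∑ q ∈ antidiagonal p.2, (lieRight S b ^ q.2)
            ⁅(lieRight S b ^ q.1) y, (lieRight S b ^ p.1) x⁆) * divPow S r.2 b := by
    intro x y
    rw [symAct_divPow, map_sum]
    simp only [map_smul, symAct_ι_mul_divPow, smul_add, Finset.sum_add_distrib]
    congr 1
    · simp only [symAct_divPow, Finset.mul_sum, Finset.smul_sum, mul_smul_comm, smul_smul,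
        ← map_mul]
      exact sum_antidiagonal_assoc (fun i j k =>
        algebraMap ℚ S (bernoulliCoeff i * bernoulliCoeff j) •
          (ι S L ((lieRight S b ^ i) x) * (ι S L ((lieRight S b ^ j) y) * divPow S k b))) m
    · simp only [map_sum, map_smul, Finset.sum_mul, Finset.smul_sum, smul_mul_assoc, smul_smul,
        ← map_mul]
      exact sum_antidiagonal_assoc (fun i j k =>
        ∑ q ∈ antidiagonal j, algebraMap ℚ S (bernoulliCoeff i * bernoulliCoeff (j + 1)) •
          (ι S L ((lieRight S b ^ q.2)
            ⁅(lieRight S b ^ q.1) y, (lieRight S b ^ i) x⁆) * divPow S k b)) m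
  rw [LinearMap.sub_apply, LinearMap.comp_apply, LinearMap.comp_apply, key, key, symAct_divPow,
    add_sub_add_comm, ← Finset.sum_sub_distrib, ← Finset.sum_sub_distrib]
  rw [Finset.sum_eq_zero, zero_add]
  · refine Finset.sum_congr rfl fun r _ => ?_
    rw [← sub_mul, ← map_sub, ← Finset.sum_sub_distrib]
    simp only [← smul_sub, ← Finset.sum_sub_distrib, ← map_sub]
    rw [bernoulli_bracket, map_smul, smul_mul_assoc]
  · intro r _
    rw [sub_eq_zero, ← Finset.Nat.sum_antidiagonal_swap]
    refine Finset.sum_congr rfl fun p _ => ?_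
    rw [mul_comm (bernoulliCoeff _), mul_left_comm (ι S L _)]
    rfl

/-- The element `x @ b ^ t` is primitive, so it goes into one tensor slot while the powers of `b`
are distributed over both. Each half is a sum over triples of exponents, rearranged by
`sum_antidiagonal_assoc`. -/
theorem coprod_symAct (x : L) (u : SymmAlg S L) :
    coprod (symAct S x u) =
      (symAct S x).rTensor _ (coprod u) +
        (symAct S x).lTensor _ (coprod u) := by
  suffices h : coprod ∘ₗ symAct S x =
      (symAct S x).rTensor _ ∘ₗ coprod + (symAct S x).lTensor _ ∘ₗ coprod from
    LinearMap.congr_fun h u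
  refine linearMap_ext_of_divPow fun m b => ?_
  rw [LinearMap.add_apply, LinearMap.comp_apply, LinearMap.comp_apply, LinearMap.comp_apply,
    coprod_divPow, symAct_divPow]
  simp only [map_sum, map_smul, coprod_ι_mul, coprod_divPow, LinearMap.rTensor_tmul,
    LinearMap.lTensor_tmul, mulι_apply, smul_add, Finset.sum_add_distrib, symAct_divPow,
    sum_tmul, tmul_sum, Finset.smul_sum, tmul_smul, ← smul_tmul']
  congr 1
  · exact sum_antidiagonal_assoc (fun i j k => algebraMap ℚ S (bernoulliCoeff i) •
      ((ι S L ((lieRight S b ^ i) x) * divPow S j b) ⊗ₜ[S] divPow S k b)) m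
  · refine (sum_antidiagonal_assoc (fun i j k => algebraMap ℚ S (bernoulliCoeff i) •
      (divPow S j b ⊗ₜ[S] (ι S L ((lieRight S b ^ i) x) * divPow S k b))) m).trans ?_
    refine Eq.trans ?_ (sum_antidiagonal_assoc (fun i j k => algebraMap ℚ S (bernoulliCoeff j) •
      (divPow S i b ⊗ₜ[S] (ι S L ((lieRight S b ^ j) x) * divPow S k b))) m).symm
    exact Finset.sum_congr rfl fun r _ => Finset.Nat.sum_antidiagonal_swap
      (f := fun p : ℕ × ℕ => algebraMap ℚ S (bernoulliCoeff p.2) •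
        (divPow S p.1 b ⊗ₜ[S] (ι S L ((lieRight S b ^ p.2) x) * divPow S r.2 b)))

end LieRight

/-- Coassociativity of a comultiplication. -/
def LinearMap.IsCoassoc {S : Type*} [CommRing S] {M : Type*} [AddCommGroup M] [Module S M]
    (Δ : M →ₗ[S] M ⊗[S] M) : Prop :=
  ∀ x, TensorProduct.assoc S M M M (Δ.rTensor M (Δ x)) = Δ.lTensor M (Δ x)

/-- Graded cocommutativity of a comultiplication, in terms of the sign operator `τ`. -/
def LinearMap.IsGradedCocomm {S : Type*} [CommRing S] {M : Type*} [AddCommGroup M] [Module S M]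
    (Δ : M →ₗ[S] M ⊗[S] M) (τ : M →ₗ[S] M) : Prop :=
  -- Since `2 (-1)^(pq) = 1 + (-1)^p + (-1)^q - (-1)^(p+q)`, the doubled Koszul sign is expressible
  -- through `τ`, without choosing components.
  ∀ x, (2 : S) • TensorProduct.comm S M M (Δ x) =
    (LinearMap.id + τ.rTensor M + τ.lTensor M - TensorProduct.map τ τ :
      Module.End S (M ⊗[S] M)) (Δ x)

theorem SymmAlg.coprod_coassoc {S : Type*} [CommRing S] [Algebra ℚ S] {M : Type*}
    [AddCommGroup M] [Module S M] : (coprod (S := S) (M := M)).IsCoassoc := fun u => by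
  refine LinearMap.congr_fun
    (f := (TensorProduct.assoc S _ _ _).toLinearMap ∘ₗ coprod.rTensor _ ∘ₗ coprod)
    (g := coprod.lTensor _ ∘ₗ coprod) (linearMap_ext_of_divPow fun m b => ?_) u
  simp only [LinearMap.comp_apply, LinearEquiv.coe_coe, coprod_divPow, map_sum,
    LinearMap.rTensor_tmul, LinearMap.lTensor_tmul, sum_tmul, tmul_sum, assoc_tmul]
  exact (sum_antidiagonal_assoc (fun i j k => divPow S i b ⊗ₜ[S] (divPow S j b ⊗ₜ[S] divPow S k b)) m).symm

/-! ## Chevalley-Eilenberg chains -/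

/-- The module `⋀ G ⊗ M` of Chevalley-Eilenberg chains. -/
def CEChain (S : Type*) [CommRing S] (G : Type*) [AddCommGroup G] [Module S G] (M : Type*)
    [AddCommGroup M] [Module S M] : Type _ :=
  ExteriorAlgebra S G ⊗[S] M

namespace CEChain

variable {S : Type*} [CommRing S] {G : Type*} [AddCommGroup G] [Module S G]
  {M : Type*} [AddCommGroup M] [Module S M] {N : Type*} [AddCommGroup N] [Module S N]

instance : AddCommGroup (CEChain S G M) :=
  inferInstanceAs (AddCommGroup (ExteriorAlgebra S G ⊗[S] M))

instance : Module S (CEChain S G M) :=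
  inferInstanceAs (Module S (ExteriorAlgebra S G ⊗[S] M))

/-- The chain `ω ⊗ u`. -/
def mk : ExteriorAlgebra S G →ₗ[S] M →ₗ[S] CEChain S G M :=
  TensorProduct.mk S _ _

/-- The linear map on chains defined by a bilinear map. -/
def lift (f : ExteriorAlgebra S G →ₗ[S] M →ₗ[S] N) : CEChain S G M →ₗ[S] N :=
  TensorProduct.lift f

@[simp]
theorem lift_mk (f : ExteriorAlgebra S G →ₗ[S] M →ₗ[S] N) (ω : ExteriorAlgebra S G) (u : M) :
    lift f (mk ω u) = f ω u := rfl

@[elab_as_elim]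
theorem mk_induction {motive : CEChain S G M → Prop} (zero : motive 0)
    (mk : ∀ ω u, motive (mk ω u)) (add : ∀ x y, motive x → motive y → motive (x + y))
    (x : CEChain S G M) : motive x :=
  TensorProduct.induction_on x zero mk add

/-- Exterior multiplication by an element of `G`. -/
def wedge : G →ₗ[S] Module.End S (CEChain S G M) where
  toFun a := lift (mk ∘ₗ LinearMap.mulLeft S (ExteriorAlgebra.ι S a))
  map_add' a b := by
    ext x
    induction x using mk_induction with
    | zero => simp
    | mk ω u => simp [add_mul]
    | add x y hx hy => rw [LinearMap.map_add _ x y, LinearMap.map_add _ x y, hx, hy]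
  map_smul' c a := by
    ext x
    induction x using mk_induction with
    | zero => simp
    | mk ω u => simp
    | add x y hx hy => rw [LinearMap.map_add _ x y, LinearMap.map_add _ x y, hx, hy]

@[simp]
theorem wedge_mk (a : G) (ω : ExteriorAlgebra S G) (u : M) :
    wedge a (mk ω u) = mk (ExteriorAlgebra.ι S a * ω) u := rfl

variable (S G M) in
/-- The inclusion of the coefficients as the chains of degree zero. -/
def coeff : M →ₗ[S] CEChain S G M := mk 1

theorem wedge_wedge (a : G) (x : CEChain S G M) : wedge a (wedge a x) = 0 := by
  induction x using mk_induction with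
  | zero => simp
  | mk ω u => simp [← mul_assoc]
  | add x y hx hy => simp [hx, hy]

theorem wedge_wedge_comm (a b : G) (x : CEChain S G M) :
    wedge a (wedge b x) = -wedge b (wedge a x) := by
  have := wedge_wedge (a + b) x
  simp only [map_add, LinearMap.add_apply, wedge_wedge, zero_add, add_zero] at this
  exact eq_neg_of_add_eq_zero_right this

@[elab_as_elim]
theorem induction {motive : CEChain S G M → Prop} (coeff : ∀ u, motive (coeff S G M u))
    (add : ∀ x y, motive x → motive y → motive (x + y))
    (wedge : ∀ a x, motive x → motive (wedge a x)) (x : CEChain S G M) : motive x := by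
  induction x using mk_induction with
  | zero => simpa using coeff 0
  | add x y hx hy => exact add x y hx hy
  | mk ω u =>
    induction ω using CliffordAlgebra.left_induction with
    | algebraMap r =>
      rw [Algebra.algebraMap_eq_smul_one, map_smul, LinearMap.smul_apply, ← map_smul]
      exact coeff (r • u)
    | add x y hx hy => rw [map_add, LinearMap.add_apply]; exact add _ _ hx hy
    | ι_mul x a hx => exact wedge a _ hx

theorem hom_ext {F F' : CEChain S G M →ₗ[S] N} (coeff : ∀ u, F (coeff S G M u) = F' (coeff S G M u))
    (wedge : ∀ a x, F x = F' x → F (wedge a x) = F' (wedge a x)) (x : CEChain S G M) :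
    F x = F' x := by
  induction x using induction with
  | coeff u => exact coeff u
  | add x y hx hy => rw [map_add, map_add, hx, hy]
  | wedge a x hx => exact wedge a x hx

/-! ### Recursion on the exterior factor -/

section fold

variable (f : G →ₗ[S] CEChain S G M × N →ₗ[S] N)
  (hf : ∀ a x y, f a (wedge a x, f a (x, y)) = 0) (f₀ : M →ₗ[S] N)

/-- The operator on `Hom(M, N)` by which `fold` is defined. -/
def foldAux : G →ₗ[S] ExteriorAlgebra S G × (M →ₗ[S] N) →ₗ[S] (M →ₗ[S] N) :=
  LinearMap.mk₂ S (fun a x => f a ∘ₗ LinearMap.prod (mk x.1) x.2)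
    (fun a b x => by ext; simp) (fun c a x => by ext; simp)
    (fun a x y => by ext; simp [← Prod.mk_add_mk]) (fun c a x => by ext; simp [← Prod.smul_mk])

include hf in
theorem foldAux_foldAux (a : G) (x : ExteriorAlgebra S G) (y : M →ₗ[S] N) :
    foldAux f a (ExteriorAlgebra.ι S a * x, foldAux f a (x, y)) =
      (0 : QuadraticForm S G) a • y := by
  ext u
  simpa [foldAux] using hf a (mk x u) (y u)

/-- The linear map `F` on chains with `F u = f₀ u` on coefficients and
`F (a ∧ x) = f a (x, F x)`. -/
def fold : CEChain S G M →ₗ[S] N :=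
  -- The exterior algebra is the Clifford algebra of the zero form. `foldr'` supplies the argument
  -- `x` next to the previous value, and values in `Hom(M, N)` carry the coefficients along.
  lift (CliffordAlgebra.foldr' (0 : QuadraticForm S G) (foldAux f) (foldAux_foldAux f hf) f₀)

@[simp]
theorem fold_coeff (u : M) : fold f hf f₀ (coeff S G M u) = f₀ u := by
  have := CliffordAlgebra.foldr'_algebraMap (0 : QuadraticForm S G) (foldAux f)
    (foldAux_foldAux f hf) f₀ 1
  rw [map_one, one_smul] at this
  exact LinearMap.congr_fun this u

@[simp]
theorem fold_wedge (a : G) (x : CEChain S G M) :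
    fold f hf f₀ (wedge a x) = f a (x, fold f hf f₀ x) := by
  induction x using mk_induction with
  | zero => simp [← Prod.zero_eq_mk]
  | add x y hx hy =>
    rw [map_add, map_add, hx, hy, ← map_add, map_add (fold f hf f₀), Prod.mk_add_mk]
  | mk ω u =>
    exact LinearMap.congr_fun (CliffordAlgebra.foldr'_ι_mul (0 : QuadraticForm S G) (foldAux f)
      (foldAux_foldAux f hf) f₀ a ω) u

end fold

section foldEnd

variable (f : G →ₗ[S] Module.End S N) (hf : ∀ a y, f a (f a y) = 0) (f₀ : M →ₗ[S] N)

/-- The linear map `F` on chains with `F u = f₀ u` on coefficients and `F (a ∧ x) = f a (F x)`. -/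
def foldEnd : CEChain S G M →ₗ[S] N :=
  fold (LinearMap.lcomp S N (LinearMap.snd S (CEChain S G M) N) ∘ₗ f) (fun a _ y => hf a y) f₀

@[simp]
theorem foldEnd_coeff (u : M) : foldEnd f hf f₀ (coeff S G M u) = f₀ u :=
  fold_coeff _ _ _ _

@[simp]
theorem foldEnd_wedge (a : G) (x : CEChain S G M) :
    foldEnd f hf f₀ (wedge a x) = f a (foldEnd f hf f₀ x) :=
  fold_wedge _ _ _ _ _

end foldEnd

/-! ### Sign operator, action and differential -/

/-- The sign operator `x ↦ (-1) ^ |x| x`. -/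
def sgn : CEChain S G M →ₗ[S] CEChain S G M :=
  foldEnd (-wedge) (fun a y => by simp [wedge_wedge]) (coeff S G M)

@[simp]
theorem sgn_coeff (u : M) : sgn (coeff S G M u) = coeff S G M u := by
  simp [sgn]

@[simp]
theorem sgn_wedge (a : G) (x : CEChain S G M) : sgn (wedge a x) = -wedge a (sgn x) := by
  simp [sgn]

@[simp]
theorem sgn_sgn (x : CEChain S G M) : sgn (sgn x) = x :=
  hom_ext (F := sgn ∘ₗ sgn) (F' := LinearMap.id) (fun u => by simp)
    (fun a x h => by
      simp only [LinearMap.comp_apply, LinearMap.id_apply] at h ⊢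
      simp [h]) x

section act

variable (β : G →ₗ[S] Module.End S G) (ρ : G →ₗ[S] Module.End S M)

/-- The operator on chains extending an endomorphism `l` of `G`, as a derivation, and an
endomorphism `R` of the coefficients. -/
def der (l : Module.End S G) (R : Module.End S M) : Module.End S (CEChain S G M) :=
  fold (LinearMap.mk₂ S (fun a x => wedge (l a) x.1 + wedge a x.2) (fun _ _ _ => by
      simp only [map_add, LinearMap.add_apply]; abel)
    (fun _ _ _ => by simp) (fun _ _ _ => by
      simp only [map_add, Prod.fst_add, Prod.snd_add]; abel) (fun _ _ _ => by simp))
    (fun a x y => by simp [wedge_wedge, wedge_wedge_comm a (l a)]) (coeff S G M ∘ₗ R)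

@[simp]
theorem der_coeff (l : Module.End S G) (R : Module.End S M) (u : M) :
    der l R (coeff S G M u) = coeff S G M (R u) := by
  simp [der]

@[simp]
theorem der_wedge (l : Module.End S G) (R : Module.End S M) (a : G) (x : CEChain S G M) :
    der l R (wedge a x) = wedge (l a) x + wedge a (der l R x) := by
  simp [der]

/-- The action of `G` on chains. -/
def act : G →ₗ[S] Module.End S (CEChain S G M) where
  toFun b := der (β b) (ρ b)
  map_add' a b := LinearMap.ext <| hom_ext (fun u => by simp) fun c x h => by
    simp only [LinearMap.add_apply] at h ⊢
    rw [der_wedge, h, der_wedge, der_wedge]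
    simp only [map_add, LinearMap.add_apply]
    abel
  map_smul' c b := LinearMap.ext <| hom_ext (fun u => by simp) fun d x h => by
    simp only [LinearMap.smul_apply, RingHom.id_apply] at h ⊢
    rw [der_wedge, h, der_wedge]
    simp

@[simp]
theorem act_coeff (b : G) (u : M) : act β ρ b (coeff S G M u) = coeff S G M (ρ b u) :=
  der_coeff _ _ _

@[simp]
theorem act_wedge (a b : G) (x : CEChain S G M) :
    act β ρ b (wedge a x) = wedge (β b a) x + wedge a (act β ρ b x) :=
  der_wedge _ _ _ _

theorem sgn_act (b : G) (x : CEChain S G M) : sgn (act β ρ b x) = act β ρ b (sgn x) :=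
  hom_ext (F := sgn ∘ₗ act β ρ b) (F' := act β ρ b ∘ₗ sgn) (fun u => by simp)
    (fun a x h => by
      simp only [LinearMap.comp_apply] at h ⊢
      simp only [act_wedge, map_add, sgn_wedge, h, map_neg]
      abel) x

/-- The action is a right representation, when `β` and `ρ` are. -/
theorem act_act (hβ : ∀ a b, β b * β a - β a * β b = β (β b a))
    (hρ : ∀ a b, ρ b * ρ a - ρ a * ρ b = ρ (β b a)) (a b : G) (x : CEChain S G M) :
    act β ρ b (act β ρ a x) - act β ρ a (act β ρ b x) = act β ρ (β b a) x :=
  hom_ext (F := act β ρ b * act β ρ a - act β ρ a * act β ρ b) (F' := act β ρ (β b a))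
    (fun u => by
      have := LinearMap.congr_fun (hρ a b) u
      simp only [LinearMap.sub_apply, Module.End.mul_apply] at this ⊢
      simp [← this])
    (fun c x h => by
      have := LinearMap.congr_fun (hβ a b) c
      simp only [LinearMap.sub_apply, Module.End.mul_apply] at this h ⊢
      simp only [act_wedge, map_add, ← this, ← h, map_sub, LinearMap.sub_apply]
      abel) x

variable (hβ : ∀ a, β a a = 0)

/-- The Chevalley-Eilenberg differential, up to the sign `(-1) ^ n` in degree `n`. -/
def ce : Module.End S (CEChain S G M) :=
  fold (LinearMap.mk₂ S (fun a x => act β ρ a x.1 - wedge a x.2) (fun _ _ _ => by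
      simp only [map_add, LinearMap.add_apply]; abel)
    (fun _ _ _ => by simp [smul_sub]) (fun _ _ _ => by
      simp only [map_add, Prod.fst_add, Prod.snd_add]; abel) (fun _ _ _ => by simp [smul_sub]))
    -- Compatibility with `a ∧ a = 0`: `a · (a ∧ x) - a ∧ (a · x) = β a a ∧ x = 0`.
    (fun a x y => by simp [wedge_wedge, hβ]) 0

@[simp]
theorem ce_coeff (u : M) : ce β ρ hβ (coeff S G M u) = 0 := by
  simp [ce]

@[simp]
theorem ce_wedge (a : G) (x : CEChain S G M) :
    ce β ρ hβ (wedge a x) = act β ρ a x - wedge a (ce β ρ hβ x) := by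
  simp [ce]

theorem sgn_ce (x : CEChain S G M) : sgn (ce β ρ hβ x) = -ce β ρ hβ (sgn x) :=
  hom_ext (F := sgn ∘ₗ ce β ρ hβ) (F' := -(ce β ρ hβ ∘ₗ sgn)) (fun u => by simp)
    (fun a x h => by
      simp only [LinearMap.comp_apply, LinearMap.neg_apply] at h ⊢
      simp [h, sgn_act]) x

section

variable (hββ : ∀ a b, β b * β a - β a * β b = β (β b a))
  (hρ : ∀ a b, ρ b * ρ a - ρ a * ρ b = ρ (β b a))

include hββ hρ

/-- On `a ∧ x` the two sides differ by a commutator of the actions of `a` and `b` on `x`, which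
`act_act` identifies with the action of `β b a`. -/
theorem ce_act (b : G) (x : CEChain S G M) :
    ce β ρ hβ (act β ρ b x) = act β ρ b (ce β ρ hβ x) :=
  hom_ext (F := ce β ρ hβ ∘ₗ act β ρ b) (F' := act β ρ b ∘ₗ ce β ρ hβ) (fun u => by simp)
    (fun a x h => by
      simp only [LinearMap.comp_apply] at h ⊢
      have := act_act β ρ hββ hρ a b x
      simp only [act_wedge, map_add, ce_wedge, h, map_sub, ← this]
      abel) x

/-- Applying `ce` twice to `a ∧ x` gives `ce (a · x) - a · ce x + a ∧ ce (ce x)`: the first two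
terms cancel by equivariance, the last vanishes by induction. -/
theorem ce_ce (x : CEChain S G M) : ce β ρ hβ (ce β ρ hβ x) = 0 :=
  hom_ext (F := ce β ρ hβ ∘ₗ ce β ρ hβ) (F' := 0) (fun u => by simp)
    (fun a x h => by
      simp only [LinearMap.comp_apply, LinearMap.zero_apply] at h ⊢
      simp [h, ce_act β ρ hβ hββ hρ]) x

end

end act

/-! ### Functoriality -/

section map

variable {G' : Type*} [AddCommGroup G'] [Module S G'] {M' : Type*} [AddCommGroup M'] [Module S M']
  (φ : G →ₗ[S] G') (χ : M →ₗ[S] M')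

/-- The functoriality of the module of chains. -/
def map : CEChain S G M →ₗ[S] CEChain S G' M' :=
  lift (mk.compl₁₂ (ExteriorAlgebra.map φ).toLinearMap χ)

@[simp]
theorem map_mk (ω : ExteriorAlgebra S G) (u : M) :
    map φ χ (mk ω u) = mk (ExteriorAlgebra.map φ ω) (χ u) := rfl

@[simp]
theorem map_coeff (u : M) : map φ χ (coeff S G M u) = coeff S G' M' (χ u) := by
  simp [coeff]

@[simp]
theorem map_wedge (a : G) (x : CEChain S G M) :
    map φ χ (wedge a x) = wedge (φ a) (map φ χ x) := by
  induction x using mk_induction with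
  | zero => simp
  | add x y hx hy => simp only [map_add, hx, hy]
  | mk ω u => simp

theorem map_sgn (x : CEChain S G M) : map φ χ (sgn x) = sgn (map φ χ x) :=
  hom_ext (F := map φ χ ∘ₗ sgn) (F' := sgn ∘ₗ map φ χ) (fun u => by simp)
    (fun a x h => by
      simp only [LinearMap.comp_apply] at h ⊢
      simp [h]) x

variable {φ χ} {β : G →ₗ[S] Module.End S G} {ρ : G →ₗ[S] Module.End S M}
  {β' : G' →ₗ[S] Module.End S G'} {ρ' : G' →ₗ[S] Module.End S M'}
  (hφ : ∀ a b, φ (β b a) = β' (φ b) (φ a)) (hχ : ∀ a u, χ (ρ a u) = ρ' (φ a) (χ u))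

include hφ hχ

theorem map_act (b : G) (x : CEChain S G M) :
    map φ χ (act β ρ b x) = act β' ρ' (φ b) (map φ χ x) :=
  hom_ext (F := map φ χ ∘ₗ act β ρ b) (F' := act β' ρ' (φ b) ∘ₗ map φ χ)
    (fun u => by simp [hχ]) (fun a x h => by
      simp only [LinearMap.comp_apply] at h ⊢
      simp [h, hφ]) x

theorem map_ce (hβ : ∀ a, β a a = 0) (hβ' : ∀ a, β' a a = 0) (x : CEChain S G M) :
    map φ χ (ce β ρ hβ x) = ce β' ρ' hβ' (map φ χ x) :=
  hom_ext (F := map φ χ ∘ₗ ce β ρ hβ) (F' := ce β' ρ' hβ' ∘ₗ map φ χ)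
    (fun u => by simp) (fun a x h => by
      simp only [LinearMap.comp_apply] at h ⊢
      simp [h, map_act hφ hχ]) x

end map

/-! ### The comultiplication -/

section comul

variable (Δ : M →ₗ[S] M ⊗[S] M)

/-- The operator `x ⊗ y ↦ (a ∧ x) ⊗ (-1) ^ |y| y + x ⊗ (a ∧ y)`. -/
def wedge₂ : G →ₗ[S] Module.End S (CEChain S G M ⊗[S] CEChain S G M) where
  -- In the sign convention the right factor is listed before the left one, so `a` passes over `y`
  -- to reach `x`.
  toFun a := TensorProduct.map (wedge a) sgn + TensorProduct.map LinearMap.id (wedge a)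
  map_add' a b := by
    rw [map_add, TensorProduct.map_add_left, TensorProduct.map_add_right]
    abel
  map_smul' c a := by
    rw [map_smul, TensorProduct.map_smul_left, TensorProduct.map_smul_right, RingHom.id_apply,
      smul_add]

theorem wedge₂_tmul (a : G) (x y : CEChain S G M) :
    wedge₂ a (x ⊗ₜ[S] y) = wedge a x ⊗ₜ sgn y + x ⊗ₜ wedge a y := rfl

theorem wedge₂_wedge₂ (a : G) (w : CEChain S G M ⊗[S] CEChain S G M) :
    wedge₂ a (wedge₂ a w) = 0 := by
  induction w using TensorProduct.induction_on with
  | zero => simp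
  | add x y hx hy => simp [hx, hy]
  | tmul x y => simp [wedge₂_tmul, wedge_wedge, tmul_neg]

/-- The comultiplication of chains, for a comultiplication of the coefficients. -/
def comul : CEChain S G M →ₗ[S] CEChain S G M ⊗[S] CEChain S G M :=
  foldEnd wedge₂ wedge₂_wedge₂ (TensorProduct.map (coeff S G M) (coeff S G M) ∘ₗ Δ)

@[simp]
theorem comul_coeff (u : M) :
    comul Δ (coeff S G M u) = TensorProduct.map (coeff S G M) (coeff S G M) (Δ u) := by
  simp [comul]

@[simp]
theorem comul_wedge (a : G) (x : CEChain S G M) :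
    comul Δ (wedge a x) = wedge₂ a (comul Δ x) := by
  simp [comul]

theorem comul_sgn (x : CEChain S G M) :
    comul Δ (sgn x) = TensorProduct.map sgn sgn (comul Δ x) := by
  refine hom_ext (F := comul Δ ∘ₗ sgn) (F' := TensorProduct.map sgn sgn ∘ₗ comul Δ)
    (fun u => ?_) (fun a x h => ?_) x
  · simp only [LinearMap.comp_apply, sgn_coeff, comul_coeff]
    generalize Δ u = v
    induction v using TensorProduct.induction_on with
    | zero => simp
    | add x y hx hy => simp only [map_add, ← hx, ← hy]
    | tmul x y => simp
  · simp only [LinearMap.comp_apply] at h ⊢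
    rw [sgn_wedge, map_neg, comul_wedge, h, comul_wedge]
    generalize comul Δ x = w
    induction w using TensorProduct.induction_on with
    | zero => simp
    | add x y hx hy => simp only [map_add, ← hx, ← hy, neg_add]
    | tmul x y => simp [wedge₂_tmul, neg_tmul, tmul_neg]; abel

/-- Both iterated coproducts intertwine `wedge a` with one and the same operator `W` on the
threefold tensor product, which reduces the claim to the coefficients. The proof of cocommutativity
has the same shape. -/
theorem comul_coassoc (hΔ : Δ.IsCoassoc) : (comul (G := G) Δ).IsCoassoc := fun x => by
  rw [LinearMap.IsCoassoc] at hΔ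
  refine hom_ext (F := (TensorProduct.assoc S _ _ _).toLinearMap ∘ₗ (comul Δ).rTensor _ ∘ₗ comul Δ)
    (F' := (comul Δ).lTensor _ ∘ₗ comul Δ) (fun u => ?_) (fun a x h => ?_) x
  · have h1 : ∀ v : M ⊗[S] M, TensorProduct.assoc S _ _ _ ((comul Δ).rTensor _
        (TensorProduct.map (coeff S G M) (coeff S G M) v)) =
        TensorProduct.map (coeff S G M) (TensorProduct.map (coeff S G M) (coeff S G M))
          (TensorProduct.assoc S M M M (Δ.rTensor M v)) := fun v => by
      induction v using TensorProduct.induction_on with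
      | zero => simp
      | add x y hx hy => simp only [map_add, hx, hy]
      | tmul x y =>
        simp only [map_tmul, LinearMap.rTensor_tmul, comul_coeff]
        generalize Δ x = z
        induction z using TensorProduct.induction_on with
        | zero => simp
        | add x y hx hy => simp only [map_add, add_tmul, hx, hy]
        | tmul x y => simp
    have h2 : ∀ v : M ⊗[S] M, (comul Δ).lTensor _
        (TensorProduct.map (coeff S G M) (coeff S G M) v) =
        TensorProduct.map (coeff S G M) (TensorProduct.map (coeff S G M) (coeff S G M))
          (Δ.lTensor M v) := fun v => by
      induction v using TensorProduct.induction_on with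
      | zero => simp
      | add x y hx hy => simp only [map_add, hx, hy]
      | tmul x y => simp
    simp only [LinearMap.comp_apply, comul_coeff, LinearEquiv.coe_coe, h1, h2, hΔ]
  · simp only [LinearMap.comp_apply, LinearEquiv.coe_coe, comul_wedge] at h ⊢
    let W : Module.End S (CEChain S G M ⊗[S] (CEChain S G M ⊗[S] CEChain S G M)) :=
      TensorProduct.map (wedge a) (TensorProduct.map sgn sgn) +
        TensorProduct.map LinearMap.id (wedge₂ a)
    have h1 : ∀ w : CEChain S G M ⊗[S] CEChain S G M,
        TensorProduct.assoc S _ _ _ ((comul Δ).rTensor _ (wedge₂ a w)) =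
          W (TensorProduct.assoc S _ _ _ ((comul Δ).rTensor _ w)) := fun w => by
      induction w using TensorProduct.induction_on with
      | zero => simp
      | add x y hx hy => simp only [map_add, hx, hy]
      | tmul x y =>
        simp only [wedge₂_tmul, map_add, LinearMap.rTensor_tmul, comul_wedge]
        generalize comul Δ x = z
        induction z using TensorProduct.induction_on with
        | zero => simp
        | add x y hx hy =>
          simp only [map_add, add_tmul] at hx hy ⊢
          rw [← hx, ← hy]
          abel
        | tmul x z => simp [W, wedge₂_tmul, add_tmul, tmul_add, add_assoc]
    have h2 : ∀ w : CEChain S G M ⊗[S] CEChain S G M,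
        (comul Δ).lTensor _ (wedge₂ a w) = W ((comul Δ).lTensor _ w) := fun w => by
      induction w using TensorProduct.induction_on with
      | zero => simp
      | add x y hx hy => simp only [map_add, hx, hy]
      | tmul x y => simp [wedge₂_tmul, W, comul_sgn]
    rw [h1, h2, h]

/-- Twice the sign operator `x ⊗ y ↦ (-1) ^ (|x| |y|) x ⊗ y`. -/
def sgn₂ : Module.End S (CEChain S G M ⊗[S] CEChain S G M) :=
  LinearMap.id + sgn.rTensor _ + sgn.lTensor _ - TensorProduct.map sgn sgn

theorem comm_comul (hΔ : ∀ u, TensorProduct.comm S M M (Δ u) = Δ u) :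
    (comul (G := G) Δ).IsGradedCocomm sgn := fun x => by
  change (2 : S) • TensorProduct.comm S _ _ (comul Δ x) = sgn₂ (comul Δ x)
  refine hom_ext (F := (2 : S) • (TensorProduct.comm S _ _).toLinearMap ∘ₗ comul Δ)
    (F' := sgn₂ ∘ₗ comul Δ) (fun u => ?_) (fun a x h => ?_) x
  · simp only [LinearMap.smul_apply, LinearMap.comp_apply, comul_coeff, LinearEquiv.coe_coe]
    have h1 : ∀ v : M ⊗[S] M, TensorProduct.comm S _ _
        (TensorProduct.map (coeff S G M) (coeff S G M) v) =
        TensorProduct.map (coeff S G M) (coeff S G M) (TensorProduct.comm S M M v) := fun v => by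
      induction v using TensorProduct.induction_on with
      | zero => simp
      | add x y hx hy => simp only [map_add, hx, hy]
      | tmul x y => simp
    rw [h1, hΔ]
    generalize Δ u = v
    induction v using TensorProduct.induction_on with
    | zero => simp
    | add x y hx hy => simp only [map_add, ← hx, ← hy, smul_add]
    | tmul x y => simp [sgn₂, two_smul]
  · simp only [LinearMap.smul_apply, LinearMap.comp_apply, LinearEquiv.coe_coe, comul_wedge] at h ⊢
    let W : Module.End S (CEChain S G M ⊗[S] CEChain S G M) :=
      TensorProduct.map sgn (wedge a) + TensorProduct.map (wedge a) LinearMap.id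
    have h1 : ∀ w : CEChain S G M ⊗[S] CEChain S G M,
        TensorProduct.comm S _ _ (wedge₂ a w) = W (TensorProduct.comm S _ _ w) := fun w => by
      induction w using TensorProduct.induction_on with
      | zero => simp
      | add x y hx hy => simp only [map_add, hx, hy]
      | tmul x y => simp [wedge₂_tmul, W]
    have h2 : ∀ w : CEChain S G M ⊗[S] CEChain S G M,
        sgn₂ (wedge₂ a w) = W (sgn₂ w) := fun w => by
      induction w using TensorProduct.induction_on with
      | zero => simp
      | add x y hx hy => simp only [map_add, hx, hy]
      | tmul x y =>
        simp [wedge₂_tmul, W, sgn₂, neg_tmul, tmul_neg]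
        abel
    rw [h1, h2, ← h, map_smul]

theorem comul_map {G' : Type*} [AddCommGroup G'] [Module S G'] {M' : Type*} [AddCommGroup M']
    [Module S M'] {Δ' : M' →ₗ[S] M' ⊗[S] M'} (φ : G →ₗ[S] G') (χ : M →ₗ[S] M')
    (hχ : ∀ u, Δ' (χ u) = TensorProduct.map χ χ (Δ u)) (x : CEChain S G M) :
    comul Δ' (map φ χ x) = TensorProduct.map (map φ χ) (map φ χ) (comul Δ x) := by
  refine hom_ext (F := comul Δ' ∘ₗ map φ χ)
    (F' := TensorProduct.map (map φ χ) (map φ χ) ∘ₗ comul Δ) (fun u => ?_) (fun a x h => ?_) x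
  · simp only [LinearMap.comp_apply, map_coeff, comul_coeff, hχ]
    generalize Δ u = v
    induction v using TensorProduct.induction_on with
    | zero => simp
    | add x y hx hy => simp only [map_add, ← hx, ← hy]
    | tmul x y => simp
  · simp only [LinearMap.comp_apply, map_wedge, comul_wedge] at h ⊢
    rw [h]
    generalize comul Δ x = w
    induction w using TensorProduct.induction_on with
    | zero => simp
    | add x y hx hy => simp only [map_add, ← hx, ← hy]
    | tmul x y => simp [wedge₂_tmul, map_sgn]

section

variable (β : G →ₗ[S] Module.End S G) (ρ : G →ₗ[S] Module.End S M)
  (hΔ : ∀ a u, Δ (ρ a u) = (ρ a).rTensor M (Δ u) + (ρ a).lTensor M (Δ u))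

include hΔ

theorem comul_act (b : G) (x : CEChain S G M) :
    comul Δ (act β ρ b x) =
      (act β ρ b).rTensor _ (comul Δ x) + (act β ρ b).lTensor _ (comul Δ x) := by
  refine hom_ext (F := comul Δ ∘ₗ act β ρ b)
    (F' := ((act β ρ b).rTensor _ + (act β ρ b).lTensor _) ∘ₗ comul Δ)
    (fun u => ?_) (fun a x h => ?_) x
  · simp only [LinearMap.comp_apply, act_coeff, comul_coeff, hΔ]
    generalize Δ u = v
    induction v using TensorProduct.induction_on with
    | zero => simp
    | add x y hx hy =>
      simp only [map_add] at hx hy ⊢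
      rw [← hx, ← hy]
      abel
    | tmul x y => simp
  · simp only [LinearMap.comp_apply, act_wedge, map_add, comul_wedge] at h ⊢
    rw [h]
    generalize comul Δ x = w
    induction w using TensorProduct.induction_on with
    | zero => simp
    | add x y hx hy =>
      simp only [map_add] at hx hy ⊢
      rw [← hx, ← hy]
      abel
    | tmul x y =>
      simp [wedge₂_tmul, sgn_act, add_tmul, tmul_add]
      abel

/-- Follows by recursion from `comul_act`: `g` acts by coderivations. The sign on the second factor
has the same origin as in `wedge₂`. -/
theorem comul_ce (hβ : ∀ a, β a a = 0) (x : CEChain S G M) :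
    comul Δ (ce β ρ hβ x) =
      TensorProduct.map (ce β ρ hβ) sgn (comul Δ x) + (ce β ρ hβ).lTensor _ (comul Δ x) := by
  refine hom_ext (F := comul Δ ∘ₗ ce β ρ hβ)
    (F' := (TensorProduct.map (ce β ρ hβ) sgn + (ce β ρ hβ).lTensor _) ∘ₗ comul Δ)
    (fun u => ?_) (fun a x h => ?_) x
  · simp only [LinearMap.comp_apply, ce_coeff, comul_coeff, map_zero]
    generalize Δ u = v
    induction v using TensorProduct.induction_on with
    | zero => simp
    | add x y hx hy => rw [map_add, map_add, ← hx, ← hy, add_zero]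
    | tmul x y => simp
  · simp only [LinearMap.comp_apply, ce_wedge, map_sub, comul_wedge] at h ⊢
    rw [h, comul_act Δ β ρ hΔ]
    generalize comul Δ x = w
    induction w using TensorProduct.induction_on with
    | zero => simp
    | add x y hx hy =>
      simp only [map_add] at hx hy ⊢
      rw [← hx, ← hy]
      abel
    | tmul x y =>
      simp [wedge₂_tmul, sgn_ce, tmul_neg, sub_tmul, tmul_sub]
      abel

end

end comul

end CEChain

/-! ### Explicit formulas for decomposable chains -/

/-- Splits subsets by membership of `0`, in step with the recursion on the first exterior factor. -/
theorem Fin.sum_finset_succ {N : Type*} [AddCommMonoid N] {n : ℕ} (f : Finset (Fin (n + 1)) → N) :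
    ∑ I, f I = ∑ J : Finset (Fin n), f (J.map (Fin.succEmb n)) +
      ∑ J : Finset (Fin n), f (insert 0 (J.map (Fin.succEmb n))) := by
  have h0 : ∀ J : Finset (Fin n), (0 : Fin (n + 1)) ∉ J.map (Fin.succEmb n) := fun J h => by
    obtain ⟨i, -, hi⟩ := Finset.mem_map.1 h
    exact Fin.succ_ne_zero i hi
  let pre : Finset (Fin (n + 1)) → Finset (Fin n) := fun I => Finset.univ.filter fun i => i.succ ∈ I
  have hp : ∀ J : Finset (Fin n), pre (J.map (Fin.succEmb n)) = J := fun J => by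
    ext i
    simp [pre]
  have hp' : ∀ J : Finset (Fin n), pre (insert 0 (J.map (Fin.succEmb n))) = J := fun J => by
    ext i
    simp [pre, Fin.succ_ne_zero]
  have hm : ∀ I : Finset (Fin (n + 1)), ∀ i : Fin n,
      i.succ ∈ (pre I).map (Fin.succEmb n) ↔ i.succ ∈ I := fun I i => by simp [pre]
  rw [← Finset.sum_filter_not_add_sum_filter Finset.univ (fun I => (0 : Fin (n + 1)) ∈ I)]
  congr 1
  · refine Finset.sum_nbij' pre (fun J => J.map (Fin.succEmb n)) (by simp) (fun J _ => by simp)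
      (fun I hI => ?_) (fun J _ => hp J) (fun I hI => ?_)
    all_goals
      have : (pre I).map (Fin.succEmb n) = I := by
        ext i
        induction i using Fin.cases with
        | zero => simpa [h0] using hI
        | succ i => exact hm I i
      simp only [this]
  · refine Finset.sum_nbij' pre (fun J => insert 0 (J.map (Fin.succEmb n))) (by simp)
      (fun J _ => by simp) (fun I hI => ?_) (fun J _ => hp' J) (fun I hI => ?_)
    all_goals
      have : insert 0 ((pre I).map (Fin.succEmb n)) = I := by
        ext i
        induction i using Fin.cases with
        | zero => simpa using hI
        | succ i => simpa [Fin.succ_ne_zero] using hm I i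
      simp only [this]

theorem Fin.exists_eq_cons {α : Type*} {n : ℕ} (a : Fin (n + 1) → α) :
    ∃ (x : α) (c : Fin n → α), a = Fin.cons x c :=
  ⟨a 0, Fin.tail a, (Fin.cons_self_tail a).symm⟩

namespace CEChain

variable {S : Type*} [CommRing S] {G : Type*} [AddCommGroup G] [Module S G]
  {M : Type*} [AddCommGroup M] [Module S M]

variable (S M) in
/-- The chain `a_0 ∧ ⋯ ∧ a_{n-1} ⊗ u`. -/
def wedges {n : ℕ} (a : Fin n → G) : M →ₗ[S] CEChain S G M := mk (ExteriorAlgebra.ιMulti S n a)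

theorem wedges_zero (a : Fin 0 → G) (u : M) : wedges S M a u = coeff S G M u := by
  simp [wedges, coeff]

theorem wedges_cons {n : ℕ} (x : G) (a : Fin n → G) (u : M) :
    wedges S M (Fin.cons x a : Fin (n + 1) → G) u = wedge x (wedges S M a u) := by
  simp [wedges, ExteriorAlgebra.ιMulti_succ_apply, Matrix.vecTail, Function.comp_def]

theorem sgn_wedges {n : ℕ} (a : Fin n → G) (u : M) :
    sgn (wedges S M a u) = (-1 : S) ^ n • wedges S M a u := by
  induction n with
  | zero => simp [wedges_zero]
  | succ n ih =>
    obtain ⟨x, a, rfl⟩ := Fin.exists_eq_cons a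
    rw [wedges_cons, sgn_wedge, ih, map_smul, pow_succ, mul_neg_one, neg_smul]

theorem map_wedges {G' : Type*} [AddCommGroup G'] [Module S G'] {M' : Type*} [AddCommGroup M']
    [Module S M'] (φ : G →ₗ[S] G') (χ : M →ₗ[S] M') {n : ℕ} (a : Fin n → G) (u : M) :
    map φ χ (wedges S M a u) = wedges S M' (fun k => φ (a k)) (χ u) := by
  rw [wedges, map_mk, wedges, ExteriorAlgebra.map_apply_ιMulti]
  rfl

/-- The factor in position `i` passes over `i` others on its way to the front. -/
theorem wedge_wedges_removeNth {n : ℕ} (a : Fin (n + 1) → G) (i : Fin (n + 1)) (x : G) (u : M) :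
    wedges S M (Function.update a i x) u = (-1 : S) ^ (i : ℕ) • wedge x (wedges S M (i.removeNth a) u) := by
  have h := (ExteriorAlgebra.ιMulti S (M := G) (n + 1)).map_insertNth i x (i.removeNth a)
  rw [Fin.insertNth_removeNth] at h
  rw [← wedges_cons, wedges, h, wedges]
  rw [← Int.cast_smul_eq_zsmul S, map_smul, LinearMap.smul_apply]
  simp [Matrix.vecCons]

section

variable (β : G →ₗ[S] Module.End S G) (ρ : G →ₗ[S] Module.End S M)

theorem act_wedges {n : ℕ} (b : G) (a : Fin n → G) (u : M) :
    act β ρ b (wedges S M a u) =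
      wedges S M a (ρ b u) + ∑ i, wedges S M (Function.update a i (β b (a i))) u := by
  induction n with
  | zero => simp [wedges_zero]
  | succ n ih =>
    obtain ⟨x, a, rfl⟩ := Fin.exists_eq_cons a
    rw [wedges_cons, act_wedge, ih, Fin.sum_univ_succ]
    simp only [Fin.cons_zero, Fin.cons_succ, Fin.update_cons_zero, ← Fin.cons_update,
      wedges_cons, map_add, map_sum]
    abel

/-- Induction on the first factor `x`. The action of `x` on the rest leaves the bracket with `a_j`
in the position of `a_j`; moving it to the front and using skew symmetry produces the terms for the
pairs containing index `0`. The term `-x ∧ ce` gives all other terms with indices shifted by one. -/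
theorem ce_wedges (hβ : ∀ a, β a a = 0) {n : ℕ} (a : Fin (n + 1) → G) (u : M) :
    ce β ρ hβ (wedges S M a u) =
      ∑ i : Fin (n + 1), (-1 : S) ^ (i : ℕ) • wedges S M (i.removeNth a) (ρ (a i) u) +
      ∑ i : Fin (n + 1), ∑ j ∈ Finset.Ioi i, (-1 : S) ^ (j : ℕ) •
        wedges S M (j.removeNth (Function.update a i (β (a j) (a i)))) u := by
  have hskew : ∀ a b, β a b = -β b a := fun a b => by
    have := hβ (a + b)
    simp only [map_add, LinearMap.add_apply, hβ, zero_add, add_zero] at this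
    exact eq_neg_of_add_eq_zero_right this
  induction n with
  | zero =>
    obtain ⟨x, a, rfl⟩ := Fin.exists_eq_cons a
    rw [wedges_cons, wedges_zero]
    simp [wedges_zero]
  | succ n ih =>
    obtain ⟨x, a, rfl⟩ := Fin.exists_eq_cons a
    rw [wedges_cons, ce_wedge, ih, act_wedges, Fin.sum_univ_succ (n := n + 1),
        Fin.sum_univ_succ (n := n + 1) (fun i => ∑ j ∈ Finset.Ioi i, _),
      Fin.sum_Ioi_zero]
    simp only [Fin.sum_Ioi_succ, Fin.cons_zero, Fin.cons_succ, Fin.update_cons_zero,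
      ← Fin.cons_update, Fin.removeNth_zero, Fin.tail_cons, wedge_wedges_removeNth, Fin.val_zero,
      Fin.val_succ, pow_zero, one_smul, map_add, map_sum, map_smul]
    have h1 : ∀ (i : Fin (n + 1)) (y : G) (c : Fin (n + 1) → G) , 
        i.succ.removeNth (Fin.cons y c : Fin (n + 2) → G) = Fin.cons y (i.removeNth c) :=
      fun i y c => by
        ext j
        induction j using Fin.cases <;> simp [Fin.removeNth]
    simp only [h1, wedges_cons, hskew _ x, pow_succ, mul_neg_one, neg_smul, map_neg,
      LinearMap.neg_apply, smul_neg, neg_neg, Finset.sum_neg_distrib]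
    abel

end

section comul

variable (S M) in
/-- The chain `a_I ⊗ u`. -/
def wedgesOn {n : ℕ} (a : Fin n → G) (I : Finset (Fin n)) : M →ₗ[S] CEChain S G M :=
  wedges S M (a ∘ I.orderEmbOfFin rfl)

theorem wedgesOn_eq {n p : ℕ} (a : Fin n → G) (I : Finset (Fin n)) (h : I.card = p) :
    wedgesOn S M a I = wedges S M (a ∘ I.orderEmbOfFin h) := by
  subst h
  rfl

theorem wedgesOn_map {n : ℕ} (x : G) (a : Fin n → G) (J : Finset (Fin n)) :
    wedgesOn S M (Fin.cons x a : Fin (n + 1) → G) (J.map (Fin.succEmb n)) =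
      wedgesOn S M a J := by
  have hc : (J.map (Fin.succEmb n)).card = J.card := Finset.card_map _
  rw [wedgesOn_eq _ _ hc, wedgesOn]
  have : (J.orderEmbOfFin rfl).trans (Fin.succOrderEmb n) = (J.map (Fin.succEmb n)).orderEmbOfFin hc :=
    Finset.orderEmbOfFin_unique' hc fun i => by simp
  rw [← this]
  congr 1

theorem wedgesOn_insert {n : ℕ} (x : G) (a : Fin n → G) (J : Finset (Fin n)) (u : M) :
    wedgesOn S M (Fin.cons x a : Fin (n + 1) → G) (insert 0 (J.map (Fin.succEmb n))) u =
      wedge x (wedgesOn S M a J u) := by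
  have hc : (insert 0 (J.map (Fin.succEmb n))).card = J.card + 1 := by
    rw [Finset.card_insert_of_notMem (by simp [Fin.succ_ne_zero]), Finset.card_map]
  rw [wedgesOn_eq _ _ hc, wedgesOn, ← wedges_cons]
  have : (Fin.cons 0 (fun i => (J.orderEmbOfFin rfl i).succ) : Fin (J.card + 1) → Fin (n + 1)) =
      (insert 0 (J.map (Fin.succEmb n))).orderEmbOfFin hc := by
    refine Finset.orderEmbOfFin_unique hc (fun i => ?_) ?_
    · induction i using Fin.cases <;> simp
    · exact Fin.strictMono_cons.2 ⟨fun i => Fin.succ_pos _,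
        (Fin.strictMono_succ).comp (J.orderEmbOfFin rfl).strictMono⟩
  rw [← this]
  congr 1
  congr 1
  ext i
  induction i using Fin.cases <;> simp

/-- The number of inversions of the permutation that lists the complement of `I` before `I`. -/
def inversions {n : ℕ} (I : Finset (Fin n)) : ℕ :=
  ((I ×ˢ Iᶜ).filter fun x => x.1 < x.2).card

theorem inversions_map {n : ℕ} (J : Finset (Fin n)) :
    inversions (J.map (Fin.succEmb n)) = inversions J := by
  rw [inversions, inversions, ← Finset.card_map ((Fin.succEmb n).prodMap (Fin.succEmb n))]
  congr 1
  ext ⟨i, j⟩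
  induction i using Fin.cases <;> induction j using Fin.cases <;> simp [Fin.succ_ne_zero]

theorem compl_map_succEmb {n : ℕ} (J : Finset (Fin n)) :
    (J.map (Fin.succEmb n))ᶜ = insert 0 (Jᶜ.map (Fin.succEmb n)) := by
  ext i
  induction i using Fin.cases <;> simp [Fin.succ_ne_zero]

theorem compl_insert_map_succEmb {n : ℕ} (J : Finset (Fin n)) :
    (insert 0 (J.map (Fin.succEmb n)))ᶜ = Jᶜ.map (Fin.succEmb n) := by
  ext i
  induction i using Fin.cases <;> simp [Fin.succ_ne_zero]

/-- The new element `0` of `I` precedes every element of the complement. This is the sign of `sgn y`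
in `wedge₂`. -/
theorem inversions_insert {n : ℕ} (J : Finset (Fin n)) :
    inversions (insert 0 (J.map (Fin.succEmb n))) = inversions J + Jᶜ.card := by
  rw [← inversions_map J, inversions, inversions, compl_insert_map_succEmb, compl_map_succEmb,
    ← Finset.card_map (Fin.succEmb n) (s := Jᶜ),
    ← Finset.card_map (Function.Embedding.sectR (0 : Fin (n + 1)) (Fin (n + 1))) (s := Jᶜ.map (Fin.succEmb n)),
    ← Finset.card_union_of_disjoint]
  · congr 1
    ext ⟨i, j⟩
    induction i using Fin.cases <;> induction j using Fin.cases <;>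
      simp [Fin.succ_ne_zero, (Fin.succ_ne_zero _).symm]
  · rw [Finset.disjoint_left]
    rintro ⟨i, j⟩
    induction i using Fin.cases <;> simp +contextual [(Fin.succ_ne_zero _).symm]

theorem comul_wedges (Δ : M →ₗ[S] M ⊗[S] M) {n : ℕ} (a : Fin n → G) (u : M) :
    comul Δ (wedges S M a u) = ∑ I : Finset (Fin n), (-1 : S) ^ inversions I •
      TensorProduct.map (wedgesOn S M a I) (wedgesOn S M a Iᶜ) (Δ u) := by
  induction n with
  | zero =>
    rw [wedges_zero, comul_coeff, Fintype.sum_eq_single ∅ (fun I hI => (hI I.eq_empty_of_isEmpty).elim)]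
    have h : ∀ I : Finset (Fin 0), wedgesOn S M a I = coeff S G M := fun I => by
      ext v
      rw [wedgesOn_eq a I (p := 0) (by simp [I.eq_empty_of_isEmpty]), wedges_zero]
    simp [h, inversions]
  | succ n ih =>
    obtain ⟨x, a, rfl⟩ := Fin.exists_eq_cons a
    rw [wedges_cons, comul_wedge, ih, Fin.sum_finset_succ, map_sum, ← Finset.sum_add_distrib]
    refine Finset.sum_congr rfl fun J _ => ?_
    rw [inversions_map, inversions_insert, compl_map_succEmb, compl_insert_map_succEmb,
      wedgesOn_map, wedgesOn_map, map_smul, pow_add, mul_smul, ← smul_add]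
    congr 1
    generalize Δ u = v
    induction v using TensorProduct.induction_on with
    | zero => simp
    | add y z hy hz => 
      simp only [map_add, hy, hz, smul_add]
      abel
    | tmul y z =>
      simp only [map_tmul, wedge₂_tmul, wedgesOn_insert]
      rw [wedgesOn_eq a Jᶜ rfl, sgn_wedges, tmul_smul, add_comm]

end comul

end CEChain

/-! ### Homogeneous components of the symmetric and exterior algebras -/

namespace SymPow

variable {S : Type u} [CommRing S] {M : Type w} [AddCommGroup M] [Module S M]

instance : SetLike.GradedMonoid fun m : ℕ => SymPow S M m :=
  Submodule.nat_power_gradedMonoid (LinearMap.range (SymmetricAlgebra.ι S M))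

/-- The inclusion into the symmetric algebra. -/
def emb (m : ℕ) : SymPow S M m →ₗ[S] SymmAlg S M :=
  (SymmAlg.equiv S M).symm.toLinearMap ∘ₗ (SymPow S M m).subtype

theorem emb_injective (m : ℕ) : Function.Injective (emb (S := S) (M := M) m) :=
  (SymmAlg.equiv S M).symm.injective.comp Subtype.val_injective

@[simp]
theorem emb_symPow (b : M) (m : ℕ) : emb m (symPow S b m) = SymmAlg.ι S M b ^ m := by
  simp [emb, symPow, SymmAlg.ι]

theorem map_equiv_range_ι_pow (m : ℕ) :
    (LinearMap.range (SymmAlg.ι S M) ^ m).map (SymmAlg.equiv S M).toLinearMap = SymPow S M m := by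
  have h : (LinearMap.range (SymmAlg.ι S M)).map (SymmAlg.equiv S M).toLinearMap =
      LinearMap.range (SymmetricAlgebra.ι S M) := by
    rw [← LinearMap.range_comp]
    congr 1
  exact (Submodule.map_pow _ (SymmAlg.equiv S M : SymmAlg S M →ₐ[S] SymmetricAlgebra S M) m).trans
    (congrArg (· ^ m) h)

theorem exists_emb_eq {m : ℕ} {u : SymmAlg S M} (hu : u ∈ LinearMap.range (SymmAlg.ι S M) ^ m) :
    ∃ v : SymPow S M m, emb m v = u := by
  have : SymmAlg.equiv S M u ∈ SymPow S M m := by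
    rw [← map_equiv_range_ι_pow]
    exact ⟨u, hu, rfl⟩
  exact ⟨⟨_, this⟩, by simp [emb]⟩

variable (S M) in
/-- The decomposition of the symmetric algebra into the symmetric powers. -/
def decompose : SymmAlg S M →ₐ[S] DirectSum ℕ fun m => SymPow S M m :=
  SymmAlg.lift (DirectSum.lof S ℕ (fun m => SymPow S M m) 1 ∘ₗ
    (SymmetricAlgebra.ι S M).codRestrict _ fun b => by
      simpa only [pow_one] using LinearMap.mem_range_self _ b)

theorem decompose_ι_pow (b : M) (m : ℕ) :
    decompose S M (SymmAlg.ι S M b ^ m) =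
      DirectSum.lof S ℕ (fun m => SymPow S M m) m (symPow S b m) := by
  induction m with
  | zero =>
    rw [pow_zero, map_one]
    exact congrArg (DirectSum.of (fun m => SymPow S M m) 0) (Subtype.ext (by simp [symPow]))
  | succ m ih =>
    rw [pow_succ, map_mul, ih, decompose, SymmAlg.lift_ι_apply]
    refine (DirectSum.of_mul_of (A := fun m => SymPow S M m) _ _).trans ?_
    exact congrArg (DirectSum.of (fun m => SymPow S M m) (m + 1))
      (Subtype.ext (by simp [symPow, pow_succ]))

variable [Algebra ℚ S]

theorem induction {m : ℕ} {motive : SymPow S M m → Prop} (symPow : ∀ b, motive (symPow S b m))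
    (zero : motive 0) (add : ∀ x y, motive x → motive y → motive (x + y))
    (smul : ∀ (c : S) x, motive x → motive (c • x)) (u : SymPow S M m) : motive u := by
  have hu : emb m u ∈ LinearMap.range (SymmAlg.ι S M) ^ m := by
    obtain ⟨v, hv, h⟩ := (map_equiv_range_ι_pow (S := S) (M := M) m).ge u.2
    convert hv
    simp [emb, ← h]
  suffices h : ∀ v ∈ LinearMap.range (SymmAlg.ι S M) ^ m, ∃ w, emb m w = v ∧ motive w by
    obtain ⟨w, hw, h⟩ := h _ hu
    rwa [← emb_injective m hw]
  intro v hv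
  rw [SymmAlg.range_ι_pow_eq_span] at hv
  induction hv using Submodule.span_induction with
  | mem x hx => obtain ⟨b, rfl⟩ := hx; exact ⟨_, by simp, symPow b⟩
  | zero => exact ⟨0, map_zero _, zero⟩
  | add x y hx hy h1 h2 =>
    obtain ⟨w1, rfl, h1⟩ := h1
    obtain ⟨w2, rfl, h2⟩ := h2
    exact ⟨_, map_add _ _ _, add _ _ h1 h2⟩
  | smul r x hx h1 =>
    obtain ⟨w, rfl, h1⟩ := h1
    exact ⟨_, map_smul _ _ _, smul r _ h1⟩

theorem decompose_emb {m : ℕ} (u : SymPow S M m) :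
    decompose S M (emb m u) = DirectSum.lof S ℕ (fun m => SymPow S M m) m u := by
  induction u using induction with
  | symPow b => rw [emb_symPow, decompose_ι_pow]
  | zero => simp
  | add x y hx hy => rw [map_add, map_add, map_add, hx, hy]
  | smul c x hx => rw [map_smul, map_smul, map_smul, hx]

/-- The divided power `b ^ m / m!`. -/
def divPow (b : M) (m : ℕ) : SymPow S M m := algebraMap ℚ S (1 / (m.factorial : ℚ)) • symPow S b m

@[simp]
theorem emb_divPow (b : M) (m : ℕ) : emb m (divPow b m) = SymmAlg.divPow S m b := by
  simp [divPow, SymmAlg.divPow]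

end SymPow

namespace ExteriorAlgebra

variable (S : Type u) [CommRing S] (G : Type v) [AddCommGroup G] [Module S G]

/-- The homogeneous component of degree `n`. -/
def component (n : ℕ) : ExteriorAlgebra S G →ₗ[S] ⋀[S]^n G :=
  DirectSum.component S ℕ (fun n => ⋀[S]^n G) n ∘ₗ
    (DirectSum.decomposeLinearEquiv (fun n => ⋀[S]^n G)).toLinearMap

variable {S G}

theorem component_ιMulti {n : ℕ} (a : Fin n → G) :
    component S G n (ιMulti S n a) = exteriorPower.ιMulti S n a := by
  rw [← exteriorPower.ιMulti_apply_coe]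
  simp only [component, DirectSum.component, LinearMap.comp_apply, LinearEquiv.coe_coe,
    DirectSum.decomposeLinearEquiv_apply, DirectSum.decompose_coe]
  exact DFinsupp.single_eq_same

theorem component_ιMulti_of_ne {n k : ℕ} (h : k ≠ n) (a : Fin k → G) :
    component S G n (ιMulti S k a) = 0 := by
  rw [← exteriorPower.ιMulti_apply_coe]
  simp only [component, DirectSum.component, LinearMap.comp_apply, LinearEquiv.coe_coe,
    DirectSum.decomposeLinearEquiv_apply, DirectSum.decompose_coe]
  exact DFinsupp.single_eq_of_ne h.symm

end ExteriorAlgebra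

namespace CEChain

variable {S : Type*} [CommRing S] [Algebra ℚ S] {G : Type*} [AddCommGroup G] [Module S G]
  {H : Type*} [AddCommGroup H] [Module S H] {N : Type*} [AddCommGroup N] [Module S N]

/-- Decomposable elements span the exterior algebra and divided powers span `Sym H`. -/
theorem linearMap_ext_of_wedges_divPow
    {F F' : CEChain S G (SymmAlg S H) →ₗ[S] N}
    (h : ∀ (n m : ℕ) (a : Fin n → G) (b : H), F (wedges S _ a (SymmAlg.divPow S m b)) =
      F' (wedges S _ a (SymmAlg.divPow S m b))) : F = F' := by
  have h1 : ∀ (n : ℕ) (a : Fin n → G), F ∘ₗ wedges S _ a = F' ∘ₗ wedges S _ a := fun n a =>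
    SymmAlg.linearMap_ext_of_divPow fun m b => h n m a b
  refine LinearMap.ext fun x => ?_
  induction x using mk_induction with
  | zero => simp
  | add x y hx hy => rw [map_add, map_add, hx, hy]
  | mk ω u =>
    have : ω ∈ Submodule.span S (Set.range fun x : Σ n, (Fin n → G) =>
        ExteriorAlgebra.ιMulti S x.1 x.2) := by
      rw [ExteriorAlgebra.ιMulti_span]
      trivial
    induction this using Submodule.span_induction with
    | mem x hx =>
      obtain ⟨⟨n, a⟩, rfl⟩ := hx
      exact LinearMap.congr_fun (h1 n a) u
    | zero => simp
    | add x y _ _ hx hy => simp only [map_add, LinearMap.add_apply, hx, hy]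
    | smul r x _ hx => simp only [map_smul, LinearMap.smul_apply, hx]

end CEChain

/-! ### The Jacobi-Bernoulli complex and Chevalley-Eilenberg chains -/

namespace LiePair

variable {S : Type u} [CommRing S] [Algebra ℚ S]

/-- The Chevalley-Eilenberg chains of `g` with coefficients in `Sym h`. -/
abbrev Chain (P : LiePair.{u, v, w} S) : Type _ := CEChain S P.g (SymmAlg S P.h)

/-- The terms of the Jacobi-Bernoulli complex, sealed so that their instances are cheap to
compare. -/
def Term (P : LiePair.{u, v, w} S) (n : ℕ) : Type (max u v w) := P.JB n

namespace Term

variable (P : LiePair.{u, v, w} S)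

instance (n : ℕ) : AddCommGroup (P.Term n) :=
  (Module.addCommMonoidToAddCommGroup S : AddCommGroup (P.JB n))

instance (n : ℕ) : Module S (P.Term n) := inferInstanceAs (Module S (P.JB n))

/-- The identity. -/
def equiv (n : ℕ) : P.JB n ≃ₗ[S] P.Term n := LinearEquiv.refl S (P.JB n)

/-- The inclusion of the summand `⋀^n g ⊗ Sym^m h`. -/
def of (n m : ℕ) : (⋀[S]^n P.g) ⊗[S] (SymPow S P.h m) →ₗ[S] P.Term n :=
  (equiv P n).toLinearMap ∘ₗ JB.of P n m

theorem equiv_of {n m : ℕ} (z : (⋀[S]^n P.g) ⊗[S] (SymPow S P.h m)) :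
    equiv P n (JB.of P n m z) = of P n m z := rfl

/-- The element `a_0 ∧ ⋯ ∧ a_{n-1} ⊗ b ^ m`. -/
def mon {n : ℕ} (m : ℕ) (a : Fin n → P.g) (b : P.h) : P.Term n :=
  of P n m (exteriorPower.ιMulti S n a ⊗ₜ[S] symPow S b m)

theorem equiv_mon {n : ℕ} (m : ℕ) (a : Fin n → P.g) (b : P.h) :
    equiv P n (JB.mon P m a b) = mon P m a b := rfl

theorem of_comp_ext {n m : ℕ} {N : Type*} [AddCommGroup N] [Module S N]
    {F F' : P.Term n →ₗ[S] N} (h : ∀ a b, F (mon P m a b) = F' (mon P m a b)) :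
    F ∘ₗ of P n m = F' ∘ₗ of P n m := by
  refine TensorProduct.ext (exteriorPower.linearMap_ext (AlternatingMap.ext fun a =>
    LinearMap.ext fun u => ?_))
  change F (of P n m (exteriorPower.ιMulti S n a ⊗ₜ[S] u)) =
    F' (of P n m (exteriorPower.ιMulti S n a ⊗ₜ[S] u))
  induction u using SymPow.induction with
  | symPow b => exact h a b
  | zero => simp
  | add x y hx hy => simp only [tmul_add, map_add, hx, hy]
  | smul c x hx => simp only [tmul_smul, map_smul, hx]

theorem linearMap_ext {n : ℕ} {N : Type*} [AddCommGroup N] [Module S N] {F F' : P.Term n →ₗ[S] N}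
    (h : ∀ m a b, F (mon P m a b) = F' (mon P m a b)) : F = F' := by
  suffices h : F ∘ₗ (equiv P n).toLinearMap = F' ∘ₗ (equiv P n).toLinearMap from
    LinearMap.ext fun x => LinearMap.congr_fun h ((equiv P n).symm x)
  refine DirectSum.linearMap_ext (R := S) fun m => LinearMap.ext fun z => ?_
  have h1 : DirectSum.lof S _ (fun m : {m : ℕ // 0 < n + m} =>
      (⋀[S]^n P.g) ⊗[S] (SymPow S P.h m.1)) m z = JB.of P n m.1 z := by
    rw [JB.of, dif_pos m.2]
  simp only [LinearMap.comp_apply, h1]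
  exact LinearMap.congr_fun (of_comp_ext P (h m.1)) z

theorem mon_zero_zero (a : Fin 0 → P.g) (b : P.h) : mon P 0 a b = 0 := by
  simp [mon, of, JB.of]

/-- The projection of chains onto the part of degree `-n` of the Jacobi-Bernoulli complex, with
`b ^ m / m!` corresponding to `b ^ m`. -/
def proj (n : ℕ) : P.Chain →ₗ[S] P.Term n :=
  CEChain.lift (TensorProduct.curry (DirectSum.toModule S ℕ (P.Term n) (fun m =>
      (m.factorial : S) • of P n m) ∘ₗ
    (TensorProduct.directSumRight S S (⋀[S]^n P.g) fun m => SymPow S P.h m).toLinearMap ∘ₗ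
    TensorProduct.map (ExteriorAlgebra.component S P.g n) (SymPow.decompose S P.h).toLinearMap))

theorem proj_wedges {n m : ℕ} (a : Fin n → P.g) (u : SymPow S P.h m) :
    proj P n (CEChain.wedges S _ a (SymPow.emb m u)) =
      (m.factorial : S) • of P n m (exteriorPower.ιMulti S n a ⊗ₜ u) := by
  rw [proj, CEChain.wedges, CEChain.lift_mk]
  simp [ExteriorAlgebra.component_ιMulti, SymPow.decompose_emb]

theorem proj_wedges_divPow {n m : ℕ} (a : Fin n → P.g) (b : P.h) :
    proj P n (CEChain.wedges S _ a (SymmAlg.divPow S m b)) = mon P m a b := by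
  rw [← SymPow.emb_divPow, proj_wedges, ← map_smul, ← tmul_smul, mon]
  congr 2
  apply SymPow.emb_injective
  simp [SymmAlg.ι_pow_eq]

theorem proj_wedges_of_ne {n k : ℕ} (h : k ≠ n) (a : Fin k → P.g) (u : SymmAlg S P.h) :
    proj P n (CEChain.wedges S _ a u) = 0 := by
  rw [proj, CEChain.wedges, CEChain.lift_mk]
  simp [ExteriorAlgebra.component_ιMulti_of_ne h]

/-- The inclusion of the part of degree `-n` of the Jacobi-Bernoulli complex into chains. -/
def incl (n : ℕ) : P.Term n →ₗ[S] P.Chain :=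
  (DirectSum.toModule S _ _ fun m => algebraMap ℚ S (1 / (m.1.factorial : ℚ)) •
    TensorProduct.lift ((CEChain.mk (S := S)).compl₁₂ (⋀[S]^n P.g).subtype (SymPow.emb m.1))) ∘ₗ
    (equiv P n).symm.toLinearMap

theorem incl_mon {n m : ℕ} (h : 0 < n + m) (a : Fin n → P.g) (b : P.h) :
    incl P n (mon P m a b) = CEChain.wedges S _ a (SymmAlg.divPow S m b) := by
  rw [← equiv_mon, incl, LinearMap.comp_apply, LinearEquiv.coe_coe, LinearEquiv.symm_apply_apply,
    JB.mon, JB.of, dif_pos h, DirectSum.toModule_lof]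
  rw [LinearMap.smul_apply, TensorProduct.lift.tmul, LinearMap.compl₁₂_apply, SymPow.emb_symPow]
  simp [CEChain.wedges, SymmAlg.divPow]

@[simp]
theorem proj_incl {n : ℕ} (z : P.Term n) : proj P n (incl P n z) = z := by
  refine LinearMap.congr_fun (f := proj P n ∘ₗ incl P n) (g := LinearMap.id)
    (linearMap_ext P fun m a b => ?_) z
  rcases Nat.eq_zero_or_pos (n + m) with h | h
  · obtain ⟨rfl, rfl⟩ := Nat.add_eq_zero_iff.1 h
    simp [mon_zero_zero]
  · simp [incl_mon P h, proj_wedges_divPow]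

theorem proj_surjective (n : ℕ) : Function.Surjective (proj P n) := fun z => ⟨_, proj_incl P z⟩

theorem incl_proj_wedges {n : ℕ} (a : Fin (n + 1) → P.g) (u : SymmAlg S P.h) :
    incl P (n + 1) (proj P (n + 1) (CEChain.wedges S _ a u)) = CEChain.wedges S _ a u := by
  refine LinearMap.congr_fun (f := incl P (n + 1) ∘ₗ proj P (n + 1) ∘ₗ CEChain.wedges S _ a)
    (SymmAlg.linearMap_ext_of_divPow fun m b => ?_) u
  simp [proj_wedges_divPow, incl_mon]

/-- The complex omits `⋀^0 ⊗ Sym^0`; the line through this chain is all that the projections lose.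
-/
theorem proj_coeff_one (n : ℕ) : proj P n (CEChain.coeff S _ _ 1) = 0 := by
  rw [← CEChain.wedges_zero ![]]
  by_cases h : 0 = n
  · subst h
    rw [← SymmAlg.divPow_zero (S := S) (0 : P.h), proj_wedges_divPow, mon_zero_zero]
  · rw [proj_wedges_of_ne P h]

/-- `SymmAlg.lift 0` is the augmentation: in degree zero the round trip removes the constant term.
-/
theorem incl_proj_coeff (u : SymmAlg S P.h) :
    incl P 0 (proj P 0 (CEChain.coeff S _ _ u)) =
      CEChain.coeff S _ _ u - SymmAlg.lift (0 : P.h →ₗ[S] S) u • CEChain.coeff S _ _ 1 := by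
  refine LinearMap.congr_fun (f := incl P 0 ∘ₗ proj P 0 ∘ₗ CEChain.coeff S _ _)
    (g := CEChain.coeff S P.g (SymmAlg S P.h) -
      (SymmAlg.lift (0 : P.h →ₗ[S] S)).toLinearMap.smulRight
        (CEChain.coeff S P.g (SymmAlg S P.h) 1))
    (SymmAlg.linearMap_ext_of_divPow fun m b => ?_) u
  rcases Nat.eq_zero_or_pos m with rfl | h
  · simp [proj_coeff_one]
  · have := incl_mon P (n := 0) (m := m) (by omega) ![] b
    rw [← proj_wedges_divPow, CEChain.wedges_zero] at this
    have h0 : SymmAlg.lift (0 : P.h →ₗ[S] S) (SymmAlg.divPow S m b) = 0 := by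
      simp [SymmAlg.divPow, h.ne']
    simp [this, h0]

theorem proj_sgn (n : ℕ) (x : P.Chain) :
    proj P n (CEChain.sgn x) = (-1 : S) ^ n • proj P n x := by
  refine LinearMap.congr_fun (f := proj P n ∘ₗ CEChain.sgn) (g := (-1 : S) ^ n • proj P n)
    (CEChain.linearMap_ext_of_wedges_divPow fun k m a b => ?_) x
  simp only [LinearMap.comp_apply, LinearMap.smul_apply, CEChain.sgn_wedges, map_smul]
  by_cases h : k = n
  · subst h
    rfl
  · simp [proj_wedges_of_ne P h]

end Term

end LiePair

/-! ### Naturality of the coproduct and of the action -/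

namespace SymmAlg

variable {S : Type*} [CommRing S] [Algebra ℚ S]

theorem coprod_map {M M' : Type*} [AddCommGroup M] [Module S M] [AddCommGroup M'] [Module S M']
    (f : M →ₗ[S] M') (u : SymmAlg S M) :
    coprod (map f u) =
      TensorProduct.map (map f).toLinearMap (map f).toLinearMap (coprod u) := by
  refine LinearMap.congr_fun (f := coprod ∘ₗ (map f).toLinearMap)
    (g := TensorProduct.map (map f).toLinearMap (map f).toLinearMap ∘ₗ coprod)
    (linearMap_ext_of_divPow fun m b => ?_) u
  simp [map_divPow, coprod_divPow]

theorem map_symAct {L L' : Type*} [LieRing L] [LieAlgebra S L] [LieRing L'] [LieAlgebra S L']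
    (f : L →ₗ⁅S⁆ L') (x : L) (u : SymmAlg S L) :
    map (f : L →ₗ[S] L') (symAct S x u) = symAct S (f x) (map (f : L →ₗ[S] L') u) := by
  refine LinearMap.congr_fun (f := (map (f : L →ₗ[S] L')).toLinearMap ∘ₗ symAct S x)
    (g := symAct S (f x) ∘ₗ (map (f : L →ₗ[S] L')).toLinearMap)
    (linearMap_ext_of_divPow fun m b => ?_) u
  have h : ∀ t, f ((lieRight S b ^ t) x) = (lieRight S (f b) ^ t) (f x) := fun t => by
    induction t with
    | zero => rfl
    | succ t ih => simp [pow_succ', ih]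
  simp [map_divPow, symAct_divPow, map_ι, h]

end SymmAlg

/-! ### Transport of comultiplications along projections -/

section transport

variable {S : Type*} [CommRing S] {K A B C A' B' : Type*} [AddCommGroup K] [Module S K]
  [AddCommGroup A] [Module S A] [AddCommGroup B] [Module S B] [AddCommGroup C] [Module S C]
  [AddCommGroup A'] [Module S A'] [AddCommGroup B'] [Module S B']

/-- Turns `comul_ce` into the coderivation rule for components. The scalars `c`, `e` stand for the
signs by which the differentials of chains and of the complex differ in the two degrees. -/
theorem TensorProduct.map_coderivation {D τ : K →ₗ[S] K} {πA : K →ₗ[S] A} {πB : K →ₗ[S] B}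
    {πA' : K →ₗ[S] A'} {πB' : K →ₗ[S] B'} {dA : A' →ₗ[S] A} {dB : B' →ₗ[S] B} {c e : S}
    (hA : ∀ y, πA (D y) = c • dA (πA' y)) (hB : ∀ y, πB (D y) = e • dB (πB' y))
    (hτ : ∀ y, πB (τ y) = e • πB y) (y : K ⊗[S] K) :
    TensorProduct.map πA πB (TensorProduct.map D τ y + D.lTensor K y) =
      (c * e) • dA.rTensor B (TensorProduct.map πA' πB y) +
        e • dB.lTensor A (TensorProduct.map πA πB' y) := by
  induction y using TensorProduct.induction_on with
  | zero => simp
  | add y y' hy hy' =>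
    simp only [map_add, smul_add] at hy hy' ⊢
    rw [add_add_add_comm, hy, hy']
    abel
  | tmul y y' =>
    simp only [map_add, map_tmul, LinearMap.lTensor_tmul, LinearMap.rTensor_tmul, hA, hB, hτ,
      tmul_smul, smul_tmul', mul_smul]
    rw [smul_comm]

theorem TensorProduct.assoc_map {Δ : K →ₗ[S] K ⊗[S] K}
    (hΔ : Δ.IsCoassoc)
    {πA : K →ₗ[S] A} {πB : K →ₗ[S] B} {πC : K →ₗ[S] C} {πA' : K →ₗ[S] A'} {πB' : K →ₗ[S] B'}
    {δ : A' →ₗ[S] A ⊗[S] B} {δ' : B' →ₗ[S] B ⊗[S] C}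
    (h : ∀ x, δ (πA' x) = TensorProduct.map πA πB (Δ x))
    (h' : ∀ x, δ' (πB' x) = TensorProduct.map πB πC (Δ x)) (x : K) :
    TensorProduct.assoc S A B C (δ.rTensor C (TensorProduct.map πA' πC (Δ x))) =
      δ'.lTensor A (TensorProduct.map πA πB' (Δ x)) := by
  have h1 : ∀ y, δ.rTensor C (TensorProduct.map πA' πC y) =
      TensorProduct.map (TensorProduct.map πA πB) πC (Δ.rTensor K y) := fun y => by
    induction y using TensorProduct.induction_on with
    | zero => simp
    | add y y' hy hy' => simp only [map_add, hy, hy']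
    | tmul y y' => simp [h]
  have h2 : ∀ y, δ'.lTensor A (TensorProduct.map πA πB' y) =
      TensorProduct.map πA (TensorProduct.map πB πC) (Δ.lTensor K y) := fun y => by
    induction y using TensorProduct.induction_on with
    | zero => simp
    | add y y' hy hy' => simp only [map_add, hy, hy']
    | tmul y y' => simp [h']
  rw [h1, h2, ← hΔ x]
  exact (TensorProduct.map_map_assoc _ _ _ _).symm

theorem TensorProduct.comm_map {Δ : K →ₗ[S] K ⊗[S] K} {τ : K →ₗ[S] K} (hΔ : Δ.IsGradedCocomm τ)
    {πA : K →ₗ[S] A} {πB : K →ₗ[S] B} {c e : S}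
    (hA : ∀ y, πA (τ y) = c • πA y) (hB : ∀ y, πB (τ y) = e • πB y) (x : K) :
    (2 : S) • TensorProduct.comm S A B (TensorProduct.map πA πB (Δ x)) =
      (1 + e + c - e * c) • TensorProduct.map πB πA (Δ x) := by
  have h1 : ∀ y, TensorProduct.comm S A B (TensorProduct.map πA πB y) =
      TensorProduct.map πB πA (TensorProduct.comm S K K y) := fun y => by
    induction y using TensorProduct.induction_on with
    | zero => simp
    | add y y' hy hy' => simp only [map_add, hy, hy']
    | tmul y y' => simp
  rw [h1, ← map_smul, hΔ x]
  generalize Δ x = y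
  induction y using TensorProduct.induction_on with
  | zero => simp
  | add y y' hy hy' => rw [map_add, map_add, map_add, smul_add, hy, hy']
  | tmul y y' =>
    simp only [LinearMap.sub_apply, LinearMap.add_apply, LinearMap.id_apply,
      LinearMap.lTensor_tmul, LinearMap.rTensor_tmul, map_tmul, map_add, map_sub, hA, hB,
      tmul_smul, ← smul_tmul', sub_smul, add_smul, one_smul, mul_smul, smul_comm c e]

end transport

/-! ### The Jacobi-Bernoulli complex and its differential -/

namespace LiePair

variable {S : Type u} [CommRing S]

namespace Term

variable (P : LiePair.{u, v, w} S)

theorem iterBracket_eq (x b : P.h) (t : ℕ) : JB.iterBracket P x b t = (lieRight S b ^ t) x := by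
  induction t with
  | zero => rfl
  | succ t ih => simp [JB.iterBracket, pow_succ', ih]

/-- `Sym` is commutative, so the `k + 1` summands of `x . b ^ k` coincide. -/
theorem emb_symDot {M : Type w} [AddCommGroup M] [Module S M] (x b : M) (k : ℕ) :
    SymPow.emb (k + 1) (symDot S x b k) =
      ((k : S) + 1) • (SymmAlg.ι S M x * SymmAlg.ι S M b ^ k) := by
  have h : ∀ j ∈ Finset.range (k + 1), SymmAlg.ι S M b ^ j * SymmAlg.ι S M x *
      SymmAlg.ι S M b ^ (k - j) =
      SymmAlg.ι S M x * SymmAlg.ι S M b ^ k := fun j hj => by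
    rw [mul_comm (_ ^ j), mul_assoc, ← pow_add]
    congr 2
    have := Finset.mem_range.1 hj
    omega
  have h1 : SymPow.emb (k + 1) (symDot S x b k) = ∑ j ∈ Finset.range (k + 1),
      SymmAlg.ι S M b ^ j * SymmAlg.ι S M x * SymmAlg.ι S M b ^ (k - j) := by
    simp [SymPow.emb, symDot, SymmAlg.ι]
  rw [h1, Finset.sum_congr rfl h, Finset.sum_const, Finset.card_range, ← Nat.cast_smul_eq_nsmul S]
  simp

variable [Algebra ℚ S]

/-- A map on chains that sees only degree `n` and kills `1` factors through `proj P n`. In this way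
the differential, the coproduct and the induced maps descend from chains to the complex. -/
theorem comp_incl_proj {n : ℕ} {N : Type*} [AddCommGroup N] [Module S N] {F : P.Chain →ₗ[S] N}
    (h : ∀ k, k ≠ n → ∀ (a : Fin k → P.g) u, F (CEChain.wedges S _ a u) = 0)
    (h1 : F (CEChain.coeff S _ _ 1) = 0) (x : P.Chain) :
    F (incl P n (proj P n x)) = F x := by
  refine LinearMap.congr_fun (f := F ∘ₗ incl P n ∘ₗ proj P n)
    (CEChain.linearMap_ext_of_wedges_divPow fun k m a b => ?_) x
  simp only [LinearMap.comp_apply]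
  by_cases hk : k = n
  · subst hk
    cases k with
    | zero => rw [CEChain.wedges_zero, incl_proj_coeff, map_sub, map_smul, h1, smul_zero, sub_zero]
    | succ k => rw [incl_proj_wedges]
  · rw [proj_wedges_of_ne P hk, map_zero, map_zero, h k hk]

theorem lieRight_self {L : Type*} [LieRing L] [LieAlgebra S L] (a : L) : lieRight S a a = 0 := by
  simp

theorem lieRight_lieRight {L : Type*} [LieRing L] [LieAlgebra S L] (a b : L) :
    lieRight S b * lieRight S a - lieRight S a * lieRight S b = lieRight S (lieRight S b a) := by
  ext c
  simp only [LinearMap.sub_apply, Module.End.mul_apply, lieRight_apply]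
  rw [leibniz_lie c a b, ← lie_skew a ⁅c, b⁆]
  abel

/-- The right action of `g` on `Sym h`. -/
def rho : P.g →ₗ[S] Module.End S (SymmAlg S P.h) :=
  symAct S ∘ₗ (P.i : P.g →ₗ[S] P.h)

theorem rho_apply (a : P.g) : rho P a = symAct S (P.i a) := rfl

theorem rho_rho (a b : P.g) : rho P b * rho P a - rho P a * rho P b = rho P (lieRight S b a) := by
  ext u
  simp [rho_apply, ← symAct_symAct]

/-- The differential of chains. -/
def bdry : P.Chain →ₗ[S] P.Chain := CEChain.ce (lieRight S) (rho P) lieRight_self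

theorem bdry_bdry (x : P.Chain) : bdry P (bdry P x) = 0 :=
  CEChain.ce_ce _ _ _ lieRight_lieRight (rho_rho P) x

theorem proj_bdry_wedges_of_ne {n k : ℕ} (h : k ≠ n + 1) (a : Fin k → P.g)
    (u : SymmAlg S P.h) : proj P n (bdry P (CEChain.wedges S _ a u)) = 0 := by
  cases k with
  | zero => rw [CEChain.wedges_zero, bdry, CEChain.ce_coeff, map_zero]
  | succ k =>
    have hk : k ≠ n := fun e => h (by rw [e])
    simp [bdry, CEChain.ce_wedges, proj_wedges_of_ne P hk]

/-- The differential of the Jacobi-Bernoulli complex. -/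
def d (n : ℕ) : P.Term (n + 1) →ₗ[S] P.Term n := (-1 : S) ^ n • proj P n ∘ₗ bdry P ∘ₗ incl P (n + 1)

theorem d_proj (n : ℕ) (x : P.Chain) :
    d P n (proj P (n + 1) x) = (-1 : S) ^ n • proj P n (bdry P x) := by
  rw [d, LinearMap.smul_apply]
  congr 1
  exact comp_incl_proj P (F := proj P n ∘ₗ bdry P)
    (fun k hk a u => proj_bdry_wedges_of_ne P hk a u) (by simp [bdry]) x

theorem proj_bdry (n : ℕ) (x : P.Chain) :
    proj P n (bdry P x) = (-1 : S) ^ n • d P n (proj P (n + 1) x) := by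
  rw [d_proj, smul_smul, ← mul_pow]
  simp

theorem d_d (n : ℕ) (z : P.Term (n + 1 + 1)) : d P n (d P (n + 1) z) = 0 := by
  obtain ⟨x, rfl⟩ := proj_surjective P _ z
  rw [d_proj, map_smul, d_proj, bdry_bdry]
  simp

/-- Here the normalizations meet: `y * b ^ k / k!` equals `(y . b ^ k) / (k + 1)!`, and `proj`
multiplies degree `k + 1` by `(k + 1)!`. So the action on divided powers becomes the stated
differential with coefficients `B_t / t!`. -/
theorem proj_wedges_ι_mul_divPow {n : ℕ} (a : Fin n → P.g) (y b : P.h) (k : ℕ) :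
    proj P n (CEChain.wedges S _ a (SymmAlg.ι S P.h y * SymmAlg.divPow S k b)) =
      of P n (k + 1) (exteriorPower.ιMulti S n a ⊗ₜ[S] symDot S y b k) := by
  have h : SymmAlg.ι S P.h y * SymmAlg.divPow S k b = SymPow.emb (k + 1)
      (algebraMap ℚ S (1 / ((k + 1).factorial : ℚ)) • symDot S y b k) := by
    rw [map_smul, emb_symDot, smul_smul, SymmAlg.ι_pow_eq, mul_smul_comm, smul_smul, mul_assoc]
    have := SymmAlg.algebraMap_factorial_mul S (k + 1)
    rw [show (((k + 1).factorial : ℕ) : S) = ((k : S) + 1) * (k.factorial : S) by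
      rw [Nat.factorial_succ, Nat.cast_mul, Nat.cast_succ]] at this
    rw [this, one_smul]
  rw [h, proj_wedges, ← map_smul, ← tmul_smul, smul_smul, mul_comm,
    SymmAlg.algebraMap_factorial_mul, one_smul]

theorem d_mon {n : ℕ} (m : ℕ) (a : Fin (n + 1) → P.g) (b : P.h) :
    d P n (mon P m a b) = equiv P n (JB.dMon P m a b) := by
  -- The global sign `(-1) ^ n` converts signs counted from the front into signs counted from the
  -- back.
  have hs : ∀ i : Fin (n + 1), (-1 : S) ^ n * (-1) ^ (i : ℕ) = (-1) ^ (n - (i : ℕ)) := fun i => by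
    obtain ⟨k, hk⟩ := Nat.exists_eq_add_of_le (Fin.is_le i)
    simp only [hk, Nat.add_sub_cancel_left]
    rw [pow_add, mul_right_comm, ← mul_pow]
    simp
  rw [← proj_wedges_divPow, d_proj, bdry, CEChain.ce_wedges, map_add, map_sum, map_sum, smul_add,
    Finset.smul_sum, Finset.smul_sum, JB.dMon, map_add, map_sum, map_sum]
  congr 1
  · refine Finset.sum_congr rfl fun i _ => ?_
    rw [map_smul, smul_smul, hs, rho_apply, symAct_divPow,
      Finset.Nat.sum_antidiagonal_eq_sum_range_succ (fun t k => algebraMap ℚ S (bernoulliCoeff t) •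
        (SymmAlg.ι S P.h ((lieRight S b ^ t) (P.i (a i))) *
          SymmAlg.divPow S k b)), map_sum, map_sum, Finset.smul_sum]
    rw [map_sum]
    refine Finset.sum_congr rfl fun t _ => ?_
    rw [map_smul, map_smul, map_smul, smul_smul, proj_wedges_ι_mul_divPow, iterBracket_eq,
      bernoulliCoeff, equiv_of]
  · refine Finset.sum_congr rfl fun i _ => ?_
    rw [map_sum, map_sum, Finset.smul_sum]
    refine Finset.sum_congr rfl fun j _ => ?_
    rw [map_smul, map_smul, smul_smul, hs, proj_wedges_divPow, lieRight_apply, equiv_mon]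

/-! ### The comultiplication -/

/-- The comultiplication of chains. -/
def chainComul : P.Chain →ₗ[S] P.Chain ⊗[S] P.Chain :=
  CEChain.comul SymmAlg.coprod

/-- The comultiplication of the Jacobi-Bernoulli complex. -/
def comul (n p q : ℕ) : P.Term n →ₗ[S] P.Term p ⊗[S] P.Term q :=
  TensorProduct.map (proj P p) (proj P q) ∘ₗ chainComul P ∘ₗ incl P n

theorem map_proj_wedgesOn {n p q : ℕ} (a : Fin n → P.g) (I : Finset (Fin n))
    (h : I.card ≠ p ∨ Iᶜ.card ≠ q) (v : SymmAlg S P.h ⊗[S] SymmAlg S P.h) :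
    TensorProduct.map (proj P p) (proj P q)
      (TensorProduct.map (CEChain.wedgesOn S _ a I) (CEChain.wedgesOn S _ a Iᶜ) v) = 0 := by
  induction v using TensorProduct.induction_on with
  | zero => simp
  | add x y hx hy => rw [map_add, map_add, hx, hy, add_zero]
  | tmul x y =>
    rcases h with h | h <;> simp [CEChain.wedgesOn, proj_wedges_of_ne P h]

/-- A chain of exterior degree other than `p + q` has no splitting into parts of sizes `p` and `q`,
and `1` maps to `1 ⊗ 1`, which is projected to zero. -/
theorem comul_proj {n p q : ℕ} (h : p + q = n) (x : P.Chain) :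
    comul P n p q (proj P n x) =
      TensorProduct.map (proj P p) (proj P q) (chainComul P x) := by
  refine comp_incl_proj P (F := TensorProduct.map (proj P p) (proj P q) ∘ₗ chainComul P)
    (fun k hk a u => ?_) ?_ x
  · rw [LinearMap.comp_apply, chainComul, CEChain.comul_wedges, map_sum]
    refine Finset.sum_eq_zero fun I _ => ?_
    rw [map_smul, map_proj_wedgesOn, smul_zero]
    have := Finset.card_compl I
    rw [Fintype.card_fin] at this
    have := Finset.card_le_univ I
    rw [Fintype.card_fin] at this
    omega
  · simp [chainComul, CEChain.comul_coeff, proj_coeff_one]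

theorem comul_mon {n p q : ℕ} (h : p + q = n) (m : ℕ) (a : Fin n → P.g) (b : P.h) :
    comul P n p q (mon P m a b) =
      TensorProduct.map (equiv P p).toLinearMap (equiv P q).toLinearMap
        (JB.comulMon P h m a b) := by
  rw [← proj_wedges_divPow, comul_proj P h, chainComul, CEChain.comul_wedges, map_sum,
    ← Fintype.sum_subtype_add_sum_subtype (fun I : Finset (Fin n) => I.card = p), JB.comulMon, map_sum]
  rw [Fintype.sum_eq_zero (α := {I : Finset (Fin n) // ¬ I.card = p}) _ fun I => ?_, add_zero]
  · refine Finset.sum_congr rfl fun I _ => ?_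
    have hI : I.1ᶜ.card = q := by
      rw [Finset.card_compl, I.2, Fintype.card_fin]
      omega
    rw [map_smul, SymmAlg.coprod_divPow, CEChain.wedgesOn_eq a I.1 I.2,
      CEChain.wedgesOn_eq a _ hI, map_sum, map_sum, CEChain.inversions, Finset.smul_sum,
      Finset.Nat.sum_antidiagonal_eq_sum_range_succ_mk, map_sum]
    refine Finset.sum_congr rfl fun k _ => ?_
    rw [map_tmul, map_tmul, proj_wedges_divPow, proj_wedges_divPow, map_smul, map_tmul]
    rfl
  · rw [map_smul, map_proj_wedgesOn P a I.1 (Or.inl I.2), smul_zero]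

theorem chainComul_bdry (x : P.Chain) :
    chainComul P (bdry P x) = TensorProduct.map (bdry P) CEChain.sgn (chainComul P x) +
      (bdry P).lTensor _ (chainComul P x) := by
  have h : ∀ a u, SymmAlg.coprod (rho P a u) = (rho P a).rTensor _ (SymmAlg.coprod u) +
      (rho P a).lTensor _ (SymmAlg.coprod u) := fun a u => by
    rw [rho_apply, coprod_symAct]
  rw [chainComul, bdry, CEChain.comul_ce _ _ _ h]

theorem comul_d {n p q : ℕ} (h : p + q = n) (z : P.Term (n + 1)) :
    comul P n p q (d P n z) =
      (d P p).rTensor (P.Term q) (comul P (n + 1) (p + 1) q z) +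
      (-1 : S) ^ p • (d P q).lTensor (P.Term p) (comul P (n + 1) p (q + 1) z) := by
  obtain ⟨x, rfl⟩ := proj_surjective P _ z
  -- The sign `(-1) ^ n` in `d`, times those from the two factors, leaves `1` in the first term and
  -- `(-1) ^ p` in the second.
  have h1 : (-1 : S) ^ n * (-1) ^ q = (-1) ^ p := by
    rw [← h, pow_add, mul_assoc, ← mul_pow]
    simp
  have h2 : (-1 : S) ^ n * ((-1) ^ p * (-1) ^ q) = 1 := by
    rw [mul_left_comm, h1, ← mul_pow]
    simp
  have h4 := TensorProduct.map_coderivation (proj_bdry P p) (proj_bdry P q) (proj_sgn P q)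
    (chainComul P x)
  rw [← chainComul_bdry, ← comul_proj P h, ← comul_proj P (n := n + 1) (by omega),
    ← comul_proj P (n := n + 1) (by omega)] at h4
  rw [d_proj, map_smul, h4, smul_add, smul_smul, smul_smul, h1, h2, one_smul]

theorem chainComul_coassoc : (chainComul P).IsCoassoc :=
  CEChain.comul_coassoc _ SymmAlg.coprod_coassoc

theorem coassoc {p q r a b n : ℕ} (hpq : p + q = a) (ha : a + r = n) (hqr : q + r = b)
    (hb : p + b = n) (z : P.Term n) :
    TensorProduct.assoc S (P.Term p) (P.Term q) (P.Term r)
      ((comul P a p q).rTensor (P.Term r) (comul P n a r z)) =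
      (comul P b q r).lTensor (P.Term p) (comul P n p b z) := by
  obtain ⟨x, rfl⟩ := proj_surjective P _ z
  rw [comul_proj P ha, comul_proj P hb]
  exact TensorProduct.assoc_map (chainComul_coassoc P) (comul_proj P hpq) (comul_proj P hqr) x

theorem chainComul_isGradedCocomm : (chainComul P).IsGradedCocomm CEChain.sgn :=
  CEChain.comm_comul _ SymmAlg.comm_coprod

theorem cocomm {p q n : ℕ} (h : p + q = n) (h' : q + p = n) (z : P.Term n) :
    TensorProduct.comm S (P.Term p) (P.Term q) (comul P n p q z) =
      (-1 : S) ^ (p * q) • comul P n q p z := by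
  obtain ⟨x, rfl⟩ := proj_surjective P _ z
  have h3 : (1 : S) + (-1) ^ q + (-1) ^ p - (-1) ^ q * (-1) ^ p = 2 * (-1) ^ (p * q) := by
    rcases Nat.even_or_odd p with hp | hp <;> rcases Nat.even_or_odd q with hq | hq
    · simp [hp.neg_one_pow, hq.neg_one_pow, (hp.mul_right q).neg_one_pow]; norm_num
    · simp [hp.neg_one_pow, hq.neg_one_pow, (hp.mul_right q).neg_one_pow]; norm_num
    · simp [hp.neg_one_pow, hq.neg_one_pow, (hq.mul_left p).neg_one_pow]; norm_num
    · simp [hp.neg_one_pow, hq.neg_one_pow, (hp.mul hq).neg_one_pow]; norm_num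
  have h4 := TensorProduct.comm_map (chainComul_isGradedCocomm P) (proj_sgn P p) (proj_sgn P q) x
  rw [h3, mul_smul] at h4
  rw [comul_proj P h, comul_proj P h']
  refine SymmAlg.smul_cancel S 1 ?_
  rw [Nat.cast_one, one_add_one_eq_two]
  exact h4

/-! ### The filtration -/

/-- The filtration. -/
def fil (r : ℤ) (n : ℕ) : Submodule S (P.Term n) := (JB.fil P r n).map (equiv P n).toLinearMap

theorem fil_eq (r : ℤ) (n : ℕ) :
    fil P r n = ⨆ m : {m : ℕ // (m : ℤ) ≤ -(n : ℤ) + r}, LinearMap.range (of P n m.1) := by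
  rw [fil, JB.fil, Submodule.map_iSup]
  simp_rw [of, LinearMap.range_comp]

theorem of_mem_fil {r : ℤ} {n m : ℕ} (h : (m : ℤ) ≤ -(n : ℤ) + r)
    (z : (⋀[S]^n P.g) ⊗[S] (SymPow S P.h m)) : of P n m z ∈ fil P r n := by
  rw [fil_eq]
  exact Submodule.mem_iSup_of_mem (⟨m, h⟩ : {m : ℕ // (m : ℤ) ≤ -(n : ℤ) + r}) ⟨z, rfl⟩

theorem mon_mem_fil {r : ℤ} {n m : ℕ} (h : (m : ℤ) ≤ -(n : ℤ) + r) (a : Fin n → P.g) (b : P.h) :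
    mon P m a b ∈ fil P r n :=
  of_mem_fil P h _

theorem fil_le {r : ℤ} {n : ℕ} {p : Submodule S (P.Term n)}
    (h : ∀ (m : ℕ) (a : Fin n → P.g) (b : P.h), (m : ℤ) ≤ -(n : ℤ) + r → mon P m a b ∈ p) :
    fil P r n ≤ p := by
  rw [fil_eq]
  refine iSup_le fun ⟨m, hm⟩ => ?_
  rintro _ ⟨z, rfl⟩
  have := LinearMap.congr_fun (of_comp_ext P (F := p.mkQ) (F' := 0) (m := m) fun a b =>
    (Submodule.Quotient.mk_eq_zero p).2 (h m a b hm)) z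
  exact (Submodule.Quotient.mk_eq_zero p).1 this

theorem fil_mono (r : ℤ) (n : ℕ) : fil P r n ≤ fil P (r + 1) n :=
  fil_le P fun _ a b h => mon_mem_fil P (by omega) a b

theorem d_fil (r : ℤ) (n : ℕ) : fil P r (n + 1) ≤ (fil P r n).comap (d P n) := by
  refine fil_le P fun m a b h => ?_
  rw [Submodule.mem_comap, d_mon, JB.dMon]
  simp only [map_add, map_sum, map_smul, equiv_of, equiv_mon]
  refine Submodule.add_mem _ (Submodule.sum_mem _ fun i _ => Submodule.sum_mem _ fun t _ =>
    Submodule.smul_mem _ _ (of_mem_fil P (by push_cast at h ⊢; omega) _))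
    (Submodule.sum_mem _ fun i _ => Submodule.sum_mem _ fun j _ =>
    Submodule.smul_mem _ _ (mon_mem_fil P (by push_cast at h ⊢; omega) _ _))

theorem comul_fil {n p q : ℕ} (h : p + q = n) (r : ℤ) :
    fil P r n ≤ (⨆ s : ℤ, LinearMap.range
      (TensorProduct.map (fil P s p).subtype (fil P (r - s) q).subtype)).comap (comul P n p q) := by
  refine fil_le P fun m a b hm => ?_
  rw [Submodule.mem_comap, comul_mon P h, JB.comulMon]
  simp only [map_sum, map_smul, map_tmul, LinearEquiv.coe_coe, equiv_mon]
  refine Submodule.sum_mem _ fun I _ => Submodule.sum_mem _ fun k hk => Submodule.smul_mem _ _ ?_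
  have hk := Finset.mem_range.1 hk
  -- `k + p` is the weight of the left factor `a_I ⊗ b ^ k`; the remaining `r - k - p` is enough for
  -- the right one.
  exact Submodule.mem_iSup_of_mem ((k : ℤ) + p)
    ⟨(⟨_, mon_mem_fil P (by omega) _ _⟩ : fil P _ p) ⊗ₜ
      (⟨_, mon_mem_fil P (by omega) _ _⟩ : fil P _ q), rfl⟩

/-- For `r ≤ 0` the bound admits at most `n = m = 0`, where `of` is zero by convention. -/
theorem fil_eq_bot {r : ℤ} (h : r ≤ 0) (n : ℕ) : fil P r n = ⊥ := by
  refine le_bot_iff.1 (fil_le P fun m a b hm => ?_)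
  obtain ⟨rfl, rfl⟩ : n = 0 ∧ m = 0 := by omega
  rw [mon_zero_zero]
  exact Submodule.zero_mem _

/-- The Jacobi-Bernoulli complex. -/
def complex : CoFiltComplex.{u, max u v w} S where
  X := P.Term
  d := d P
  d_d := d_d P
  fil := fil P
  fil_mono := fil_mono P
  d_fil := d_fil P
  comul {n p q} _ := comul P n p q
  comul_d h := comul_d P h
  coassoc hpq ha hqr hb := coassoc P hpq ha hqr hb
  cocomm h h' := cocomm P h h'
  comul_fil h r := comul_fil P h r

/-! ### Functoriality -/

variable {P}
variable {Q : LiePair.{u, v, w} S} (f : P ⟶ Q)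

/-- The map induced by a morphism on chains. -/
def chainMap : P.Chain →ₗ[S] Q.Chain :=
  CEChain.map (f.φ : P.g →ₗ[S] Q.g) (SymmAlg.map (f.ψ : P.h →ₗ[S] Q.h)).toLinearMap

theorem chainMap_bdry (x : P.Chain) : chainMap f (bdry P x) = bdry Q (chainMap f x) := by
  refine CEChain.map_ce (fun a b => by simp) (fun a u => ?_) _ _ x
  simp only [rho_apply, AlgHom.toLinearMap_apply, LieHom.coe_toLinearMap]
  rw [SymmAlg.map_symAct, f.comm]

theorem chainMap_comul (x : P.Chain) :
    TensorProduct.map (chainMap f) (chainMap f) (chainComul P x) = chainComul Q (chainMap f x) :=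
  (CEChain.comul_map _ _ _ (SymmAlg.coprod_map _) x).symm

/-- The map induced by a morphism on the Jacobi-Bernoulli complexes. -/
def map (n : ℕ) : P.Term n →ₗ[S] Q.Term n := proj Q n ∘ₗ chainMap f ∘ₗ incl P n

theorem map_proj (n : ℕ) (x : P.Chain) : map f n (proj P n x) = proj Q n (chainMap f x) := by
  refine comp_incl_proj P (F := proj Q n ∘ₗ chainMap f) (fun k hk a u => ?_) ?_ x
  · simp [chainMap, CEChain.map_wedges, proj_wedges_of_ne Q hk]
  · simp [chainMap, proj_coeff_one]

theorem map_mon {n : ℕ} (m : ℕ) (a : Fin n → P.g) (b : P.h) :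
    map f n (mon P m a b) = mon Q m (fun k => f.φ (a k)) (f.ψ b) := by
  rw [← proj_wedges_divPow, map_proj, chainMap, CEChain.map_wedges, ← proj_wedges_divPow]
  simp [SymmAlg.map_divPow]

/-- The morphism of complexes induced by a morphism of Lie pairs. -/
def complexMap : complex P ⟶ complex Q where
  app := map f
  comm_d n (z : P.Term (n + 1)) := by
    obtain ⟨x, rfl⟩ := proj_surjective P _ z
    change map f n (d P n _) = d Q n (map f (n + 1) _)
    rw [d_proj, map_smul, map_proj, map_proj, d_proj, chainMap_bdry]
  map_fil r n := fil_le P (p := (fil Q r n).comap (map f n)) fun m a b h => by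
    rw [Submodule.mem_comap, map_mon]
    exact mon_mem_fil Q h _ _
  comm_comul {n p q} h (z : P.Term n) := by
    obtain ⟨x, rfl⟩ := proj_surjective P _ z
    change TensorProduct.map (map f p) (map f q) (comul P n p q _) = comul Q n p q (map f n _)
    rw [comul_proj P h, map_proj, comul_proj Q h, ← chainMap_comul, TensorProduct.map_map,
      TensorProduct.map_map]
    congr 2 <;> exact LinearMap.ext (map_proj f _)

theorem complexMap_id : complexMap (𝟙 P) = 𝟙 (complex P) :=
  CoFiltComplex.Hom.ext (funext fun n =>
    linearMap_ext P (F := map (𝟙 P) n) (F' := LinearMap.id) fun m a b => map_mon _ m a b)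

theorem complexMap_comp {R : LiePair.{u, v, w} S} (f' : Q ⟶ R) :
    complexMap (f ≫ f') = complexMap f ≫ complexMap f' := by
  refine CoFiltComplex.Hom.ext (funext fun n => ?_)
  refine linearMap_ext P (F := map (f ≫ f') n) (F' := map f' n ∘ₗ map f n) fun m a b => ?_
  rw [LinearMap.comp_apply, map_mon f m a b, map_mon f', map_mon]
  rfl

variable (S) in
/-- The Jacobi-Bernoulli functor. -/
def functor : LiePair.{u, v, w} S ⥤ CoFiltComplex.{u, max u v w} S where
  obj P := complex P
  map f := complexMap f
  map_id _ := complexMap_id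
  map_comp f f' := complexMap_comp f f'

end Term

end LiePair

/-! ### Exterior powers of a Lie pair and chains -/

namespace LiePair

namespace ExtPow

variable {S : Type u} [CommRing S] (P : LiePair.{u, v, w} S)

/-- The tensor product with a factor on the left. -/
def consT (r : ℕ) : (P.g × P.h) →ₗ[S] T P r →ₗ[S] T P (r + 1) :=
  PiTensorProduct.lift.toLinearMap ∘ₗ
    (PiTensorProduct.tprod S (s := fun _ : Fin (r + 1) => P.g × P.h)).curryLeft

theorem consT_tprod {r : ℕ} (v : P.g × P.h) (w : Fin r → P.g × P.h) :
    consT P r v (PiTensorProduct.tprod S w) = PiTensorProduct.tprod S (Fin.cons v w) := by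
  simp [consT]

theorem consT_mono {r : ℕ} (s : P.g ⊕ P.h) (x : Fin r → P.g ⊕ P.h) :
    consT P r (tot s) (mono P r x) = mono P (r + 1) (Fin.cons s x) := by
  rw [mono, consT_tprod, mono]
  congr 1
  funext k
  refine Fin.cases ?_ (fun k => ?_) k <;> simp

theorem tot_inl_add_tot_inr (v : P.g × P.h) :
    tot (P := P) (.inl v.1) + tot (.inr v.2) = v := by
  simp [tot]

variable {P}

theorem prod_ext {N : Type*} [AddCommGroup N] [Module S N] {F F' : (P.g × P.h) →ₗ[S] N}
    (h : ∀ s, F (tot s) = F' (tot s)) : F = F' := by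
  ext v
  · exact h (.inl v)
  · exact h (.inr v)

/-- Homogeneous tensors span: every factor is the sum of its components in `g` and `h`, split one
position at a time. -/
theorem T_ext {N : Type*} [AddCommGroup N] [Module S N] {r : ℕ} {F F' : T P r →ₗ[S] N}
    (h : ∀ x, F (mono P r x) = F' (mono P r x)) : F = F' := by
  induction r with
  | zero =>
    refine PiTensorProduct.ext (MultilinearMap.ext fun w => ?_)
    have : w = fun k => tot (Fin.elim0 k) := Subsingleton.elim _ _
    rw [this]
    exact h fun k => Fin.elim0 k
  | succ r ih =>
    have h1 : ∀ s, F ∘ₗ consT P r (tot s) = F' ∘ₗ consT P r (tot s) := fun s => ih fun x => by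
      simp only [LinearMap.comp_apply, consT_mono, h]
    have h2 : LinearMap.llcomp S _ _ _ F ∘ₗ consT P r = LinearMap.llcomp S _ _ _ F' ∘ₗ consT P r :=
      prod_ext h1
    refine PiTensorProduct.ext (MultilinearMap.ext fun w => ?_)
    have h3 := LinearMap.congr_fun (LinearMap.congr_fun h2 (w 0)) (PiTensorProduct.tprod S
      (Fin.tail w))
    simp only [LinearMap.comp_apply, LinearMap.llcomp_apply, consT_tprod] at h3
    have : (Fin.cons (w 0) (Fin.tail w) : Fin (r + 1) → P.g × P.h) = w := Fin.cons_self_tail w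
    rwa [this] at h3

theorem total_ext {N : Type*} [AddCommGroup N] [Module S N] {r : ℕ} {F F' : Total P r →ₗ[S] N}
    (h : ∀ x, F ((rel P r).mkQ (mono P r x)) = F' ((rel P r).mkQ (mono P r x))) : F = F' :=
  Submodule.linearMap_qext _ (T_ext h)

theorem cons_comp_swap {α : Type*} {r : ℕ} (s : α) (x : Fin r → α) (k l : Fin r) :
    (Fin.cons s x : Fin (r + 1) → α) ∘ Equiv.swap k.succ l.succ =
      Fin.cons s (x ∘ Equiv.swap k l) := by
  funext m
  refine Fin.cases ?_ (fun m => ?_) m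
  · rw [Function.comp_apply, Equiv.swap_apply_of_ne_of_ne (Fin.succ_ne_zero k).symm
      (Fin.succ_ne_zero l).symm]
    rfl
  · rw [Function.comp_apply, Fin.cons_succ, Function.comp_apply]
    rcases eq_or_ne m k with rfl | hk
    · simp
    · rcases eq_or_ne m l with rfl | hl
      · simp
      · rw [Equiv.swap_apply_of_ne_of_ne (by simpa using hk) (by simpa using hl),
          Equiv.swap_apply_of_ne_of_ne hk hl, Fin.cons_succ]

theorem cons_cons_comp_swap {α : Type*} {r : ℕ} (s t : α) (x : Fin r → α) :
    (Fin.cons s (Fin.cons t x : Fin (r + 1) → α) : Fin (r + 2) → α) ∘ Equiv.swap 0 1 =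
      Fin.cons t (Fin.cons s x : Fin (r + 1) → α) := by
  funext m
  refine Fin.cases ?_ (fun m => ?_) m
  · simp
  · refine Fin.cases ?_ (fun m => ?_) m
    · simp
    · rw [Function.comp_apply, Equiv.swap_apply_of_ne_of_ne (b := 1) (Fin.succ_ne_zero _)
        (fun h => Fin.succ_ne_zero m (Fin.succ_injective _ h))]
      rfl

theorem consT_rel {r : ℕ} (v : P.g × P.h) : rel P r ≤ (rel P (r + 1)).comap (consT P r v) := by
  have h : ∀ s : P.g ⊕ P.h, rel P r ≤ (rel P (r + 1)).comap (consT P r (tot s)) := fun s => by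
    rw [rel, Submodule.span_le]
    rintro _ ⟨x, k, l, h, rfl⟩
    change consT P r (tot s) _ ∈ rel P (r + 1)
    rw [map_add, map_smul, consT_mono, consT_mono]
    have := rel_mem (Fin.cons s x : Fin (r + 1) → P.g ⊕ P.h) k.succ l.succ (by simp [h])
    rwa [cons_comp_swap] at this
  rw [← tot_inl_add_tot_inr P v, map_add]
  exact fun z hz => Submodule.add_mem (rel P (r + 1)) (h _ hz) (h _ hz)

variable (P)

/-- The exterior product with a factor on the left. -/
def cons (r : ℕ) : (P.g × P.h) →ₗ[S] Total P r →ₗ[S] Total P (r + 1) where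
  toFun v := (rel P r).mapQ (rel P (r + 1)) (consT P r v) (consT_rel v)
  map_add' v w := Submodule.linearMap_qext _ (by ext; simp)
  map_smul' c v := Submodule.linearMap_qext _ (by ext; simp)

theorem cons_mk {r : ℕ} (v : P.g × P.h) (z : T P r) :
    cons P r v ((rel P r).mkQ z) = (rel P (r + 1)).mkQ (consT P r v z) := rfl

theorem cons_cons {r : ℕ} (s t : P.g ⊕ P.h) (z : Total P r) :
    cons P (r + 1) (tot s) (cons P r (tot t) z) =
      -((koszul s t : S) • cons P (r + 1) (tot t) (cons P r (tot s) z)) := by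
  refine LinearMap.congr_fun (f := cons P (r + 1) (tot s) ∘ₗ cons P r (tot t))
    (g := -((koszul s t : S) • cons P (r + 1) (tot t) ∘ₗ cons P r (tot s))) (total_ext fun x => ?_) z
  simp only [LinearMap.comp_apply, LinearMap.neg_apply, LinearMap.smul_apply, cons_mk, consT_mono]
  have := rel_mem (Fin.cons s (Fin.cons t x : Fin (r + 1) → P.g ⊕ P.h)) 0 1 rfl
  rw [cons_cons_comp_swap] at this
  rw [eq_neg_iff_add_eq_zero, ← map_smul, ← map_add]
  exact (Submodule.Quotient.mk_eq_zero _).2 this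

/-- The differential of the total module of an exterior power. -/
def totalD (r : ℕ) : Total P r →ₗ[S] Total P r := (rel P r).mapQ (rel P r) (tD P r) tD_rel

theorem tD_consT {r : ℕ} (v : P.g × P.h) (z : T P r) :
    tD P (r + 1) (consT P r v z) = consT P r (bd P v) z + consT P r (sg P v) (tD P r z) := by
  refine LinearMap.congr_fun (f := tD P (r + 1) ∘ₗ consT P r v)
    (g := consT P r (bd P v) + consT P r (sg P v) ∘ₗ tD P r)
    (PiTensorProduct.ext (MultilinearMap.ext fun w => ?_)) z
  simp only [LinearMap.compMultilinearMap_apply, LinearMap.comp_apply, LinearMap.add_apply,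
    consT_tprod, tD, LinearMap.sum_apply, PiTensorProduct.map_tprod, Fin.sum_univ_succ, map_sum]
  congr 1
  · congr 1
    funext l
    refine Fin.cases ?_ (fun l => ?_) l <;> simp
  · refine Finset.sum_congr rfl fun k _ => ?_
    congr 1
    funext l
    refine Fin.cases ?_ (fun l => ?_) l
    · simp
    · simp only [Fin.cons_succ, Fin.succ_lt_succ_iff, Fin.succ_inj]

theorem totalD_cons {r : ℕ} (v : P.g × P.h) (z : Total P r) :
    totalD P (r + 1) (cons P r v z) =
      cons P r (bd P v) z + cons P r (sg P v) (totalD P r z) := by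
  obtain ⟨z, rfl⟩ := (rel P r).mkQ_surjective z
  have := congrArg (rel P (r + 1)).mkQ (tD_consT P v z)
  rwa [map_add] at this

theorem cons_mem_piece {r n : ℕ} (s : P.g ⊕ P.h) {z : Total P r} (hz : z ∈ piece P r n) :
    cons P r (tot s) z ∈ piece P (r + 1) (if s.isLeft then n + 1 else n) := by
  suffices h : piece P r n ≤ (piece P (r + 1) (if s.isLeft then n + 1 else n)).comap
      (cons P r (tot s)) from h hz
  rw [piece, Submodule.span_le]
  rintro _ ⟨x, hx, rfl⟩
  refine Submodule.subset_span ⟨Fin.cons s x, ?_, ?_⟩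
  · have hx' : ∑ k, (if (x k).isLeft then 1 else 0) = n := by rw [← hx, Finset.card_filter]
    rw [Finset.card_filter, Fin.sum_univ_succ]
    simp only [Fin.cons_zero, Fin.cons_succ, hx']
    rcases s with a | b <;> simp [add_comm]
  · rw [cons_mk, consT_mono]

variable {P} {Q : LiePair.{u, v, w} S} (f : P ⟶ Q)

/-- The map induced by a morphism on the total modules of the exterior powers. -/
def totalMap (r : ℕ) : Total P r →ₗ[S] Total Q r :=
  (rel P r).mapQ (rel Q r) (tMap r f) (tMap_rel r f)

theorem totalMap_cons {r : ℕ} (s : P.g ⊕ P.h) (z : Total P r) :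
    totalMap f (r + 1) (cons P r (tot s) z) =
      cons Q r (tot (s.map f.φ f.ψ)) (totalMap f r z) := by
  refine LinearMap.congr_fun (f := totalMap f (r + 1) ∘ₗ cons P r (tot s))
    (g := cons Q r (tot (s.map f.φ f.ψ)) ∘ₗ totalMap f r) (total_ext fun x => ?_) z
  change (rel Q (r + 1)).mkQ (tMap (r + 1) f (consT P r (tot s) (mono P r x))) =
    (rel Q (r + 1)).mkQ (consT Q r (tot (s.map f.φ f.ψ)) (tMap r f (mono P r x)))
  rw [consT_mono, tMap_mono, tMap_mono, consT_mono]
  congr 2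
  funext k
  refine Fin.cases ?_ (fun k => ?_) k <;> simp

end ExtPow

end LiePair

/-! ### The symbol of the differential -/

namespace CEChain

variable {S : Type*} [CommRing S] {G : Type*} [AddCommGroup G] [Module S G]
  {M : Type*} [AddCommGroup M] [Module S M]

theorem der_zero (R : Module.End S M) (x : CEChain S G M) :
    der 0 R x = map LinearMap.id R x :=
  hom_ext (F := der 0 R) (F' := map LinearMap.id R) (fun u => by simp) (fun a x h => by simp [h]) x

end CEChain

namespace LiePair

namespace Chain

variable {S : Type u} [CommRing S] (P : LiePair.{u, v, w} S)

/-- The multiplication of the coefficients by elements of `h`. -/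
def coeffMul : P.h →ₗ[S] Module.End S P.Chain where
  toFun b := CEChain.map LinearMap.id (SymmAlg.mulι b)
  map_add' a b := LinearMap.ext <| CEChain.hom_ext (fun u => by simp)
    fun c x h => by
      simp only [LinearMap.add_apply] at h ⊢
      rw [CEChain.map_wedge, h, CEChain.map_wedge, CEChain.map_wedge, map_add]
  map_smul' c b := LinearMap.ext <| CEChain.hom_ext (fun u => by simp)
    fun a x h => by
      simp only [LinearMap.smul_apply] at h ⊢
      rw [CEChain.map_wedge, h, CEChain.map_wedge, map_smul]

@[simp]
theorem coeffMul_coeff (b : P.h) (u : SymmAlg S P.h) :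
    coeffMul P b (CEChain.coeff S _ _ u) = CEChain.coeff S _ _ (SymmAlg.ι S _ b * u) :=
  CEChain.map_coeff _ _ _

@[simp]
theorem coeffMul_wedge (b : P.h) (a : P.g) (x : P.Chain) :
    coeffMul P b (CEChain.wedge a x) = CEChain.wedge a (coeffMul P b x) :=
  CEChain.map_wedge _ _ _ _

theorem coeffMul_wedges (b : P.h) {n : ℕ} (a : Fin n → P.g) (u : SymmAlg S P.h) :
    coeffMul P b (CEChain.wedges S _ a u) = CEChain.wedges S _ a (SymmAlg.ι S _ b * u) :=
  CEChain.map_wedges _ _ _ _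

theorem coeffMul_sgn (b : P.h) (x : P.Chain) :
    coeffMul P b (CEChain.sgn x) = CEChain.sgn (coeffMul P b x) :=
  CEChain.map_sgn _ _ _

theorem coeffMul_comm (b c : P.h) (x : P.Chain) :
    coeffMul P b (coeffMul P c x) = coeffMul P c (coeffMul P b x) :=
  CEChain.hom_ext (F := coeffMul P b ∘ₗ coeffMul P c) (F' := coeffMul P c ∘ₗ coeffMul P b)
    (fun u => by simp [mul_left_comm]) (fun a x h => by
      simp only [LinearMap.comp_apply] at h ⊢
      simp [h]) x

/-- The exterior product with elements of `g` and `h`. -/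
def mul : (P.g × P.h) →ₗ[S] Module.End S P.Chain :=
  CEChain.wedge ∘ₗ LinearMap.fst S _ _ +
    LinearMap.llcomp S _ _ _ CEChain.sgn ∘ₗ coeffMul P ∘ₗ LinearMap.snd S _ _

@[simp]
theorem mul_inl (a : P.g) (x : P.Chain) : mul P (tot (.inl a)) x = CEChain.wedge a x := by
  simp [mul, tot]

@[simp]
theorem mul_inr (b : P.h) (x : P.Chain) :
    mul P (tot (.inr b)) x = CEChain.sgn (coeffMul P b x) := by
  simp [mul, tot]

/-- The sign operator in the product with `h` makes elements of `h` anticommute with those of `g`,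
while they commute among themselves. These are the relations of the exterior power, with `h` in odd
degree. -/
theorem mul_mul (s t : P.g ⊕ P.h) (x : P.Chain) :
    mul P (tot s) (mul P (tot t) x) = -((koszul s t : S) • mul P (tot t) (mul P (tot s) x)) := by
  rcases s with a | b <;> rcases t with a' | b'
  · simp [koszul, CEChain.wedge_wedge_comm a a']
  · simp [koszul]
  · simp [koszul]
  · simp [koszul, coeffMul_sgn, coeffMul_comm P b b']

/-- The symbol of the differential of chains. -/
def symbol : Module.End S P.Chain :=
  CEChain.ce 0 (SymmAlg.mulι ∘ₗ (P.i : P.g →ₗ[S] P.h)) fun _ => rfl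

@[simp]
theorem symbol_coeff (u : SymmAlg S P.h) : symbol P (CEChain.coeff S _ _ u) = 0 :=
  CEChain.ce_coeff _ _ _ _

@[simp]
theorem symbol_wedge (a : P.g) (x : P.Chain) :
    symbol P (CEChain.wedge a x) = coeffMul P (P.i a) x - CEChain.wedge a (symbol P x) := by
  rw [symbol, CEChain.ce_wedge]
  congr 1
  exact CEChain.der_zero _ _

theorem symbol_wedges {n : ℕ} (a : Fin (n + 1) → P.g) (u : SymmAlg S P.h) :
    symbol P (CEChain.wedges S _ a u) = ∑ i : Fin (n + 1), (-1 : S) ^ (i : ℕ) •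
      CEChain.wedges S _ (i.removeNth a) (SymmAlg.ι S _ (P.i (a i)) * u) := by
  rw [symbol, CEChain.ce_wedges]
  refine (add_eq_left (M := P.Chain)).2 ?_
  refine Finset.sum_eq_zero fun i _ => Finset.sum_eq_zero fun j hj => ?_
  have hij := Finset.mem_Ioi.1 hj
  obtain ⟨k, hk⟩ := Fin.exists_succAbove_eq hij.ne
  have : j.removeNth (Function.update a i ((0 : P.g →ₗ[S] Module.End S P.g) (a j) (a i))) =
      Function.update (j.removeNth a) k 0 := by
    subst hk
    exact Fin.removeNth_update_succAbove _ _ _ _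
  rw [this, CEChain.wedges, AlternatingMap.map_update_zero]
  simp

end Chain

/-! ### Recursion on exterior powers and comparison with chains -/

namespace ExtPow

variable {S : Type u} [CommRing S] (P : LiePair.{u, v, w} S)

/-- The unit of the exterior algebra. -/
def one : Total P 0 := (rel P 0).mkQ (mono P 0 Fin.elim0)

variable {P} in
theorem total_zero_ext {N : Type*} [AddCommGroup N] [Module S N] {F F' : Total P 0 →ₗ[S] N}
    (h : F (one P) = F' (one P)) : F = F' :=
  total_ext fun x => by rw [Subsingleton.elim x Fin.elim0]; exact h

variable {P} in
theorem total_succ_ext {N : Type*} [AddCommGroup N] [Module S N] {r : ℕ}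
    {F F' : Total P (r + 1) →ₗ[S] N}
    (h : ∀ s z, F (cons P r (tot s) z) = F' (cons P r (tot s) z)) : F = F' :=
  total_ext fun x => by
    have := h (x 0) ((rel P r).mkQ (mono P r (Fin.tail x)))
    rwa [cons_mk, consT_mono, Fin.cons_self_tail] at this

theorem totalD_zero : totalD P 0 = 0 := total_zero_ext <| by
  change (rel P 0).mkQ (tD P 0 _) = _
  simp [tD]

section Fold

variable {P} {N : Type*} [AddCommGroup N] [Module S N] (F : (P.g × P.h) →ₗ[S] Module.End S N)
  (hF : ∀ s t x, F (tot s) (F (tot t) x) = -((koszul s t : S) • F (tot t) (F (tot s) x))) (z₀ : N)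

/-- The iterated application of operators, on tensors. -/
def foldT (r : ℕ) : T P r →ₗ[S] N :=
  PiTensorProduct.lift ((LinearMap.applyₗ z₀).compMultilinearMap
    ((MultilinearMap.mkPiAlgebraFin S r (Module.End S N)).compLinearMap fun _ => F))

theorem foldT_consT {r : ℕ} (v : P.g × P.h) (z : T P r) :
    foldT F z₀ (r + 1) (consT P r v z) = F v (foldT F z₀ r z) := by
  refine LinearMap.congr_fun (f := foldT F z₀ (r + 1) ∘ₗ consT P r v)
    (g := F v ∘ₗ foldT F z₀ r)
    (PiTensorProduct.ext (MultilinearMap.ext fun w => ?_)) z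
  simp [consT_tprod, foldT, List.ofFn_succ]

theorem foldT_mono_succ {r : ℕ} (x : Fin (r + 1) → P.g ⊕ P.h) :
    foldT F z₀ (r + 1) (mono P (r + 1) x) = F (tot (x 0)) (foldT F z₀ r (mono P r (Fin.tail x))) := by
  rw [← foldT_consT, consT_mono, Fin.cons_self_tail]

theorem foldT_zero (x : Fin 0 → P.g ⊕ P.h) : foldT F z₀ 0 (mono P 0 x) = z₀ := by
  simp [foldT, mono]

include hF in
theorem foldT_swap {r : ℕ} (x : Fin r → P.g ⊕ P.h) (k l : Fin r) (h : (l : ℕ) = k + 1) :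
    foldT F z₀ r (mono P r x + (koszul (x k) (x l) : S) • mono P r (x ∘ Equiv.swap k l)) = 0 := by
  -- Common leading factors are stripped until the exchanged pair stands in front, where the claim
  -- is `hF`.
  induction r with
  | zero => exact k.elim0
  | succ r ih =>
    rw [map_add, map_smul]
    obtain ⟨l, rfl⟩ := Fin.exists_succ_eq.2 (show l ≠ 0 from fun e => by simp [e] at h)
    obtain ⟨s, y, rfl⟩ : ∃ s y, x = Fin.cons s y := ⟨_, _, (Fin.cons_self_tail x).symm⟩
    induction k using Fin.cases with
    | zero =>
      cases r with
      | zero => exact l.elim0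
      | succ r =>
        obtain rfl : l = 0 := Fin.ext (by simpa using h)
        obtain ⟨t, y, rfl⟩ : ∃ t y', y = Fin.cons t y' := ⟨_, _, (Fin.cons_self_tail y).symm⟩
        have h1 := cons_cons_comp_swap s t y
        rw [Fin.succ_zero_eq_one, h1]
        simp only [foldT_mono_succ, Fin.tail_cons, Fin.cons_zero, Fin.cons_one]
        rw [hF s t, neg_add_cancel]
    | succ k =>
      rw [cons_comp_swap]
      simp only [foldT_mono_succ, Fin.tail_cons, Fin.cons_zero, Fin.cons_succ]
      rw [← map_smul, ← map_add, ← map_smul, ← map_add, ih y k l (by simpa using h), map_zero]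

/-- The iterated application of operators. -/
def fold (r : ℕ) : Total P r →ₗ[S] N :=
  (rel P r).liftQ (foldT F z₀ r) (by
    rw [rel, Submodule.span_le]
    rintro _ ⟨x, k, l, h, rfl⟩
    exact foldT_swap F hF z₀ x k l h)

theorem fold_cons {r : ℕ} (v : P.g × P.h) (z : Total P r) :
    fold F hF z₀ (r + 1) (cons P r v z) = F v (fold F hF z₀ r z) := by
  obtain ⟨z, rfl⟩ := (rel P r).mkQ_surjective z
  exact foldT_consT F z₀ v z

theorem fold_one : fold F hF z₀ 0 (one P) = z₀ := foldT_zero F z₀ _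

end Fold

/-- The inverse of `ofChain`. -/
def toChain (r : ℕ) : Total P r →ₗ[S] P.Chain :=
  fold (Chain.mul P) (Chain.mul_mul P) (CEChain.coeff S _ _ 1) r

theorem toChain_cons {r : ℕ} (v : P.g × P.h) (z : Total P r) :
    toChain P (r + 1) (cons P r v z) = Chain.mul P v (toChain P r z) := fold_cons _ _ _ v z

theorem toChain_one : toChain P 0 (one P) = CEChain.coeff S _ _ 1 := fold_one _ _ _

/-- The product of all exterior powers. -/
def Powers : Type (max u v w) := ∀ r, Total P r

instance : AddCommGroup (Powers P) := inferInstanceAs (AddCommGroup (∀ r, Total P r))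

instance : Module S (Powers P) :=
  { (inferInstance : Module S (∀ r, Total P r)) with }

/-- The projections. -/
def Powers.proj (r : ℕ) : Powers P →ₗ[S] Total P r where
  toFun z := z r
  map_add' _ _ := rfl
  map_smul' _ _ := rfl

variable {P} in
theorem Powers.ext {z z' : Powers P} (h : ∀ r, Powers.proj P r z = Powers.proj P r z') : z = z' := funext h

/-- The unit. -/
def Powers.one : Powers P := Pi.single 0 (ExtPow.one P)

/-- The exterior product with a factor on the left, on all exterior powers. -/
def consPi : (P.g × P.h) →ₗ[S] Module.End S (Powers P) :=
  LinearMap.mk₂ S (fun v z r => match r with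
    | 0 => 0
    | r + 1 => cons P r v (Powers.proj P r z))
    (fun v w z => Powers.ext fun r => by
      cases r
      · exact (add_zero _).symm
      · exact LinearMap.congr_fun (map_add (cons P _) v w) _)
    (fun c v z => Powers.ext fun r => by
      cases r
      · exact (smul_zero c).symm
      · exact LinearMap.congr_fun (map_smul (cons P _) c v) _)
    (fun v z z' => Powers.ext fun r => by
      cases r
      · exact (add_zero _).symm
      · exact map_add (cons P _ v) _ _)
    (fun c v z => Powers.ext fun r => by
      cases r
      · exact (smul_zero c).symm
      · exact map_smul (cons P _ v) c _)

@[simp]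
theorem consPi_zero (v : P.g × P.h) (z : Powers P) : Powers.proj P 0 (consPi P v z) = 0 := rfl

@[simp]
theorem consPi_succ (v : P.g × P.h) (z : Powers P) (r : ℕ) :
    Powers.proj P (r + 1) (consPi P v z) = cons P r v (Powers.proj P r z) := rfl

theorem consPi_consPi (s t : P.g ⊕ P.h) (z : Powers P) :
    consPi P (tot s) (consPi P (tot t) z) =
      -((koszul s t : S) • consPi P (tot t) (consPi P (tot s) z)) := by
  refine Powers.ext fun r => ?_
  rcases r with _ | _ | r
  · simp
  · simp
  · simp [cons_cons P s t]

variable [Algebra ℚ S]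

/-- The relations only give `a ∧ a = -a ∧ a`; that `2` is invertible does the rest. -/
theorem consPi_inl_self (a : P.g) (z : Powers P) :
    (consPi P ∘ₗ LinearMap.inl S P.g P.h) a ((consPi P ∘ₗ LinearMap.inl S P.g P.h) a z) = 0 := by
  have h := consPi_consPi P (.inl a) (.inl a) z
  rw [show koszul (Sum.inl a : P.g ⊕ P.h) (.inl a) = (1 : S) from rfl, one_smul, eq_neg_iff_add_eq_zero, ← two_smul S] at h
  refine SymmAlg.smul_cancel S 1 ?_
  rw [Nat.cast_one, one_add_one_eq_two, smul_zero]
  exact h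

/-- The product of the elements of `h`. -/
def ofSym : SymmAlg S P.h →ₗ[S] Powers P :=
  SymmAlg.fold (consPi P ∘ₗ LinearMap.inr S P.g P.h) (fun b c => by
    ext1 z
    have := consPi_consPi P (.inr b) (.inr c) z
    rw [show koszul (Sum.inr b : P.g ⊕ P.h) (.inr c) = (-1 : S) from rfl, neg_one_smul,
      neg_neg] at this
    exact this) (Powers.one P)

/-- The map from chains to the exterior powers. -/
def ofChain : P.Chain →ₗ[S] Powers P :=
  CEChain.foldEnd (consPi P ∘ₗ LinearMap.inl S P.g P.h) (consPi_inl_self P) (ofSym P)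

theorem ofChain_one : ofChain P (CEChain.coeff S _ _ 1) = Powers.one P := by
  simp [ofChain, ofSym]

/-- By definition `ofChain` puts the factors from `g` outside those from `h`. A new factor from `h`
therefore has to move inwards past them, and the sign in `Chain.mul` accounts for this. -/
theorem ofChain_mul (s : P.g ⊕ P.h) (x : P.Chain) :
    ofChain P (Chain.mul P (tot s) x) = consPi P (tot s) (ofChain P x) := by
  rcases s with a | b
  · rw [Chain.mul_inl, ofChain, CEChain.foldEnd_wedge]
    rfl
  · refine CEChain.hom_ext (F := ofChain P ∘ₗ Chain.mul P (tot (.inr b)))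
      (F' := consPi P (tot (.inr b)) ∘ₗ ofChain P) (fun u => ?_) (fun a x h => ?_) x
    · simp only [LinearMap.comp_apply, Chain.mul_inr, Chain.coeffMul_coeff, CEChain.sgn_coeff,
        ofChain, CEChain.foldEnd_coeff, ofSym, SymmAlg.fold_ι_mul]
      rfl
    · simp only [LinearMap.comp_apply, Chain.mul_inr, Chain.coeffMul_wedge, CEChain.sgn_wedge,
        map_neg] at h ⊢
      have h1 : ∀ y, ofChain P (CEChain.wedge a y) = consPi P (tot (.inl a)) (ofChain P y) :=
        CEChain.foldEnd_wedge _ _ _ a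
      rw [h1, h1, h, consPi_consPi P (.inl a) (.inr b),
        show koszul (Sum.inl a : P.g ⊕ P.h) (.inr b) = (1 : S) from rfl, one_smul, neg_neg]

end ExtPow

end LiePair

/-! ### Bidegrees of chains -/

namespace LiePair

variable {S : Type u} [CommRing S] (P : LiePair.{u, v, w} S)

namespace Chain

/-- The chains `⋀^n g ⊗ Sym^m h` with `n + m = r`. -/
def bidegree (r n : ℕ) : Submodule S P.Chain :=
  Submodule.span S {y | ∃ (m : ℕ) (a : Fin n → P.g) (u : SymmAlg S P.h),
    u ∈ LinearMap.range (SymmAlg.ι S P.h) ^ m ∧ n + m = r ∧ y = CEChain.wedges S _ a u}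

theorem one_mem_bidegree : CEChain.coeff S _ _ 1 ∈ bidegree P 0 0 :=
  Submodule.subset_span ⟨0, Fin.elim0, 1, by rw [pow_zero]; exact Submodule.one_le.1 le_rfl, rfl,
    (CEChain.wedges_zero _ _).symm⟩

theorem mul_mem_bidegree {r n : ℕ} (s : P.g ⊕ P.h) {y : P.Chain} (hy : y ∈ bidegree P r n) :
    mul P (tot s) y ∈ bidegree P (r + 1) (if s.isLeft then n + 1 else n) := by
  suffices h : bidegree P r n ≤ (bidegree P (r + 1) (if s.isLeft then n + 1 else n)).comap
      (mul P (tot s)) from h hy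
  rw [bidegree, Submodule.span_le]
  rintro _ ⟨m, a, u, hu, h, rfl⟩
  rw [SetLike.mem_coe, Submodule.mem_comap]
  rcases s with c | b
  · rw [mul_inl, ← CEChain.wedges_cons]
    exact Submodule.subset_span ⟨m, _, u, hu, by simp; omega, rfl⟩
  · rw [mul_inr, coeffMul_wedges, CEChain.sgn_wedges]
    refine Submodule.smul_mem _ _ (Submodule.subset_span ⟨m + 1, _, _, ?_, by simp; omega, rfl⟩)
    rw [pow_succ']
    exact Submodule.mul_mem_mul (LinearMap.mem_range_self _ b) hu

theorem wedges_ι_mul_divPow_mem_bidegree [Algebra ℚ S] {n m : ℕ} (a : Fin n → P.g) (y b : P.h) :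
    CEChain.wedges S _ a (SymmAlg.ι S _ y * SymmAlg.divPow S m b) ∈ bidegree P (n + (m + 1)) n := by
  refine Submodule.subset_span ⟨m + 1, a, _, ?_, rfl, rfl⟩
  rw [pow_succ']
  exact Submodule.mul_mem_mul (LinearMap.mem_range_self _ y) (Submodule.smul_mem _ _
    (Submodule.pow_mem_pow _ (LinearMap.mem_range_self _ b) m))

theorem wedges_divPow_mem_bidegree [Algebra ℚ S] {n m : ℕ} (a : Fin n → P.g) (b : P.h) :
    CEChain.wedges S _ a (SymmAlg.divPow S m b) ∈ bidegree P (n + m) n :=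
  Submodule.subset_span ⟨m, a, _, Submodule.smul_mem _ _
    (Submodule.pow_mem_pow _ (LinearMap.mem_range_self _ b) m), rfl, rfl⟩

variable {P}

/-- Induction principle: chains of bidegree `(r, n)` arise from `1` by `r` multiplications with
homogeneous elements, `n` of them from `g`. By polarization pure powers of elements of `h` suffice.
-/
theorem bidegree_le [Algebra ℚ S] {p : ℕ → ℕ → Submodule S P.Chain}
    (one : CEChain.coeff S _ _ 1 ∈ p 0 0)
    (mul : ∀ r n s, ∀ y ∈ p r n, mul P (tot s) y ∈ p (r + 1) (if s.isLeft then n + 1 else n))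
    (r n : ℕ) : bidegree P r n ≤ p r n := by
  have h0 : ∀ (m : ℕ) (b : P.h), CEChain.coeff S P.g _ (SymmAlg.ι S P.h b ^ m) ∈ p m 0 := by
    intro m b
    induction m with
    | zero => simpa using one
    | succ m ih =>
      have := mul m 0 (.inr b) _ ih
      rw [mul_inr, coeffMul_coeff, CEChain.sgn_coeff, ← pow_succ'] at this
      exact this
  rw [bidegree, Submodule.span_le]
  rintro _ ⟨m, a, u, hu, rfl, rfl⟩
  rw [SymmAlg.range_ι_pow_eq_span] at hu
  suffices h : Submodule.span S (Set.range fun b : P.h => SymmAlg.ι S P.h b ^ m) ≤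
      (p (n + m) n).comap (CEChain.wedges S _ a) from h hu
  rw [Submodule.span_le]
  rintro _ ⟨b, rfl⟩
  rw [SetLike.mem_coe, Submodule.mem_comap]
  induction n with
  | zero => rw [CEChain.wedges_zero, zero_add]; exact h0 m b
  | succ n ih =>
    obtain ⟨c, a, rfl⟩ := Fin.exists_eq_cons a
    have := mul _ _ (.inl c) _ (ih a)
    rw [mul_inl, ← CEChain.wedges_cons] at this
    rwa [Nat.add_right_comm]

end Chain

namespace Term

variable [Algebra ℚ S]

theorem proj_mem_fil {r n : ℕ} {y : P.Chain} (hy : y ∈ Chain.bidegree P r n) :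
    proj P n y ∈ fil P r n := by
  suffices h : Chain.bidegree P r n ≤ (fil P r n).comap (proj P n) from h hy
  rw [Chain.bidegree, Submodule.span_le]
  rintro _ ⟨m, a, u, hu, h, rfl⟩
  obtain ⟨v, rfl⟩ := SymPow.exists_emb_eq hu
  rw [SetLike.mem_coe, Submodule.mem_comap, proj_wedges]
  exact Submodule.smul_mem _ _ (of_mem_fil P (by omega) _)

end Term

namespace ExtPow

/-- The component in the `r`-th exterior power of the element corresponding to a chain. -/
def ofChainAt [Algebra ℚ S] (r : ℕ) : P.Chain →ₗ[S] Total P r := Powers.proj P r ∘ₗ ofChain P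

variable [Algebra ℚ S]

theorem ofChainAt_zero_one : ofChainAt P 0 (CEChain.coeff S _ _ 1) = one P := by
  rw [ofChainAt, LinearMap.comp_apply, ofChain_one]
  rfl

theorem ofChainAt_succ_one (r : ℕ) : ofChainAt P (r + 1) (CEChain.coeff S _ _ 1) = 0 := by
  rw [ofChainAt, LinearMap.comp_apply, ofChain_one]
  rfl

theorem ofChainAt_zero_mul (s : P.g ⊕ P.h) (x : P.Chain) :
    ofChainAt P 0 (Chain.mul P (tot s) x) = 0 := by
  rw [ofChainAt, LinearMap.comp_apply, ofChain_mul]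
  rfl

theorem ofChainAt_succ_mul (r : ℕ) (s : P.g ⊕ P.h) (x : P.Chain) :
    ofChainAt P (r + 1) (Chain.mul P (tot s) x) = cons P r (tot s) (ofChainAt P r x) := by
  rw [ofChainAt, LinearMap.comp_apply, ofChain_mul]
  rfl

variable {P}

theorem ofChainAt_mem_piece {r n : ℕ} {y : P.Chain} (hy : y ∈ Chain.bidegree P r n) :
    ofChainAt P r y ∈ piece P r n := by
  refine Chain.bidegree_le (p := fun r n => (piece P r n).comap (ofChainAt P r)) ?_ ?_ r n hy
  · rw [Submodule.mem_comap, ofChainAt_zero_one]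
    exact Submodule.subset_span ⟨Fin.elim0, rfl, rfl⟩
  · intro r n s y hy
    rw [Submodule.mem_comap] at hy ⊢
    rw [ofChainAt_succ_mul]
    exact cons_mem_piece P s hy

theorem ofChainAt_of_ne {r n k : ℕ} (hk : k ≠ r) {y : P.Chain} (hy : y ∈ Chain.bidegree P r n) :
    ofChainAt P k y = 0 := by
  have := Chain.bidegree_le
    (p := fun r _ => ⨅ k : {k : ℕ // k ≠ r}, LinearMap.ker (ofChainAt P k.1)) ?_ ?_ r n hy
  · exact (Submodule.mem_iInf _).1 this ⟨k, hk⟩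
  · refine (Submodule.mem_iInf _).2 fun ⟨k, hk⟩ => ?_
    obtain ⟨k, rfl⟩ := Nat.exists_eq_succ_of_ne_zero hk
    exact ofChainAt_succ_one P k
  · refine fun r n s y hy => (Submodule.mem_iInf _).2 fun ⟨k, hk⟩ => ?_
    rw [LinearMap.mem_ker]
    cases k with
    | zero => exact ofChainAt_zero_mul P s y
    | succ k =>
      have h1 : ofChainAt P k y = 0 :=
        (Submodule.mem_iInf _).1 hy ⟨k, fun e => hk (congrArg Nat.succ e)⟩
      rw [ofChainAt_succ_mul, h1, map_zero]

/-- Both maps respect the unit and multiplication by homogeneous elements, and these generate. -/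
theorem toChain_ofChainAt {r n : ℕ} {y : P.Chain} (hy : y ∈ Chain.bidegree P r n) :
    toChain P r (ofChainAt P r y) = y := by
  refine Chain.bidegree_le
    (p := fun r _ => LinearMap.eqLocus (toChain P r ∘ₗ ofChainAt P r) LinearMap.id) ?_ ?_ r n hy
  · rw [LinearMap.mem_eqLocus, LinearMap.comp_apply, ofChainAt_zero_one, toChain_one]
    rfl
  · intro r n s y hy
    rw [LinearMap.mem_eqLocus, LinearMap.comp_apply] at hy ⊢
    rw [ofChainAt_succ_mul, toChain_cons, hy]
    rfl

theorem exists_ofChainAt_eq {r : ℕ} (x : Fin r → P.g ⊕ P.h) :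
    ∃ y ∈ Chain.bidegree P r (Finset.univ.filter fun k => (x k).isLeft).card,
      ofChainAt P r y = (rel P r).mkQ (mono P r x) := by
  induction r with
  | zero =>
    refine ⟨_, Chain.one_mem_bidegree P, ?_⟩
    rw [ofChainAt_zero_one, one]
    congr 2
    exact Subsingleton.elim _ _
  | succ r ih =>
    obtain ⟨s, x, rfl⟩ := Fin.exists_eq_cons x
    obtain ⟨y, hy, h⟩ := ih x
    refine ⟨_, ?_, (ofChainAt_succ_mul P r s y).trans ?_⟩
    · have := Chain.mul_mem_bidegree P s hy
      convert this using 1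
      rw [Finset.card_filter, Finset.card_filter, Fin.sum_univ_succ]
      simp only [Fin.cons_zero, Fin.cons_succ]
      rcases s with a | b <;> simp [add_comm]
    · rw [h, cons_mk, consT_mono]

/-- Both sides obey the same recursion under multiplication by an element of `g` or `h`. The
operator `sgn` supplies the sign `(-1) ^ n` that also distinguishes `Term.d` from `Term.bdry`. -/
theorem ofChainAt_sgn_symbol (r : ℕ) (x : P.Chain) :
    ofChainAt P r (CEChain.sgn (Chain.symbol P x)) = totalD P r (ofChainAt P r x) := by
  induction x using CEChain.induction generalizing r with
  | coeff u =>
    rw [Chain.symbol_coeff, map_zero, map_zero]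
    induction u using SymmAlg.ι_mul_induction generalizing r with
    | one =>
      cases r with
      | zero => simp [totalD_zero]
      | succ r => rw [ofChainAt_succ_one, map_zero]
    | smul c u h => rw [map_smul, map_smul, map_smul, ← h, smul_zero]
    | add u v hu hv => rw [map_add, map_add, map_add, ← hu, ← hv, add_zero]
    | ι_mul b u h =>
      have : CEChain.coeff S P.g _ (SymmAlg.ι S P.h b * u) =
          Chain.mul P (tot (.inr b)) (CEChain.coeff S P.g _ u) := by simp
      rw [this]
      cases r with
      | zero => simp [totalD_zero]
      | succ r =>
        rw [ofChainAt_succ_mul, totalD_cons, ← h, map_zero, add_zero]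
        simp [bd, tot, show ((0, 0) : P.g × P.h) = 0 from rfl]
  | add x y hx hy => simp only [map_add, hx, hy]
  | wedge a x h =>
    have h1 : CEChain.sgn (Chain.symbol P (CEChain.wedge a x)) =
        Chain.mul P (tot (.inr (P.i a))) x +
          Chain.mul P (tot (.inl a)) (CEChain.sgn (Chain.symbol P x)) := by
      simp
    rw [h1, ← Chain.mul_inl, map_add]
    cases r with
    | zero =>
      rw [ofChainAt_zero_mul, ofChainAt_zero_mul, ofChainAt_zero_mul, map_zero, add_zero]
    | succ r =>
      rw [ofChainAt_succ_mul, ofChainAt_succ_mul, ofChainAt_succ_mul, totalD_cons, h]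
      congr 2
      simp [sg, tot]

theorem ofChainAt_chainMap {Q : LiePair.{u, v, w} S} (f : P ⟶ Q) (r : ℕ) (x : P.Chain) :
    ofChainAt Q r (Term.chainMap f x) = totalMap f r (ofChainAt P r x) := by
  have h0 : ∀ s x, Term.chainMap f (Chain.mul P (tot s) x) =
      Chain.mul Q (tot (s.map f.φ f.ψ)) (Term.chainMap f x) := by
    rintro (a | b) x
    · simp [Term.chainMap]
    · simp only [Chain.mul_inr, Sum.map_inr]
      rw [Term.chainMap, CEChain.map_sgn]
      congr 1
      refine CEChain.hom_ext
        (F := CEChain.map (f.φ : P.g →ₗ[S] Q.g) (SymmAlg.map (f.ψ : P.h →ₗ[S] Q.h)).toLinearMap ∘ₗ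
          Chain.coeffMul P b)
        (F' := Chain.coeffMul Q (f.ψ b) ∘ₗ
          CEChain.map (f.φ : P.g →ₗ[S] Q.g) (SymmAlg.map (f.ψ : P.h →ₗ[S] Q.h)).toLinearMap)
        (fun u => by simp) (fun a x h => ?_) x
      simp only [LinearMap.comp_apply] at h ⊢
      simp [h]
  have h1 : ∀ s x, (∀ r, ofChainAt Q r (Term.chainMap f x) = totalMap f r (ofChainAt P r x)) →
      ∀ r, ofChainAt Q r (Term.chainMap f (Chain.mul P (tot s) x)) =
        totalMap f r (ofChainAt P r (Chain.mul P (tot s) x)) := by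
    intro s x h r
    rw [h0]
    cases r with
    | zero => rw [ofChainAt_zero_mul, ofChainAt_zero_mul, map_zero]
    | succ r => rw [ofChainAt_succ_mul, ofChainAt_succ_mul, totalMap_cons, h]
  induction x using CEChain.induction generalizing r with
  | coeff u =>
    induction u using SymmAlg.ι_mul_induction generalizing r with
    | one =>
      have : Term.chainMap f (CEChain.coeff S P.g _ 1) = CEChain.coeff S Q.g _ 1 := by
        simp [Term.chainMap]
      rw [this]
      cases r with
      | zero =>
        rw [ofChainAt_zero_one, ofChainAt_zero_one]
        change _ = (rel Q 0).mkQ (tMap 0 f _)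
        rw [tMap_mono, one]
        congr 2
        exact Subsingleton.elim _ _
      | succ r => rw [ofChainAt_succ_one, ofChainAt_succ_one, map_zero]
    | smul c u h => simp only [map_smul, h]
    | add u v hu hv => simp only [map_add, hu, hv]
    | ι_mul b u h =>
      have : CEChain.coeff S P.g _ (SymmAlg.ι S P.h b * u) =
          Chain.mul P (tot (.inr b)) (CEChain.coeff S P.g _ u) := by simp
      rw [this]
      exact h1 _ _ h r
  | add x y hx hy => simp only [map_add, hx, hy]
  | wedge a x h =>
    rw [← Chain.mul_inl]
    exact h1 _ _ h r

end ExtPow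

end LiePair

/-! ### The associated graded complex -/

namespace LiePair

namespace ExtPow

variable {S : Type u} [CommRing S] [Algebra ℚ S] (P : LiePair.{u, v, w} S)

/-- The component in the `r`-th exterior power of an element of the Jacobi-Bernoulli complex. -/
def ofTerm (r n : ℕ) : P.Term n →ₗ[S] Total P r := ofChainAt P r ∘ₗ Term.incl P n

variable {P}

/-- The bound on `r` matters for `n = m = 0`: the chain `1`, absent from the complex, has no
component in positive exterior powers. -/
theorem ofTerm_mon {r n m : ℕ} (hr : 1 ≤ r) (a : Fin n → P.g) (b : P.h) :
    ofTerm P r n (Term.mon P m a b) =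
      ofChainAt P r (CEChain.wedges S _ a (SymmAlg.divPow S m b)) := by
  rcases Nat.eq_zero_or_pos (n + m) with h | h
  · obtain ⟨rfl, rfl⟩ := Nat.add_eq_zero_iff.1 h
    rw [Term.mon_zero_zero, map_zero, SymmAlg.divPow_zero, CEChain.wedges_zero]
    obtain ⟨r, rfl⟩ := Nat.exists_eq_add_of_le' hr
    exact (ofChainAt_succ_one P r).symm
  · rw [ofTerm, LinearMap.comp_apply, Term.incl_mon P h]

theorem ofTerm_proj_wedges {r n : ℕ} (hr : 1 ≤ r) (a : Fin n → P.g) (u : SymmAlg S P.h) :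
    ofTerm P r n (Term.proj P n (CEChain.wedges S _ a u)) =
      ofChainAt P r (CEChain.wedges S _ a u) := by
  refine LinearMap.congr_fun (f := ofTerm P r n ∘ₗ Term.proj P n ∘ₗ CEChain.wedges S _ a)
    (g := ofChainAt P r ∘ₗ CEChain.wedges S _ a)
    (SymmAlg.linearMap_ext_of_divPow fun m b => ?_) u
  simp only [LinearMap.comp_apply]
  rw [Term.proj_wedges_divPow, ofTerm_mon hr]

theorem ofTerm_proj {r n : ℕ} (hr : 1 ≤ r) {y : P.Chain} (hy : y ∈ Chain.bidegree P r n) :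
    ofTerm P r n (Term.proj P n y) = ofChainAt P r y := by
  induction hy using Submodule.span_induction with
  | mem y hy =>
    obtain ⟨m, a, u, -, -, rfl⟩ := hy
    exact ofTerm_proj_wedges hr a u
  | zero => simp
  | add x y _ _ hx hy => simp only [map_add, hx, hy]
  | smul c x _ hx => simp only [map_smul, hx]

theorem ofTerm_mon_of_ne {r n m : ℕ} (hr : 1 ≤ r) (h : n + m ≠ r) (a : Fin n → P.g) (b : P.h) :
    ofTerm P r n (Term.mon P m a b) = 0 := by
  rw [ofTerm_mon hr, ofChainAt_of_ne h.symm (Chain.wedges_divPow_mem_bidegree P a b)]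

theorem ofTerm_mem_piece {r n : ℕ} (hr : 1 ≤ r) {x : P.Term n} (hx : x ∈ Term.fil P r n) :
    ofTerm P r n x ∈ piece P r n := by
  refine Term.fil_le P (p := (piece P r n).comap (ofTerm P r n)) (fun m a b _ => ?_) hx
  rw [Submodule.mem_comap]
  by_cases h : n + m = r
  · subst h
    rw [ofTerm_mon hr]
    exact ofChainAt_mem_piece (Chain.wedges_divPow_mem_bidegree P a b)
  · rw [ofTerm_mon_of_ne hr h]
    exact Submodule.zero_mem _

theorem ofTerm_eq_zero {r n : ℕ} (hr : 1 ≤ r) {x : P.Term n} (hx : x ∈ Term.fil P (r - 1) n) :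
    ofTerm P r n x = 0 :=
  Term.fil_le P (p := LinearMap.ker (ofTerm P r n))
    (fun m a b h => ofTerm_mon_of_ne hr (by omega) a b) hx

/-- The part of weight exactly `r` is recovered from its image in the exterior power; what remains
has smaller weight. Hence the kernel on `F_r` is `F_{r-1}`. -/
theorem sub_proj_mem_fil {r n : ℕ} (hr : 1 ≤ r) {x : P.Term n} (hx : x ∈ Term.fil P r n) :
    x - Term.proj P n (toChain P r (ofTerm P r n x)) ∈ Term.fil P (r - 1) n := by
  refine Term.fil_le P (p := (Term.fil P (r - 1) n).comap
    (LinearMap.id - Term.proj P n ∘ₗ toChain P r ∘ₗ ofTerm P r n)) (fun m a b h => ?_) hx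
  rw [Submodule.mem_comap, LinearMap.sub_apply, LinearMap.id_apply, LinearMap.comp_apply,
    LinearMap.comp_apply]
  by_cases hm : n + m = r
  · subst hm
    rw [ofTerm_mon hr, toChain_ofChainAt (Chain.wedges_divPow_mem_bidegree P a b),
      Term.proj_wedges_divPow, sub_self]
    exact Submodule.zero_mem _
  · rw [ofTerm_mon_of_ne hr hm, map_zero, map_zero, sub_zero]
    exact Term.mon_mem_fil P (by omega) a b

theorem mem_fil_of_ofTerm_eq_zero {r n : ℕ} (hr : 1 ≤ r) {x : P.Term n} (hx : x ∈ Term.fil P r n)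
    (h : ofTerm P r n x = 0) : x ∈ Term.fil P (r - 1) n := by
  simpa [h] using sub_proj_mem_fil hr hx

theorem piece_le_map {r : ℕ} (hr : 1 ≤ r) (n : ℕ) :
    piece P r n ≤ (Term.fil P r n).map (ofTerm P r n) := by
  rw [piece, Submodule.span_le]
  rintro _ ⟨x, rfl, rfl⟩
  obtain ⟨y, hy, h⟩ := exists_ofChainAt_eq x
  exact ⟨_, Term.proj_mem_fil P hy, (ofTerm_proj hr hy).trans h⟩

/-- The terms with `t ≥ 1` have total degree below `r`, and the remaining coefficient is `B_0 / 0! =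
1`. -/
theorem ofChainAt_wedges_symAct {r n m : ℕ} (h : n + m + 1 ≤ r) (a : Fin n → P.g) (x b : P.h) :
    ofChainAt P r (CEChain.wedges S _ a (symAct S x (SymmAlg.divPow S m b))) =
      ofChainAt P r (CEChain.wedges S _ a (SymmAlg.ι S _ x * SymmAlg.divPow S m b)) := by
  rw [symAct_divPow, map_sum, map_sum, Finset.sum_eq_single (0, m)]
  · simp [bernoulliCoeff]
  · rintro ⟨t, k⟩ hk ht
    have hk := mem_antidiagonal.1 hk
    have : t ≠ 0 := fun e => ht (by subst e; simpa using hk)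
    rw [map_smul, map_smul,
      ofChainAt_of_ne (by omega) (Chain.wedges_ι_mul_divPow_mem_bidegree P a _ b), smul_zero]
  · exact fun h => absurd (mem_antidiagonal.2 (zero_add m)) h

/-- Modulo `F_{r-1}` the differential is its symbol: brackets in `g` lower `n + m` by one, and
higher terms of the action lower it as well. -/
theorem ofTerm_d_mon {r n m : ℕ} (hr : 1 ≤ r) (h : n + 1 + m ≤ r) (a : Fin (n + 1) → P.g)
    (b : P.h) : ofTerm P r n (Term.d P n (Term.mon P m a b)) =
      totalD P r (ofTerm P r (n + 1) (Term.mon P m a b)) := by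
  rw [ofTerm_mon hr, ← ofChainAt_sgn_symbol, Chain.symbol_wedges, ← Term.proj_wedges_divPow,
    Term.d_proj, Term.bdry, CEChain.ce_wedges]
  have h1 : ∀ i j : Fin (n + 1), ofChainAt P r (CEChain.wedges S _ (j.removeNth
      (Function.update a i (lieRight S (a j) (a i)))) (SymmAlg.divPow S m b)) = 0 := fun i j =>
    ofChainAt_of_ne (by omega) (Chain.wedges_divPow_mem_bidegree P _ b)
  simp only [map_add, map_sum, map_smul, ofTerm_proj_wedges hr, h1, smul_zero,
    Finset.sum_const_zero, add_zero, CEChain.sgn_wedges, Finset.smul_sum, smul_smul, Term.rho_apply]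
  refine Finset.sum_congr rfl fun i _ => ?_
  rw [ofChainAt_wedges_symAct (by omega), mul_comm]

theorem ofTerm_d {r n : ℕ} (hr : 1 ≤ r) {x : P.Term (n + 1)} (hx : x ∈ Term.fil P r (n + 1)) :
    ofTerm P r n (Term.d P n x) = totalD P r (ofTerm P r (n + 1) x) :=
  Term.fil_le P (p := LinearMap.eqLocus (ofTerm P r n ∘ₗ Term.d P n)
    (totalD P r ∘ₗ ofTerm P r (n + 1))) (fun m a b h => ofTerm_d_mon hr (by omega) a b) hx

theorem ofTerm_map {Q : LiePair.{u, v, w} S} (f : P ⟶ Q) {r n : ℕ} (hr : 1 ≤ r) (x : P.Term n) :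
    ofTerm Q r n (Term.map f n x) = totalMap f r (ofTerm P r n x) := by
  refine LinearMap.congr_fun (f := ofTerm Q r n ∘ₗ Term.map f n)
    (g := totalMap f r ∘ₗ ofTerm P r n) (Term.linearMap_ext P fun m a b => ?_) x
  simp only [LinearMap.comp_apply]
  rw [ofTerm_mon hr, ← ofChainAt_chainMap, Term.map_mon, ofTerm_mon hr, Term.chainMap,
    CEChain.map_wedges, AlgHom.toLinearMap_apply, SymmAlg.map_divPow]
  rfl

variable (P)

/-- The map from the associated graded complex to the exterior powers. -/
def ofGrAux {r : ℕ} (hr : 1 ≤ r) (n : ℕ) : (Term.complex P).Gr (r : ℤ) n →ₗ[S] piece P r n :=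
  Submodule.liftQ _ ((ofTerm P r n).restrict fun _ hx => ofTerm_mem_piece hr hx) fun _ hx =>
    Subtype.ext (ofTerm_eq_zero hr hx)

theorem ofGrAux_mk {r : ℕ} (hr : 1 ≤ r) {n : ℕ} (x : Term.fil P r n) :
    (ofGrAux P hr n (Submodule.Quotient.mk x) : Total P r) = ofTerm P r n x := rfl

/-- The isomorphism from the associated graded complex to the exterior powers. -/
def ofGr {r : ℕ} (hr : 1 ≤ r) (n : ℕ) : (Term.complex P).Gr (r : ℤ) n ≃ₗ[S] piece P r n :=
  LinearEquiv.ofBijective (ofGrAux P hr n) (by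
    constructor
    · refine (injective_iff_map_eq_zero _).2 fun x hx => ?_
      obtain ⟨x, rfl⟩ := Submodule.Quotient.mk_surjective _ x
      have h : ofTerm P r n x.1 = 0 := (ofGrAux_mk P hr x).symm.trans (congrArg Subtype.val hx)
      exact (Submodule.Quotient.mk_eq_zero _).2 (mem_fil_of_ofTerm_eq_zero hr x.2 h)
    · rintro ⟨z, hz⟩
      obtain ⟨x, hx, rfl⟩ := piece_le_map hr n hz
      exact ⟨Submodule.Quotient.mk ⟨x, hx⟩, rfl⟩)

theorem ofGr_grD {r : ℕ} (hr : 1 ≤ r) (n : ℕ) (x : (Term.complex P).Gr (r : ℤ) (n + 1)) :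
    ofGr P hr n ((Term.complex P).grD r n x) = D P r n (ofGr P hr (n + 1) x) := by
  obtain ⟨x, rfl⟩ := Submodule.Quotient.mk_surjective _ x
  exact Subtype.ext (ofTerm_d hr x.2)

theorem ofGr_grMap {Q : LiePair.{u, v, w} S} (f : P ⟶ Q) {r : ℕ} (hr : 1 ≤ r) (n : ℕ)
    (x : (Term.complex P).Gr (r : ℤ) n) :
    ofGr Q hr n (CoFiltComplex.grMap (Term.complexMap f) r n x) =
      map r f n (ofGr P hr n x) := by
  obtain ⟨x, rfl⟩ := Submodule.Quotient.mk_surjective _ x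
  exact Subtype.ext (ofTerm_map f hr x.1)

end ExtPow

end LiePair

/-! ### Quasi-isomorphisms of differential modules -/

namespace LinearMap

variable {S : Type*} [CommRing S]
  {A A' A'' : Type*} [AddCommGroup A] [Module S A] [AddCommGroup A'] [Module S A']
  [AddCommGroup A''] [Module S A'']
  {B B' : Type*} [AddCommGroup B] [Module S B] [AddCommGroup B'] [Module S B']

/-- The mapping cone of `f` is exact. -/
def ConeExact (d : Module.End S A) (d' : Module.End S A') (f : A →ₗ[S] A') : Prop :=
  ∀ a b, d a = 0 → f a = d' b → ∃ a' b', d a' = a ∧ f a' + d' b' = b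

/-- The differential `(x, y) ↦ (d x, j x - d y)`. -/
def coneD (d : Module.End S A) (d' : Module.End S A') (j : A →ₗ[S] A') : Module.End S (A × A') :=
  (d ∘ₗ fst S A A').prod (j ∘ₗ fst S A A' - d' ∘ₗ snd S A A')

@[simp]
theorem coneD_apply (d : Module.End S A) (d' : Module.End S A') (j : A →ₗ[S] A') (x : A) (y : A') :
    coneD d d' j (x, y) = (d x, j x - d' y) := rfl

variable {d : Module.End S A} {d' : Module.End S A'} {d'' : Module.End S A''}
  {e : Module.End S B} {e' : Module.End S B'}

theorem ConeExact.comp {f : A →ₗ[S] A'} {g : A' →ₗ[S] A''} (hf : ConeExact d d' f)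
    (hg : ConeExact d' d'' g) (hfd : ∀ x, f (d x) = d' (f x)) (hgd : ∀ x, g (d' x) = d'' (g x)) :
    ConeExact d d'' (g ∘ₗ f) := by
  intro a c ha h
  obtain ⟨b', c', hb, hc⟩ := hg (f a) c (by rw [← hfd, ha, map_zero]) h
  obtain ⟨a', b'', ha', hb'⟩ := hf a b' ha hb.symm
  refine ⟨a', g b'' + c', ha', ?_⟩
  rw [comp_apply, map_add, ← hgd, ← add_assoc, ← map_add, hb', hc]

/-- A cycle of the cone of `f` is sent to the cone of `g`, bounded there, and the bounding element
is sent back. Instead of `p ∘ i = 1`, an invertible scalar is enough. -/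
theorem ConeExact.of_retract {f : A →ₗ[S] A'} {g : B →ₗ[S] B'} (hg : ConeExact e e' g)
    {i : A →ₗ[S] B} {p : B →ₗ[S] A} {i' : A' →ₗ[S] B'} {p' : B' →ₗ[S] A'}
    (hi : ∀ x, i (d x) = e (i x)) (hp : ∀ x, p (e x) = d (p x))
    (hi' : ∀ x, i' (d' x) = e' (i' x)) (hp' : ∀ x, p' (e' x) = d' (p' x))
    (hif : ∀ x, i' (f x) = g (i x)) (hpf : ∀ x, p' (g x) = f (p x))
    {c c' : S} (hc : c' * c = 1) (hpi : ∀ x, p (i x) = c • x) (hpi' : ∀ x, p' (i' x) = c • x) :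
    ConeExact d d' f := by
  intro a b ha h
  obtain ⟨x, y, hx, hy⟩ := hg (i a) (i' b) (by rw [← hi, ha, map_zero]) (by rw [← hif, h, hi'])
  refine ⟨c' • p x, c' • p' y, ?_, ?_⟩
  · rw [map_smul, ← hp, hx, hpi, smul_smul, hc, one_smul]
  · rw [map_smul, map_smul, ← smul_add, ← hpf, ← hp', ← map_add, hy, hpi', smul_smul, hc, one_smul]

theorem ConeExact.coneExact {f : A →ₗ[S] A'} (h : ConeExact d d' f) (hd : ∀ x, d (d x) = 0)
    (hd' : ∀ x, d' (d' x) = 0) (hf : ∀ x, f (d x) = d' (f x)) :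
    Function.Exact (coneD d d' f) (coneD d d' f) := by
  rintro ⟨a, b⟩
  constructor
  · intro hab
    rw [coneD_apply, Prod.mk_eq_zero, sub_eq_zero] at hab
    obtain ⟨a', b', rfl, rfl⟩ := h a b hab.1 hab.2
    -- `ConeExact` adds `d' b'`, whereas `coneD` subtracts it.
    exact ⟨(a', -b'), by simp⟩
  · rintro ⟨⟨a', b'⟩, h⟩
    rw [← h]
    simp [hd, hd', hf]

/-- Cone exactness is exactness of the single endomorphism `coneD` of `A × A'`, and this survives
tensoring with a flat module. -/
theorem ConeExact.lTensor (M : Type*) [AddCommGroup M] [Module S M] [Module.Flat S M]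
    {f : A →ₗ[S] A'} (h : ConeExact d d' f) (hd : ∀ x, d (d x) = 0)
    (hd' : ∀ x, d' (d' x) = 0) (hf : ∀ x, f (d x) = d' (f x)) :
    ConeExact (d.lTensor M) (d'.lTensor M) (f.lTensor M) := by
  have hex := Module.Flat.lTensor_exact M (h.coneExact hd hd' hf)
  have hcomm : ∀ w, TensorProduct.prodRight S S M A A' ((coneD d d' f).lTensor M w) =
      coneD (d.lTensor M) (d'.lTensor M) (f.lTensor M) (TensorProduct.prodRight S S M A A' w) := by
    intro w
    induction w using TensorProduct.induction_on with
    | zero => simp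
    | add x y hx hy => rw [map_add, map_add, hx, hy, map_add, map_add]
    | tmul m x =>
      obtain ⟨a, b⟩ := x
      simp [TensorProduct.tmul_sub]
  intro a b ha hab
  obtain ⟨w, hw⟩ := (TensorProduct.prodRight S S M A A').surjective (a, b)
  have h0 : (coneD d d' f).lTensor M w = 0 := by
    apply (TensorProduct.prodRight S S M A A').injective
    rw [hcomm, hw, map_zero, coneD_apply, ha, hab, sub_self]
    rfl
  obtain ⟨z, hz⟩ := (hex w).1 h0
  obtain ⟨⟨a', b'⟩, hz'⟩ := (TensorProduct.prodRight S S M A A').symm.surjective z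
  have h1 := hcomm z
  rw [hz, hw, ← hz', LinearEquiv.apply_symm_apply, coneD_apply, Prod.mk.injEq] at h1
  exact ⟨a', -b', h1.1.symm, by rw [map_neg, ← sub_eq_add_neg]; exact h1.2.symm⟩

/-- A morphism of mapping cones with exact components. -/
theorem ConeExact.prodMap {j : A →ₗ[S] A'} {k : B →ₗ[S] B'} {f : A →ₗ[S] B} {f' : A' →ₗ[S] B'}
    (hf : ConeExact d e f) (hf' : ConeExact d' e' f') (hj : ∀ x, j (d x) = d' (j x))
    (hk : ∀ x, k (e x) = e' (k x)) (hjk : ∀ x, f' (j x) = k (f x)) :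
    ConeExact (coneD d d' j) (coneD e e' k) (f.prodMap f') := by
  rintro ⟨x, y⟩ ⟨u, v⟩ h0 h1
  rw [coneD_apply, Prod.mk_eq_zero] at h0
  rw [coneD_apply, prodMap_apply, Prod.mk.injEq] at h1
  obtain ⟨x', u', rfl, rfl⟩ := hf x u h0.1 h1.1
  obtain ⟨y', v', hy, hv⟩ := hf' (j x' - y) (v - k u') (by rw [map_sub, ← hj, h0.2])
    (by rw [map_sub, map_sub, hjk, h1.2, map_add, ← hk]; abel)
  refine ⟨(x', y'), (u', -v'), ?_, ?_⟩
  · rw [coneD_apply, hy, sub_sub_cancel]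
  · rw [coneD_apply, prodMap_apply, Prod.mk_add_mk, map_neg, sub_neg_eq_add, add_left_comm, hv,
      add_sub_cancel]

/-- A morphism of mapping cones from a bicartesian square. -/
theorem coneExact_of_bicartesian {j : A →ₗ[S] A'} {k : B →ₗ[S] B'} {f : A →ₗ[S] B}
    {f' : A' →ₗ[S] B'} (he : ∀ x, e (e x) = 0) (hd' : ∀ x, d' (d' x) = 0)
    (hj : ∀ x, j (d x) = d' (j x)) (hk : ∀ x, k (e x) = e' (k x))
    (hf : ∀ x, f (d x) = e (f x)) (hf' : ∀ x, f' (d' x) = e' (f' x))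
    (inj : ∀ a, f a = 0 → j a = 0 → a = 0)
    (exact : ∀ c b, k c = f' b → ∃ a, f a = c ∧ j a = b)
    (surj : ∀ y, ∃ c b, k c - f' b = y) :
    ConeExact (coneD d d' j) (coneD e e' k) (f.prodMap f') := by
  rintro ⟨x, y⟩ ⟨u, v⟩ h0 h1
  rw [coneD_apply, Prod.mk_eq_zero, sub_eq_zero] at h0
  rw [coneD_apply, prodMap_apply, Prod.mk.injEq] at h1
  obtain ⟨p, q, rfl⟩ := surj v
  obtain ⟨s, hs, hs'⟩ := exact (u - e p) (y - d' q) (by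
    rw [map_sub, map_sub, h1.2, map_sub, hf', hk]; abel)
  have hx : x - d s = 0 := inj _ (by rw [map_sub, hf, hs, h1.1, map_sub, he, sub_zero, sub_self])
    (by rw [map_sub, hj, hs', h0.2, map_sub, hd', sub_zero, sub_self])
  refine ⟨(s, -q), (p, 0), ?_, ?_⟩
  · rw [coneD_apply, ← sub_eq_zero.1 hx, hs', map_neg, sub_neg_eq_add, sub_add_cancel]
  · rw [coneD_apply, prodMap_apply, Prod.mk_add_mk, hs, map_neg, map_zero, sub_zero,
      sub_add_cancel, neg_add_eq_sub]

end LinearMap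

namespace TensorProduct

/-- Tensoring a bicartesian square with flat target. -/
theorem bicartesian_rTensor {S : Type*} [CommRing S] {G G' H H' : Type*} [AddCommGroup G]
    [Module S G] [AddCommGroup G'] [Module S G'] [AddCommGroup H] [Module S H] [AddCommGroup H']
    [Module S H'] [Module.Flat S H'] {i : G →ₗ[S] H} {i' : G' →ₗ[S] H'} {f : G →ₗ[S] G'}
    {f' : H →ₗ[S] H'} (comm : ∀ a, f' (i a) = i' (f a)) (inj : ∀ a, f a = 0 → i a = 0 → a = 0)
    (exact : ∀ c b, i' c = f' b → ∃ a, f a = c ∧ i a = b)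
    (surj : ∀ y, ∃ c b, i' c - f' b = y) (M : Type*) [AddCommGroup M] [Module S M] :
    (∀ a, f.rTensor M a = 0 → i.rTensor M a = 0 → a = 0) ∧
    (∀ c b, i'.rTensor M c = f'.rTensor M b → ∃ a, f.rTensor M a = c ∧ i.rTensor M a = b) ∧
    (∀ y, ∃ c b, i'.rTensor M c - f'.rTensor M b = y) := by
  -- The square amounts to the short exact sequence `0 → G → G' × H → H' → 0`.
  let α : G →ₗ[S] G' × H := f.prod i
  let β : G' × H →ₗ[S] H' := i'.coprod (-f')
  have hα : Function.Injective α := (injective_iff_map_eq_zero α).2 fun a ha => by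
    have := Prod.mk_eq_zero.1 ha
    exact inj a this.1 this.2
  have hβ : Function.Surjective β := fun y => by
    obtain ⟨c, b, rfl⟩ := surj y
    exact ⟨(c, b), by simp [β, sub_eq_add_neg]⟩
  have hαβ : Function.Exact α β := by
    rintro ⟨c, b⟩
    constructor
    · intro h
      have h : i' c + -f' b = 0 := h
      rw [← sub_eq_add_neg, sub_eq_zero] at h
      obtain ⟨a, rfl, rfl⟩ := exact c b h
      exact ⟨a, rfl⟩
    · rintro ⟨a, h⟩
      rw [← h]
      change i' (f a) + -f' (i a) = 0
      rw [comm, add_neg_cancel]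
  have hα1 : ∀ w, prodLeft S S G' H M (α.rTensor M w) = (f.rTensor M w, i.rTensor M w) := by
    intro w
    induction w using TensorProduct.induction_on with
    | zero =>
      simp only [map_zero]
      rfl
    | add x y hx hy => rw [map_add, map_add, hx, hy]; simp
    | tmul m x => simp [α]
  have hβ1 : ∀ w, β.rTensor M w = i'.rTensor M (prodLeft S S G' H M w).1 -
      f'.rTensor M (prodLeft S S G' H M w).2 := by
    intro w
    induction w using TensorProduct.induction_on with
    | zero => simp
    | add x y hx hy => rw [map_add, hx, hy]; simp; abel
    | tmul m x =>
      obtain ⟨c, b⟩ := m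
      rw [prodLeft_tmul]
      simp [β, add_tmul, neg_tmul, sub_eq_add_neg]
  -- Flatness of the quotient `H'` keeps the sequence exact on the left after tensoring with any
  -- `M`.
  have hinj : Function.Injective (α.rTensor M) :=
    (LinearMap.lTensor_inj_iff_rTensor_inj M α).1
      (LinearMap.lTensor_injective_of_exact_of_flat β hβ α hα hαβ M)
  refine ⟨fun a h1 h2 => hinj ?_, fun c b h => ?_, fun y => ?_⟩
  · apply (prodLeft S S G' H M).injective
    rw [hα1, h1, h2, map_zero, map_zero]
    rfl
  · obtain ⟨w, hw⟩ := (prodLeft S S G' H M).surjective (c, b)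
    obtain ⟨a, rfl⟩ := ((rTensor_exact M hαβ hβ) w).1 (by rw [hβ1, hw, h, sub_self])
    rw [hα1, Prod.mk.injEq] at hw
    exact ⟨a, hw⟩
  · obtain ⟨w, rfl⟩ := LinearMap.rTensor_surjective M hβ y
    exact ⟨_, _, (hβ1 w).symm⟩

end TensorProduct

/-! ### Exterior powers of quasi-isomorphisms -/

namespace LiePair

namespace ExtPow

variable {S : Type u} [CommRing S] {P : LiePair.{u, v, w} S}

theorem koszul_comm (s t : P.g ⊕ P.h) : koszul (S := S) s t = koszul t s := by
  rcases s with a | a <;> rcases t with b | b <;> rfl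

theorem koszul_mul_self (s t : P.g ⊕ P.h) : koszul (S := S) s t * koszul s t = 1 := by
  rcases s with a | a <;> rcases t with b | b <;> simp [koszul]

/-! ### Contraction: splitting off one factor -/

section Contraction

variable {M : Type*} [AddCommGroup M] [Module S M]

/-- The hypotheses under which the factors mapped by `l` can be moved to the front; `σ` is the sign
of the exchange with such a factor. -/
structure IsContraction (l : (P.g × P.h) →ₗ[S] M) (σ : (P.g × P.h) →ₗ[S] P.g × P.h) : Prop where
  tmul : ∀ s t, l (tot t) ⊗ₜ[S] σ (tot s) = (koszul s t : S) • l (tot t) ⊗ₜ[S] tot s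
  consPi_comm : ∀ (s t) (z : Powers P), consPi P (σ (tot s)) (consPi P (σ (tot t)) z) =
      -((koszul s t : S) • consPi P (σ (tot t)) (consPi P (σ (tot s)) z))

variable (l : (P.g × P.h) →ₗ[S] M) (σ : (P.g × P.h) →ₗ[S] P.g × P.h)

/-- The operators defining the contraction. -/
def contrOp : (P.g × P.h) →ₗ[S] Module.End S (Powers P × (M ⊗[S] Powers P)) :=
  -- The first component keeps the element `z` itself, which the recursion `contr (v ∧ z) = l v ⊗ z
  -- - σ v ∧ contr z` needs along with `contr z`.
  LinearMap.mk₂ S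
    (fun v z => (consPi P v z.1, l v ⊗ₜ[S] z.1 - (consPi P (σ v)).lTensor M z.2))
    (fun v w z => Prod.ext (by simp) (by simp [add_tmul]; abel))
    (fun c v z => Prod.ext (by simp) (by simp [smul_sub, smul_tmul']))
    (fun v z z' => Prod.ext (by simp) (by simp [tmul_add]; abel))
    (fun c v z => Prod.ext (by simp) (by simp [smul_sub]))

theorem contrOp_apply (v : P.g × P.h) (x : Powers P) (y : M ⊗[S] Powers P) :
    contrOp l σ v (x, y) = (consPi P v x, l v ⊗ₜ[S] x - (consPi P (σ v)).lTensor M y) := rfl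

variable {l σ} (h : IsContraction l σ)
include h

theorem IsContraction.tmul_consPi (s t : P.g ⊕ P.h) (z : Powers P) :
    l (tot t) ⊗ₜ[S] consPi P (σ (tot s)) z =
      (koszul s t : S) • l (tot t) ⊗ₜ[S] consPi P (tot s) z := by
  have := congrArg (((consPi P).flip z).lTensor M) (h.tmul s t)
  simpa using this

theorem IsContraction.contrOp_contrOp (s t : P.g ⊕ P.h) (z : Powers P × (M ⊗[S] Powers P)) :
    contrOp l σ (tot s) (contrOp l σ (tot t) z) =
      -((koszul s t : S) • contrOp l σ (tot t) (contrOp l σ (tot s) z)) := by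
  obtain ⟨x, y⟩ := z
  have h1 : (consPi P (σ (tot s))).lTensor M ((consPi P (σ (tot t))).lTensor M y) =
      -((koszul s t : S) • (consPi P (σ (tot t))).lTensor M
        ((consPi P (σ (tot s))).lTensor M y)) := by
    rw [← LinearMap.lTensor_comp_apply, ← LinearMap.lTensor_comp_apply, ← LinearMap.smul_apply,
      ← LinearMap.lTensor_smul, ← LinearMap.neg_apply, ← LinearMap.lTensor_neg]
    congr 2
    exact LinearMap.ext (h.consPi_comm s t)
  simp only [contrOp_apply]
  refine Prod.ext (consPi_consPi P s t x) ?_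
  simp only [map_sub, LinearMap.lTensor_tmul, h1, Prod.snd_neg, Prod.smul_snd]
  rw [h.tmul_consPi s t, h.tmul_consPi t s, koszul_comm t s, smul_sub, smul_sub,
    smul_smul, koszul_mul_self, one_smul]
  abel

/-- The sum over all ways to move a factor to the front, followed by the application of `l` to this
factor. -/
def IsContraction.contr (r : ℕ) : Total P (r + 1) →ₗ[S] M ⊗[S] Total P r :=
  (Powers.proj P r).lTensor M ∘ₗ LinearMap.snd S _ _ ∘ₗ
    fold (contrOp l σ) h.contrOp_contrOp (Powers.one P, 0) (r + 1)

theorem IsContraction.fold_fst (r : ℕ) (z : Total P r) :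
    Powers.proj P r (fold (contrOp l σ) h.contrOp_contrOp (Powers.one P, 0) r z).1 = z := by
  suffices H : Powers.proj P r ∘ₗ LinearMap.fst S _ _ ∘ₗ
      fold (contrOp l σ) h.contrOp_contrOp (Powers.one P, 0) r = LinearMap.id from
    LinearMap.congr_fun H z
  clear z
  induction r with
  | zero =>
    refine total_zero_ext ?_
    simp only [LinearMap.comp_apply, fold_one]
    rfl
  | succ r ih =>
    refine total_succ_ext fun s z => ?_
    simp only [LinearMap.comp_apply, fold_cons]
    exact (consPi_succ _ _ _ _).trans (congrArg _ (LinearMap.congr_fun ih z))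

theorem IsContraction.contr_cons_zero (v : P.g × P.h) (z : Total P 0) :
    h.contr 0 (cons P 0 v z) = l v ⊗ₜ[S] z := by
  have h1 : (Powers.proj P 0).lTensor M ∘ₗ (consPi P (σ v)).lTensor M = 0 := by
    rw [← LinearMap.lTensor_comp, show Powers.proj P 0 ∘ₗ consPi P (σ v) = 0 from rfl,
      LinearMap.lTensor_zero]
  rw [contr, LinearMap.comp_apply, LinearMap.comp_apply, fold_cons]
  change (Powers.proj P 0).lTensor M (_ - _) = _
  rw [map_sub, LinearMap.lTensor_tmul, h.fold_fst, ← LinearMap.comp_apply, h1,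
    LinearMap.zero_apply, sub_zero]

theorem IsContraction.contr_cons_succ {r : ℕ} (v : P.g × P.h) (z : Total P (r + 1)) :
    h.contr (r + 1) (cons P (r + 1) v z) =
      l v ⊗ₜ[S] z - (cons P r (σ v)).lTensor M (h.contr r z) := by
  have h1 : (Powers.proj P (r + 1)).lTensor M ∘ₗ (consPi P (σ v)).lTensor M =
      (cons P r (σ v)).lTensor M ∘ₗ (Powers.proj P r).lTensor M := by
    rw [← LinearMap.lTensor_comp, ← LinearMap.lTensor_comp]
    rfl
  rw [contr, LinearMap.comp_apply, LinearMap.comp_apply, fold_cons]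
  change (Powers.proj P (r + 1)).lTensor M (_ - _) = _
  rw [map_sub, LinearMap.lTensor_tmul, h.fold_fst, ← LinearMap.comp_apply, h1]
  rfl

end Contraction

variable (P) in
theorem isContraction_fst : IsContraction (LinearMap.fst S P.g P.h) LinearMap.id where
  tmul s t := by rcases t with a | b <;> rcases s with a' | b' <;> simp [tot, koszul]
  consPi_comm := consPi_consPi P

@[simp]
theorem sg_inl (a : P.g) : sg P (tot (.inl a)) = tot (.inl a) := by simp [sg, tot]

@[simp]
theorem sg_inr (b : P.h) : sg P (tot (.inr b)) = -tot (.inr b) := by simp [sg, tot]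

theorem sg_sg (v : P.g × P.h) : sg P (sg P v) = v := by simp [sg]

theorem bd_sg (v : P.g × P.h) : bd P (sg P v) = bd P v := by simp [sg, bd]

theorem sg_bd (v : P.g × P.h) : sg P (bd P v) = -bd P v := by simp [sg, bd]

-- A factor from `h` anticommutes with `g` but commutes with `h`, hence the twist `sg`; a factor
-- from `g` anticommutes with everything and needs none.
variable (P) in
theorem isContraction_snd : IsContraction (LinearMap.snd S P.g P.h) (sg P) where
  tmul s t := by
    rcases t with a | b <;> rcases s with a' | b'
    · simp [tot]
    · simp [tot]
    · simp [koszul]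
    · simp [koszul, tmul_neg]
  consPi_comm s t z := by
    have h := consPi_consPi P s t z
    rcases s with a | b <;> rcases t with a' | b' <;> simpa [koszul, neg_eq_iff_eq_neg] using h

variable (P) in
/-- The contraction with values in `g`. -/
def contrL (r : ℕ) : Total P (r + 1) →ₗ[S] P.g ⊗[S] Total P r := (isContraction_fst P).contr r

variable (P) in
/-- The contraction with values in `h`. -/
def contrR (r : ℕ) : Total P (r + 1) →ₗ[S] P.h ⊗[S] Total P r := (isContraction_snd P).contr r

theorem contrL_cons_zero (v : P.g × P.h) (z : Total P 0) :
    contrL P 0 (cons P 0 v z) = v.1 ⊗ₜ[S] z := (isContraction_fst P).contr_cons_zero v z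

theorem contrR_cons_zero (v : P.g × P.h) (z : Total P 0) :
    contrR P 0 (cons P 0 v z) = v.2 ⊗ₜ[S] z := (isContraction_snd P).contr_cons_zero v z

theorem contrL_cons_succ {r : ℕ} (v : P.g × P.h) (z : Total P (r + 1)) :
    contrL P (r + 1) (cons P (r + 1) v z) =
      v.1 ⊗ₜ[S] z - (cons P r v).lTensor _ (contrL P r z) :=
  (isContraction_fst P).contr_cons_succ v z

theorem contrR_cons_succ {r : ℕ} (v : P.g × P.h) (z : Total P (r + 1)) :
    contrR P (r + 1) (cons P (r + 1) v z) =
      v.2 ⊗ₜ[S] z - (cons P r (sg P v)).lTensor _ (contrR P r z) :=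
  (isContraction_snd P).contr_cons_succ v z

theorem lTensor_totalD_cons (M : Type*) [AddCommGroup M] [Module S M] {r : ℕ} (v : P.g × P.h)
    (x : M ⊗[S] Total P r) :
    (totalD P (r + 1)).lTensor M ((cons P r v).lTensor M x) =
      (cons P r (bd P v)).lTensor M x +
        (cons P r (sg P v)).lTensor M ((totalD P r).lTensor M x) := by
  rw [← LinearMap.lTensor_comp_apply, ← LinearMap.lTensor_comp_apply, ← LinearMap.add_apply,
    ← LinearMap.lTensor_add]
  congr 2
  exact LinearMap.ext fun z => totalD_cons P v z

@[simp] theorem bd_fst (v : P.g × P.h) : (bd P v).1 = 0 := rfl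
@[simp] theorem bd_snd (v : P.g × P.h) : (bd P v).2 = P.i v.1 := rfl
@[simp] theorem sg_fst (v : P.g × P.h) : (sg P v).1 = v.1 := rfl
@[simp] theorem sg_snd (v : P.g × P.h) : (sg P v).2 = -v.2 := rfl

theorem contrL_totalD (r : ℕ) (z : Total P (r + 1)) :
    contrL P r (totalD P (r + 1) z) = (totalD P r).lTensor _ (contrL P r z) := by
  suffices H : contrL P r ∘ₗ totalD P (r + 1) = (totalD P r).lTensor _ ∘ₗ contrL P r from
    LinearMap.congr_fun H z
  clear z
  induction r with
  | zero =>
    refine total_succ_ext fun s z => ?_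
    simp only [LinearMap.comp_apply, totalD_cons, map_add, contrL_cons_zero,
      LinearMap.lTensor_tmul, bd_fst, sg_fst, zero_tmul, zero_add]
  | succ r ih =>
    refine total_succ_ext fun s z => ?_
    have ih := LinearMap.congr_fun ih z
    simp only [LinearMap.comp_apply] at ih
    simp only [LinearMap.comp_apply, totalD_cons, map_add, map_sub, contrL_cons_succ,
      LinearMap.lTensor_tmul, bd_fst, sg_fst, zero_tmul, lTensor_totalD_cons, ih]
    abel

variable (P) in
/-- The map `i`, as a linear map. -/
abbrev iLin : P.g →ₗ[S] P.h := (P.i : P.g →ₗ[S] P.h)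

/-- With `contrL_totalD` this says that the pair of contractions intertwines `totalD` with `coneD`,
the differential of `(g → h) ⊗ ⋀^r`. -/
theorem contrR_totalD (r : ℕ) (z : Total P (r + 1)) :
    contrR P r (totalD P (r + 1) z) =
      (iLin P).rTensor _ (contrL P r z) - (totalD P r).lTensor _ (contrR P r z) := by
  suffices H : contrR P r ∘ₗ totalD P (r + 1) =
      (iLin P).rTensor _ ∘ₗ contrL P r - (totalD P r).lTensor _ ∘ₗ contrR P r from
    LinearMap.congr_fun H z
  clear z
  induction r with
  | zero =>
    refine total_succ_ext fun s z => ?_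
    simp only [LinearMap.comp_apply, LinearMap.sub_apply, totalD_cons, map_add, contrL_cons_zero,
      contrR_cons_zero, LinearMap.lTensor_tmul, LinearMap.rTensor_tmul, bd_snd, sg_snd, neg_tmul]
    rw [← sub_eq_add_neg]
    rfl
  | succ r ih =>
    refine total_succ_ext fun s z => ?_
    have ih := LinearMap.congr_fun ih z
    simp only [LinearMap.comp_apply, LinearMap.sub_apply] at ih
    have hc : (iLin P).rTensor _ ((cons P r (tot s)).lTensor _ (contrL P r z)) =
        (cons P r (tot s)).lTensor _ ((iLin P).rTensor _ (contrL P r z)) := by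
      rw [← LinearMap.comp_apply (_ : _ →ₗ[S] _), LinearMap.rTensor_comp_lTensor,
        ← LinearMap.lTensor_comp_rTensor, LinearMap.comp_apply]
    simp only [LinearMap.comp_apply, LinearMap.sub_apply, totalD_cons, map_add, map_sub,
      contrR_cons_succ, contrL_cons_succ, LinearMap.lTensor_tmul, LinearMap.rTensor_tmul, bd_snd,
      sg_snd, neg_tmul, lTensor_totalD_cons, ih, sg_sg, bd_sg, sg_bd, map_neg, LinearMap.lTensor_neg,
      LinearMap.neg_apply, hc]
    simp only [LieHom.coe_toLinearMap]
    abel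

variable (P) in
/-- The exterior product with an element of `g`. -/
def consL (r : ℕ) : P.g ⊗[S] Total P r →ₗ[S] Total P (r + 1) :=
  TensorProduct.lift (cons P r ∘ₗ LinearMap.inl S P.g P.h)

variable (P) in
/-- The exterior product with an element of `h`. -/
def consR (r : ℕ) : P.h ⊗[S] Total P r →ₗ[S] Total P (r + 1) :=
  TensorProduct.lift (cons P r ∘ₗ LinearMap.inr S P.g P.h)

theorem consL_tmul {r : ℕ} (a : P.g) (z : Total P r) :
    consL P r (a ⊗ₜ z) = cons P r (tot (.inl a)) z := rfl

theorem consR_tmul {r : ℕ} (b : P.h) (z : Total P r) :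
    consR P r (b ⊗ₜ z) = cons P r (tot (.inr b)) z := rfl

theorem consL_lTensor_cons {r : ℕ} (s : P.g ⊕ P.h) (x : P.g ⊗[S] Total P r) :
    consL P (r + 1) ((cons P r (tot s)).lTensor _ x) = -cons P (r + 1) (tot s) (consL P r x) := by
  induction x using TensorProduct.induction_on with
  | zero => simp
  | add x y hx hy => simp only [map_add, hx, hy, neg_add]
  | tmul a z =>
    rw [LinearMap.lTensor_tmul, consL_tmul, consL_tmul, cons_cons P (.inl a) s]
    rcases s with b | b <;> simp [koszul]

theorem consR_lTensor_cons {r : ℕ} (s : P.g ⊕ P.h) (x : P.h ⊗[S] Total P r) :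
    consR P (r + 1) ((cons P r (sg P (tot s))).lTensor _ x) =
      -cons P (r + 1) (tot s) (consR P r x) := by
  induction x using TensorProduct.induction_on with
  | zero => simp
  | add x y hx hy => simp only [map_add, hx, hy, neg_add]
  | tmul a z =>
    rw [LinearMap.lTensor_tmul, consR_tmul, consR_tmul]
    have := cons_cons P (.inr a) s z
    rcases s with b | b <;> simpa [koszul] using this

/-- Euler's identity: each of the `r + 1` factors is moved to the front once and multiplied back. -/
theorem consL_contrL_add (r : ℕ) (z : Total P (r + 1)) :
    consL P r (contrL P r z) + consR P r (contrR P r z) = ((r + 1 : ℕ) : S) • z := by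
  suffices H : consL P r ∘ₗ contrL P r + consR P r ∘ₗ contrR P r =
      ((r + 1 : ℕ) : S) • LinearMap.id from LinearMap.congr_fun H z
  clear z
  have h0 : ∀ {r} (v : P.g × P.h) (z : Total P r),
      cons P r (tot (.inl v.1)) z + cons P r (tot (.inr v.2)) z = cons P r v z := fun v z => by
    rw [← LinearMap.add_apply, ← map_add, tot_inl_add_tot_inr]
  induction r with
  | zero =>
    refine total_succ_ext fun s z => ?_
    simp only [LinearMap.comp_apply, LinearMap.add_apply, contrL_cons_zero, contrR_cons_zero,
      consL_tmul, consR_tmul, h0]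
    simp
  | succ r ih =>
    refine total_succ_ext fun s z => ?_
    have ih := LinearMap.congr_fun ih z
    simp only [LinearMap.comp_apply, LinearMap.add_apply] at ih
    simp only [LinearMap.comp_apply, LinearMap.add_apply, contrL_cons_succ, contrR_cons_succ,
      map_sub, consL_tmul, consR_tmul, consL_lTensor_cons, consR_lTensor_cons]
    have := congrArg (cons P (r + 1) (tot s)) ih
    rw [map_add] at this
    rw [sub_neg_eq_add, sub_neg_eq_add, add_add_add_comm, h0, this]
    simp only [LinearMap.smul_apply, LinearMap.id_apply, map_smul]
    push_cast
    module

theorem totalD_consL {r : ℕ} (x : P.g ⊗[S] Total P r) :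
    totalD P (r + 1) (consL P r x) =
      consR P r ((iLin P).rTensor _ x) + consL P r ((totalD P r).lTensor _ x) := by
  induction x using TensorProduct.induction_on with
  | zero => simp
  | add x y hx hy =>
    simp only [map_add, hx, hy]
    abel
  | tmul a z =>
    rw [LinearMap.lTensor_tmul, LinearMap.rTensor_tmul, consL_tmul, consL_tmul, consR_tmul,
      totalD_cons, sg_inl]
    congr 3

theorem totalD_consR {r : ℕ} (x : P.h ⊗[S] Total P r) :
    totalD P (r + 1) (consR P r x) = -consR P r ((totalD P r).lTensor _ x) := by
  induction x using TensorProduct.induction_on with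
  | zero => simp
  | add x y hx hy => simp only [map_add, hx, hy, neg_add]
  | tmul a z =>
    rw [LinearMap.lTensor_tmul, consR_tmul, consR_tmul, totalD_cons, sg_inr,
      show bd P (tot (.inr a)) = 0 by simp [bd, tot]]
    simp

variable {Q : LiePair.{u, v, w} S} (f : P ⟶ Q)

theorem totalMap_cons' {r : ℕ} (v : P.g × P.h) (z : Total P r) :
    totalMap f (r + 1) (cons P r v z) = cons Q r (f.φ v.1, f.ψ v.2) (totalMap f r z) := by
  rw [← tot_inl_add_tot_inr P v, map_add, LinearMap.add_apply, map_add, totalMap_cons,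
    totalMap_cons, ← LinearMap.add_apply, ← map_add]
  simp [tot]

/-- The linear map `φ`. -/
abbrev φLin : P.g →ₗ[S] Q.g := (f.φ : P.g →ₗ[S] Q.g)

/-- The linear map `ψ`. -/
abbrev ψLin : P.h →ₗ[S] Q.h := (f.ψ : P.h →ₗ[S] Q.h)

theorem lTensor_cons_map {M N : Type*} [AddCommGroup M] [Module S M] [AddCommGroup N] [Module S N]
    (χ : M →ₗ[S] N) {r : ℕ} (v : P.g × P.h) (x : M ⊗[S] Total P r) :
    TensorProduct.map χ (totalMap f (r + 1)) ((cons P r v).lTensor M x) =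
      (cons Q r (f.φ v.1, f.ψ v.2)).lTensor N (TensorProduct.map χ (totalMap f r) x) := by
  rw [← LinearMap.comp_apply, ← LinearMap.comp_apply, LinearMap.map_comp_lTensor,
    LinearMap.lTensor_comp_map]
  congr 2
  exact LinearMap.ext fun z => totalMap_cons' f v z

theorem contrL_totalMap (r : ℕ) (z : Total P (r + 1)) :
    contrL Q r (totalMap f (r + 1) z) =
      TensorProduct.map (φLin f) (totalMap f r) (contrL P r z) := by
  suffices H : contrL Q r ∘ₗ totalMap f (r + 1) =
      TensorProduct.map (φLin f) (totalMap f r) ∘ₗ contrL P r from LinearMap.congr_fun H z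
  clear z
  induction r with
  | zero =>
    refine total_succ_ext fun s z => ?_
    simp only [LinearMap.comp_apply, totalMap_cons', contrL_cons_zero, TensorProduct.map_tmul]
    rfl
  | succ r ih =>
    refine total_succ_ext fun s z => ?_
    have ih := LinearMap.congr_fun ih z
    simp only [LinearMap.comp_apply] at ih
    simp only [LinearMap.comp_apply, totalMap_cons', contrL_cons_succ, TensorProduct.map_tmul,
      map_sub, lTensor_cons_map, ih]
    rfl

theorem contrR_totalMap (r : ℕ) (z : Total P (r + 1)) :
    contrR Q r (totalMap f (r + 1) z) =
      TensorProduct.map (ψLin f) (totalMap f r) (contrR P r z) := by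
  suffices H : contrR Q r ∘ₗ totalMap f (r + 1) =
      TensorProduct.map (ψLin f) (totalMap f r) ∘ₗ contrR P r from LinearMap.congr_fun H z
  clear z
  induction r with
  | zero =>
    refine total_succ_ext fun s z => ?_
    simp only [LinearMap.comp_apply, totalMap_cons', contrR_cons_zero, TensorProduct.map_tmul]
    rfl
  | succ r ih =>
    refine total_succ_ext fun s z => ?_
    have ih := LinearMap.congr_fun ih z
    simp only [LinearMap.comp_apply] at ih
    have hs : sg Q (f.φ (tot s).1, f.ψ (tot s).2) =
        (f.φ (sg P (tot s)).1, f.ψ (sg P (tot s)).2) := by simp [sg]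
    simp only [LinearMap.comp_apply, totalMap_cons', contrR_cons_succ, TensorProduct.map_tmul,
      map_sub, lTensor_cons_map, ih, hs]
    rfl

theorem consL_map {r : ℕ} (x : P.g ⊗[S] Total P r) :
    consL Q r (TensorProduct.map (φLin f) (totalMap f r) x) = totalMap f (r + 1) (consL P r x) := by
  induction x using TensorProduct.induction_on with
  | zero => simp
  | add x y hx hy => simp only [map_add, hx, hy]
  | tmul a z =>
    rw [TensorProduct.map_tmul, consL_tmul, consL_tmul, totalMap_cons]
    rfl

theorem consR_map {r : ℕ} (x : P.h ⊗[S] Total P r) :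
    consR Q r (TensorProduct.map (ψLin f) (totalMap f r) x) = totalMap f (r + 1) (consR P r x) := by
  induction x using TensorProduct.induction_on with
  | zero => simp
  | add x y hx hy => simp only [map_add, hx, hy]
  | tmul a z =>
    rw [TensorProduct.map_tmul, consR_tmul, consR_tmul, totalMap_cons]
    rfl

theorem totalD_totalD (r : ℕ) (z : Total P r) : totalD P r (totalD P r z) = 0 := by
  suffices H : totalD P r ∘ₗ totalD P r = 0 from LinearMap.congr_fun H z
  clear z
  induction r with
  | zero => rw [totalD_zero, LinearMap.comp_zero]
  | succ r ih =>
    refine total_succ_ext fun s z => ?_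
    have ih := LinearMap.congr_fun ih z
    simp only [LinearMap.comp_apply, LinearMap.zero_apply] at ih
    have h0 : bd P (bd P (tot s)) = 0 := by simp [bd]
    simp only [LinearMap.comp_apply, totalD_cons, map_add, ih, sg_bd, bd_sg, h0, map_zero, map_neg,
      LinearMap.zero_apply, LinearMap.neg_apply]
    abel

theorem totalMap_totalD (r : ℕ) (z : Total P r) :
    totalMap f r (totalD P r z) = totalD Q r (totalMap f r z) := by
  suffices H : totalMap f r ∘ₗ totalD P r = totalD Q r ∘ₗ totalMap f r from
    LinearMap.congr_fun H z
  clear z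
  induction r with
  | zero => rw [totalD_zero, totalD_zero, LinearMap.comp_zero, LinearMap.zero_comp]
  | succ r ih =>
    refine total_succ_ext fun s z => ?_
    have ih := LinearMap.congr_fun ih z
    simp only [LinearMap.comp_apply] at ih
    simp only [LinearMap.comp_apply, totalD_cons, map_add, totalMap_cons', ih]
    congr 3
    · simp [bd, f.comm]
    · simp [sg]

theorem totalMap_one : totalMap f 0 (one P) = one Q :=
  congrArg (rel Q 0).mkQ <| (tMap_mono 0 f _).trans (congrArg _ (Subsingleton.elim _ _))

theorem totalMap_zero_bijective : Function.Bijective (totalMap f 0) := by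
  let g : Total Q 0 →ₗ[S] Total P 0 := fold 0 (by simp) (one P) 0
  have hg : g (one Q) = one P := fold_one _ _ _
  refine Function.bijective_iff_has_inverse.2 ⟨g, LinearMap.congr_fun (f := g ∘ₗ totalMap f 0)
    (g := LinearMap.id) (total_zero_ext ?_), LinearMap.congr_fun (f := totalMap f 0 ∘ₗ g)
    (g := LinearMap.id) (total_zero_ext ?_)⟩
  · rw [LinearMap.comp_apply, totalMap_one, hg, LinearMap.id_apply]
  · rw [LinearMap.comp_apply, hg, totalMap_one, LinearMap.id_apply]

end ExtPow

end LiePair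

/-! ### Tensor products of quasi-isomorphisms -/

namespace TensorProduct

open LinearMap (ConeExact coneD lTensor rTensor)

section

variable {S : Type*} [CommRing S] {A A' B B' : Type*} [AddCommGroup A] [Module S A]
  [AddCommGroup A'] [Module S A'] [AddCommGroup B] [Module S B] [AddCommGroup B'] [Module S B']

theorem rTensor_lTensor_comm (p : A →ₗ[S] A') (q : B →ₗ[S] B') (z : A ⊗[S] B) :
    p.rTensor B' (q.lTensor A z) = q.lTensor A' (p.rTensor B z) :=
  LinearMap.congr_fun ((LinearMap.rTensor_comp_lTensor _ _ _).trans
    (LinearMap.lTensor_comp_rTensor _ _ _).symm) z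

theorem lTensor_comp_eq_zero {d : Module.End S A} (hd : ∀ x, d (d x) = 0) (M : Type*)
    [AddCommGroup M] [Module S M] (x : M ⊗[S] A) : d.lTensor M (d.lTensor M x) = 0 := by
  rw [← LinearMap.lTensor_comp_apply, show d ∘ₗ d = 0 from LinearMap.ext hd,
    LinearMap.lTensor_zero, LinearMap.zero_apply]

theorem lTensor_comm {d : Module.End S A} {e : Module.End S B} {g : A →ₗ[S] B}
    (h : ∀ x, g (d x) = e (g x)) (M : Type*) [AddCommGroup M] [Module S M] (x : M ⊗[S] A) :
    g.lTensor M (d.lTensor M x) = e.lTensor M (g.lTensor M x) := by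
  rw [← LinearMap.lTensor_comp_apply, ← LinearMap.lTensor_comp_apply,
    show g ∘ₗ d = e ∘ₗ g from LinearMap.ext h]

end

/-- Write `f ⊗ g` as `1 ⊗ g` followed by `f ⊗ 1`. The first has an exact cone since `G` and `H` are
flat, the second since the square tensored with `B` stays bicartesian. -/
theorem coneExact_map {S : Type*} [CommRing S] {G G' H H' : Type*} [AddCommGroup G]
    [Module S G] [AddCommGroup G'] [Module S G'] [AddCommGroup H] [Module S H] [AddCommGroup H']
    [Module S H'] [Module.Flat S G] [Module.Flat S H] [Module.Flat S H'] {i : G →ₗ[S] H}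
    {i' : G' →ₗ[S] H'} {f : G →ₗ[S] G'} {f' : H →ₗ[S] H'} (comm : ∀ a, f' (i a) = i' (f a))
    (inj : ∀ a, f a = 0 → i a = 0 → a = 0) (exact : ∀ c b, i' c = f' b → ∃ a, f a = c ∧ i a = b)
    (surj : ∀ y, ∃ c b, i' c - f' b = y)
    {A B : Type*} [AddCommGroup A] [Module S A] [AddCommGroup B] [Module S B]
    {d : Module.End S A} {e : Module.End S B} {g : A →ₗ[S] B} (hg : ConeExact d e g)
    (hd : ∀ x, d (d x) = 0) (he : ∀ x, e (e x) = 0) (hgd : ∀ x, g (d x) = e (g x)) :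
    ConeExact (coneD (d.lTensor G) (d.lTensor H) (i.rTensor A))
      (coneD (e.lTensor G') (e.lTensor H') (i'.rTensor B))
      ((TensorProduct.map f g).prodMap (TensorProduct.map f' g)) := by
  obtain ⟨h1, h2, h3⟩ := bicartesian_rTensor comm inj exact surj B
  have c1 := (hg.lTensor G hd he hgd).prodMap (hg.lTensor H hd he hgd)
    (j := i.rTensor A) (k := i.rTensor B) (rTensor_lTensor_comm i d) (rTensor_lTensor_comm i e) fun x => (rTensor_lTensor_comm i g x).symm
  have c2 := LinearMap.coneExact_of_bicartesian (j := i.rTensor B) (k := i'.rTensor B)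
    (f := f.rTensor B) (f' := f'.rTensor B) (lTensor_comp_eq_zero he G') (lTensor_comp_eq_zero he H) (rTensor_lTensor_comm i e) (rTensor_lTensor_comm i' e) (rTensor_lTensor_comm f e)
    (rTensor_lTensor_comm f' e) h1 h2 h3
  have := c1.comp c2 ?_ ?_
  · have e1 : (f.rTensor B).prodMap (f'.rTensor B) ∘ₗ (g.lTensor G).prodMap (g.lTensor H) =
        (TensorProduct.map f g).prodMap (TensorProduct.map f' g) := by
      rw [← LinearMap.rTensor_comp_lTensor, ← LinearMap.rTensor_comp_lTensor]
      rfl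
    rwa [e1] at this
  · rintro ⟨x, y⟩
    simp only [LinearMap.coneD_apply, LinearMap.prodMap_apply, map_sub, lTensor_comm hgd, rTensor_lTensor_comm]
  · rintro ⟨x, y⟩
    have : f'.rTensor B (i.rTensor B x) = i'.rTensor B (f.rTensor B x) := by
      rw [← LinearMap.rTensor_comp_apply, ← LinearMap.rTensor_comp_apply,
        show f' ∘ₗ i = i' ∘ₗ f from LinearMap.ext comm]
    simp only [LinearMap.coneD_apply, LinearMap.prodMap_apply, map_sub, rTensor_lTensor_comm, this]

end TensorProduct

namespace LiePair

namespace ExtPow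

open LinearMap (ConeExact coneD)

variable {S : Type u} [CommRing S] [Algebra ℚ S] {P Q : LiePair.{u, v, w} S} {f : P ⟶ Q}

/-- Induction on `r`: contraction and multiplication exhibit `⋀^(r+1)` as a retract of `(g → h) ⊗
⋀^r`, up to the invertible factor `r + 1`, compatibly with differentials and induced maps. -/
theorem totalMap_coneExact (hP : P.IsFlat) (hQ : Q.IsFlat) (hf : IsQuasiIso f) (r : ℕ) :
    ConeExact (totalD P r) (totalD Q r) (totalMap f r) := by
  obtain ⟨hPg, hPh⟩ := hP
  obtain ⟨-, hQh⟩ := hQ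
  obtain ⟨inj, hker, hcoker, surj⟩ := hf
  induction r with
  | zero =>
    intro a b _ h
    rw [totalD_zero, LinearMap.zero_apply] at h
    obtain ⟨a', rfl⟩ := (totalMap_zero_bijective f).2 b
    refine ⟨a', 0, ?_, by simp⟩
    rw [totalD_zero, LinearMap.zero_apply]
    exact ((totalMap_zero_bijective f).1 (h.trans (map_zero _).symm)).symm
  | succ r ih =>
    -- A morphism of two-term complexes is a quasi-isomorphism exactly when its square is
    -- bicartesian; the hypotheses on `ker i` and `coker i` are rewritten in this form.
    have h := TensorProduct.coneExact_map (i := iLin P) (i' := iLin Q) (f := φLin f)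
      (f' := ψLin f) f.comm (fun a h1 h2 => inj a h2 h1) (fun c b h => by
        obtain ⟨a, rfl⟩ := hcoker b ⟨c, h.symm⟩
        obtain ⟨a', h1, h2⟩ := hker (c - f.φ a) (by
          rw [map_sub, ← f.comm, sub_eq_zero]
          exact h)
        refine ⟨a + a', ?_, ?_⟩
        · rw [map_add]
          exact (congrArg _ h2).trans (add_sub_cancel _ _)
        · rw [map_add]
          exact (congrArg _ h1).trans (add_zero _))
      (fun y => by
        obtain ⟨b, c, rfl⟩ := surj y
        refine ⟨c, -b, ?_⟩
        rw [map_neg, sub_neg_eq_add, add_comm]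
        rfl)
      ih (totalD_totalD r) (totalD_totalD r) (totalMap_totalD f r)
    have hc : algebraMap ℚ S (r + 1 : ℚ)⁻¹ * ((r + 1 : ℕ) : S) = 1 := by
      rw [← map_natCast (algebraMap ℚ S), ← map_mul, Nat.cast_succ,
        inv_mul_cancel₀ (Nat.cast_add_one_ne_zero r), map_one]
    refine h.of_retract (i := (contrL P r).prod (contrR P r))
      (p := (consL P r).coprod (consR P r)) (i' := (contrL Q r).prod (contrR Q r))
      (p' := (consL Q r).coprod (consR Q r)) ?_ ?_ ?_ ?_ ?_ ?_ hc (consL_contrL_add r)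
      (consL_contrL_add r)
    · exact fun z => Prod.ext (contrL_totalD r z) (contrR_totalD r z)
    · rintro ⟨x, y⟩
      rw [LinearMap.coneD_apply, LinearMap.coprod_apply, LinearMap.coprod_apply, map_add,
        totalD_consL, totalD_consR, map_sub]
      abel
    · exact fun z => Prod.ext (contrL_totalD r z) (contrR_totalD r z)
    · rintro ⟨x, y⟩
      rw [LinearMap.coneD_apply, LinearMap.coprod_apply, LinearMap.coprod_apply, map_add,
        totalD_consL, totalD_consR, map_sub]
      abel
    · exact fun z => Prod.ext (contrL_totalMap f r z) (contrR_totalMap f r z)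
    · rintro ⟨x, y⟩
      rw [LinearMap.prodMap_apply, LinearMap.coprod_apply, LinearMap.coprod_apply, map_add,
        consL_map, consR_map]

end ExtPow

end LiePair

/-! ### Quasi-isomorphisms of Jacobi-Bernoulli complexes -/

namespace LiePair

variable {S : Type u} [CommRing S] {P Q : LiePair.{u, v, w} S} {f : P ⟶ Q}

namespace ExtPow

theorem ext_of_piece {N : Type*} [AddCommGroup N] [Module S N] {r : ℕ}
    {F F' : Total P r →ₗ[S] N} (h : ∀ n, ∀ z ∈ piece P r n, F z = F' z) : F = F' :=
  total_ext fun x => h _ _ (Submodule.subset_span ⟨x, rfl, rfl⟩)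

theorem totalD_mem_piece {r n : ℕ} {z : Total P r} (hz : z ∈ piece P r (n + 1)) :
    totalD P r z ∈ piece P r n := (D P r n ⟨z, hz⟩).2

theorem totalD_eq_zero {r : ℕ} {z : Total P r} (hz : z ∈ piece P r 0) : totalD P r z = 0 := by
  suffices h : piece P r 0 ≤ LinearMap.ker (totalD P r) from h hz
  rw [piece, Submodule.span_le]
  rintro _ ⟨x, hx, rfl⟩
  change (rel P r).mkQ (tD P r (mono P r x)) = 0
  rw [tD_mono, Finset.sum_eq_zero, map_zero]
  intro k _
  refine mono_zero _ k ?_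
  rcases hk : x k with a | b
  · have : k ∈ Finset.univ.filter fun k => (x k).isLeft := by simp [hk]
    rw [Finset.card_eq_zero.1 hx] at this
    simp at this
  · simp [step, hk]

theorem totalMap_mem_piece {r n : ℕ} {z : Total P r} (hz : z ∈ piece P r n) :
    totalMap f r z ∈ piece Q r n := (map r f n ⟨z, hz⟩).2

variable [Algebra ℚ S]

variable (P) in
/-- The projection to a homogeneous component. -/
def pieceProj (r n : ℕ) : Module.End S (Total P r) :=
  -- The quotient `Total` comes without a grading; its homogeneous components are read off from
  -- chains.
  ofTerm P r n ∘ₗ Term.proj P n ∘ₗ toChain P r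

theorem exists_bidegree {r n : ℕ} {z : Total P r} (hz : z ∈ piece P r n) :
    ∃ y ∈ Chain.bidegree P r n, ofChainAt P r y = z := by
  suffices h : piece P r n ≤ (Chain.bidegree P r n).map (ofChainAt P r) from h hz
  rw [piece, Submodule.span_le]
  rintro _ ⟨x, rfl, rfl⟩
  exact exists_ofChainAt_eq x

theorem pieceProj_self {r n : ℕ} (hr : 1 ≤ r) {z : Total P r} (hz : z ∈ piece P r n) :
    pieceProj P r n z = z := by
  obtain ⟨y, hy, rfl⟩ := exists_bidegree hz
  rw [pieceProj, LinearMap.comp_apply, LinearMap.comp_apply, toChain_ofChainAt hy, ofTerm_proj hr hy]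

theorem pieceProj_of_ne {r n k : ℕ} (hk : n ≠ k) {z : Total P r} (hz : z ∈ piece P r k) :
    pieceProj P r n z = 0 := by
  obtain ⟨y, hy, rfl⟩ := exists_bidegree hz
  rw [pieceProj, LinearMap.comp_apply, LinearMap.comp_apply, toChain_ofChainAt hy]
  have : Chain.bidegree P r k ≤ LinearMap.ker (Term.proj P n) := by
    rw [Chain.bidegree, Submodule.span_le]
    rintro _ ⟨m, a, u, -, -, rfl⟩
    exact Term.proj_wedges_of_ne P hk.symm a u
  rw [LinearMap.mem_ker.1 (this hy), map_zero]

theorem pieceProj_mem {r n : ℕ} (hr : 1 ≤ r) (z : Total P r) : pieceProj P r n z ∈ piece P r n := by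
  suffices H : (piece P r n).mkQ ∘ₗ pieceProj P r n = 0 from
    (Submodule.Quotient.mk_eq_zero _).1 (LinearMap.congr_fun H z)
  refine ext_of_piece fun k z hz => (Submodule.Quotient.mk_eq_zero _).2 ?_
  rcases eq_or_ne n k with rfl | h
  · rwa [pieceProj_self hr hz]
  · rw [pieceProj_of_ne h hz]
    exact zero_mem _

theorem pieceProj_totalD {r n : ℕ} (hr : 1 ≤ r) (z : Total P r) :
    pieceProj P r n (totalD P r z) = totalD P r (pieceProj P r (n + 1) z) := by
  refine LinearMap.congr_fun (f := pieceProj P r n ∘ₗ totalD P r)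
    (g := totalD P r ∘ₗ pieceProj P r (n + 1)) (ext_of_piece fun k z hz => ?_) z
  simp only [LinearMap.comp_apply]
  cases k with
  | zero => rw [totalD_eq_zero hz, pieceProj_of_ne n.succ_ne_zero hz, map_zero, map_zero]
  | succ k =>
    rcases eq_or_ne n k with rfl | h
    · rw [pieceProj_self hr hz, pieceProj_self hr (totalD_mem_piece hz)]
    · rw [pieceProj_of_ne h (totalD_mem_piece hz), pieceProj_of_ne (by omega) hz, map_zero]

theorem pieceProj_totalMap {r n : ℕ} (hr : 1 ≤ r) (z : Total P r) :
    pieceProj Q r n (totalMap f r z) = totalMap f r (pieceProj P r n z) := by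
  refine LinearMap.congr_fun (f := pieceProj Q r n ∘ₗ totalMap f r)
    (g := totalMap f r ∘ₗ pieceProj P r n) (ext_of_piece fun k z hz => ?_) z
  simp only [LinearMap.comp_apply]
  rcases eq_or_ne n k with rfl | h
  · rw [pieceProj_self hr hz, pieceProj_self hr (totalMap_mem_piece hz)]
  · rw [pieceProj_of_ne h (totalMap_mem_piece hz), pieceProj_of_ne h hz, map_zero]

end ExtPow

namespace Term

open ExtPow LinearMap

variable [Algebra ℚ S]

theorem exists_mem_fil {n : ℕ} (x : P.Term n) : ∃ r : ℕ, x ∈ fil P r n := by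
  let p : Submodule S (P.Term n) := ⨆ r : ℕ, fil P r n
  have hp : p.mkQ = 0 := linearMap_ext P fun m a b => (Submodule.Quotient.mk_eq_zero _).2
    (Submodule.mem_iSup_of_mem (n + m) (mon_mem_fil P (by push_cast; omega) a b))
  refine (Submodule.mem_iSup_of_directed _ (monotone_nat_of_le_succ fun r => ?_).directed_le).1
    ((Submodule.Quotient.mk_eq_zero p).1 (LinearMap.congr_fun hp x))
  exact_mod_cast fil_mono P r n

theorem mem_fil_pred {r n : ℕ} {x : P.Term n} (hx : x ∈ fil P (r + 1 : ℕ) n)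
    (h : ofTerm P (r + 1) n x = 0) : x ∈ fil P r n := by
  have := mem_fil_of_ofTerm_eq_zero (Nat.le_add_left 1 r) hx h
  rwa [Nat.cast_succ, add_sub_cancel_right] at this

theorem totalD_ofTerm {r n : ℕ} (hr : 1 ≤ r) {x : P.Term n} (hx : x ∈ fil P r n)
    (hx' : x ∈ (complex P).cycles n) : totalD P r (ofTerm P r n x) = 0 := by
  cases n with
  | zero => exact totalD_eq_zero (ofTerm_mem_piece hr hx)
  | succ n =>
    rw [← ofTerm_d hr hx, show d P n x = 0 from hx', map_zero]

theorem d_mem_cycles {n : ℕ} (x : P.Term (n + 1)) : d P n x ∈ (complex P).cycles n := by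
  cases n with
  | zero => trivial
  | succ n => exact d_d P n x

theorem d_map {n : ℕ} (x : P.Term (n + 1)) : d Q n (map f (n + 1) x) = map f n (d P n x) :=
  ((complexMap f).comm_d n x).symm

theorem map_mem_fil {r : ℤ} {n : ℕ} {x : P.Term n} (hx : x ∈ fil P r n) : map f n x ∈ fil Q r n :=
  (complexMap f).map_fil r n x hx

variable (h : ∀ r, ConeExact (totalD P r) (totalD Q r) (totalMap f r))
include h

/-- Cone exactness by induction along the filtration. The classes in the `r`-th exterior power are
bounded there, the components of the right degree are lifted to `F_r`, and subtracting the boundary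
of the lift leaves a problem in `F_{r-1}`. -/
theorem exists_primitive_of_mem_fil (r : ℕ) {n : ℕ} (x : P.Term n) (y : Q.Term (n + 1))
    (hx : x ∈ fil P r n) (hy : y ∈ fil Q r (n + 1)) (hx' : x ∈ (complex P).cycles n)
    (hxy : map f n x = d Q n y) :
    ∃ (x' : P.Term (n + 1)) (y' : Q.Term (n + 2)),
      d P n x' = x ∧ map f (n + 1) x' + d Q (n + 1) y' = y := by
  induction r generalizing x y with
  | zero =>
    rw [fil_eq_bot _ (by simp), Submodule.mem_bot] at hx hy
    exact ⟨0, 0, by rw [map_zero, hx], by rw [map_zero, map_zero, add_zero, hy]⟩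
  | succ r ih =>
    have hr : 1 ≤ r + 1 := Nat.le_add_left 1 r
    obtain ⟨X, Y, hX, hY⟩ := h (r + 1) (ofTerm P _ n x) (ofTerm Q _ (n + 1) y)
      (totalD_ofTerm hr hx hx') (by rw [← ofTerm_map f hr, hxy, ofTerm_d hr hy])
    obtain ⟨x', hx1, hx2⟩ := piece_le_map hr (n + 1) (pieceProj_mem hr X)
    obtain ⟨y', hy1, hy2⟩ := piece_le_map hr (n + 2) (pieceProj_mem hr Y)
    obtain ⟨x'', y'', hx3, hy3⟩ := ih (x - d P n x') (y - (map f (n + 1) x' + d Q (n + 1) y'))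
      (mem_fil_pred (sub_mem hx (d_fil P _ _ hx1)) (by
        rw [map_sub, ofTerm_d hr hx1, hx2, ← pieceProj_totalD hr, hX,
          pieceProj_self hr (ofTerm_mem_piece hr hx), sub_self]))
      (mem_fil_pred (sub_mem hy (add_mem (map_mem_fil hx1) (d_fil Q _ _ hy1))) (by
        rw [map_sub, map_add, ofTerm_d hr hy1, hy2, ofTerm_map f hr, hx2, ← pieceProj_totalD hr,
          ← pieceProj_totalMap hr, ← map_add, hY, pieceProj_self hr (ofTerm_mem_piece hr hy),
          sub_self]))
      (sub_mem hx' (d_mem_cycles x'))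
      (by rw [map_sub, map_sub, map_add, d_d, add_zero, d_map, hxy])
    refine ⟨x' + x'', y' + y'', ?_, ?_⟩
    · rw [map_add, hx3, add_sub_cancel]
    · rw [map_add, map_add, add_add_add_comm, hy3, add_sub_cancel]

/-- The same induction at the end of the complex, where no degree lies below `0` and the class to be
bounded in the source is zero. -/
theorem exists_lift_of_mem_fil (r : ℕ) (y : Q.Term 0) (hy : y ∈ fil Q r 0) :
    ∃ (x : P.Term 0) (y' : Q.Term 1), map f 0 x + d Q 0 y' = y := by
  induction r generalizing y with
  | zero =>
    rw [fil_eq_bot _ (by simp), Submodule.mem_bot] at hy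
    exact ⟨0, 0, by rw [map_zero, map_zero, add_zero, hy]⟩
  | succ r ih =>
    have hr : 1 ≤ r + 1 := Nat.le_add_left 1 r
    obtain ⟨X, Y, -, hY⟩ := h (r + 1) 0 (ofTerm Q _ 0 y) (map_zero _)
      (by rw [map_zero, totalD_eq_zero (ofTerm_mem_piece hr hy)])
    obtain ⟨x', hx1, hx2⟩ := piece_le_map hr 0 (pieceProj_mem hr X)
    obtain ⟨y', hy1, hy2⟩ := piece_le_map hr 1 (pieceProj_mem hr Y)
    obtain ⟨x'', y'', h3⟩ := ih (y - (map f 0 x' + d Q 0 y'))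
      (mem_fil_pred (sub_mem hy (add_mem (map_mem_fil hx1) (d_fil Q _ _ hy1))) (by
        rw [map_sub, map_add, ofTerm_d hr hy1, hy2, ofTerm_map f hr, hx2, ← pieceProj_totalD hr,
          ← pieceProj_totalMap hr, ← map_add, hY, pieceProj_self hr (ofTerm_mem_piece hr hy),
          sub_self]))
    refine ⟨x' + x'', y' + y'', ?_⟩
    rw [map_add, map_add, add_add_add_comm, h3, add_sub_cancel]

theorem exists_primitive {n : ℕ} (x : P.Term n) (y : Q.Term (n + 1))
    (hx' : x ∈ (complex P).cycles n) (hxy : map f n x = d Q n y) :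
    ∃ (x' : P.Term (n + 1)) (y' : Q.Term (n + 2)),
      d P n x' = x ∧ map f (n + 1) x' + d Q (n + 1) y' = y := by
  obtain ⟨r, hr⟩ := exists_mem_fil x
  obtain ⟨s, hs⟩ := exists_mem_fil y
  have mono : ∀ (R : LiePair.{u, v, w} S) (k : ℕ), Monotone fun t : ℕ => fil R t k := fun R k =>
    monotone_nat_of_le_succ fun t => by exact_mod_cast fil_mono R t k
  exact exists_primitive_of_mem_fil h (max r s) x y (mono _ _ (le_max_left r s) hr)
    (mono _ _ (le_max_right r s) hs) hx' hxy

theorem isQuasiIso_complexMap : CoFiltComplex.IsQuasiIso (complexMap f) := by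
  intro n
  constructor
  · rintro x hx ⟨y, hy⟩
    obtain ⟨x', -, hx', -⟩ := exists_primitive h x y hx hy.symm
    exact ⟨x', hx'⟩
  · intro y hy
    cases n with
    | zero =>
      obtain ⟨r, hr⟩ := exists_mem_fil (show Q.Term 0 from y)
      obtain ⟨x, y', hxy⟩ := exists_lift_of_mem_fil h r _ hr
      exact ⟨x, trivial, y', eq_sub_of_add_eq' hxy⟩
    | succ n =>
      -- Surjectivity on cohomology is cone exactness at `(0, y)`; injectivity above is the first
      -- component of the general case.
      obtain ⟨x, y', hx, hxy⟩ := exists_primitive h (0 : P.Term n) y (zero_mem _)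
        ((map_zero _).trans (Eq.symm hy))
      exact ⟨x, hx, y', eq_sub_of_add_eq' hxy⟩

end Term

end LiePair

end

/-- The Jacobi-Bernoulli complex `J`, as a functor on Lie pairs over a `ℚ`-algebra `S`.  The
isomorphisms `e P n` identify its terms with the direct sums of the `⋀^n g ⊗ Sym^m h`. -/
theorem theorem1p2p1 (S : Type u) [CommRing S] [Algebra ℚ S] :
    ∃ (J : LiePair.{u, v, w} S ⥤ CoFiltComplex.{u, max u v w} S)
      (e : ∀ (P : LiePair.{u, v, w} S) (n : ℕ), P.JB n ≃ₗ[S] (J.obj P).X n),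
      -- the differentials
      (∀ (P : LiePair.{u, v, w} S) (n m : ℕ) (a : Fin (n + 1) → P.g) (b : P.h),
        (J.obj P).d n (e P (n + 1) (LiePair.JB.mon P m a b)) =
          e P n (LiePair.JB.dMon P m a b)) ∧
      -- the comultiplication
      (∀ (P : LiePair.{u, v, w} S) (n p q : ℕ) (h : p + q = n) (m : ℕ) (a : Fin n → P.g)
        (b : P.h),
        (J.obj P).comul h (e P n (LiePair.JB.mon P m a b)) =
          TensorProduct.map (e P p).toLinearMap (e P q).toLinearMap
            (LiePair.JB.comulMon P h m a b)) ∧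
      -- the filtration
      (∀ (P : LiePair.{u, v, w} S) (r : ℤ) (n : ℕ),
        (J.obj P).fil r n = (LiePair.JB.fil P r n).map (e P n).toLinearMap) ∧
      -- the functoriality
      (∀ (P Q : LiePair.{u, v, w} S) (f : P ⟶ Q) (n m : ℕ) (a : Fin n → P.g) (b : P.h),
        (J.map f).app n (e P n (LiePair.JB.mon P m a b)) =
          e Q n (LiePair.JB.mon Q m (fun k => f.φ (a k)) (f.ψ b))) ∧
      -- the associated graded: `F_r = 0` for `r ≤ 0`, and for `r ≥ 1` the complex `F_r / F_{r-1}`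
      -- is naturally isomorphic to the `r`-th exterior power of the complex `g → h`
      (∀ (P : LiePair.{u, v, w} S) (r : ℤ) (n : ℕ), r ≤ 0 → (J.obj P).fil r n = ⊥) ∧
      (∀ r : ℕ, 1 ≤ r →
        ∃ E : ∀ (P : LiePair.{u, v, w} S) (n : ℕ),
          (J.obj P).Gr (r : ℤ) n ≃ₗ[S] LiePair.ExtPow.piece P r n,
          (∀ (P : LiePair.{u, v, w} S) (n : ℕ) (x : (J.obj P).Gr (r : ℤ) (n + 1)),
            E P n ((J.obj P).grD r n x) = LiePair.ExtPow.D P r n (E P (n + 1) x)) ∧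
          (∀ (P Q : LiePair.{u, v, w} S) (f : P ⟶ Q) (n : ℕ) (x : (J.obj P).Gr (r : ℤ) n),
            E Q n (CoFiltComplex.grMap (J.map f) r n x) =
              LiePair.ExtPow.map r f n (E P n x))) ∧
      -- the dependence on the quasi-isomorphism class only
      (∀ (P Q : LiePair.{u, v, w} S) (f : P ⟶ Q), P.IsFlat → Q.IsFlat →
        LiePair.IsQuasiIso f → CoFiltComplex.IsQuasiIso (J.map f)) ∧
      (∀ P Q : LiePair.{u, v, w} S, LiePair.QuasiIsomorphic P Q →
        CoFiltComplex.QuasiIsomorphic (J.obj P) (J.obj Q)) := by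
  refine ⟨LiePair.Term.functor S, LiePair.Term.equiv, ?_, ?_, ?_, ?_, ?_, ?_, ?_, ?_⟩
  · exact fun P n m a b => LiePair.Term.d_mon P m a b
  · exact fun P n p q h m a b => LiePair.Term.comul_mon P h m a b
  · exact fun P r n => rfl
  · exact fun P Q f n m a b => LiePair.Term.map_mon f m a b
  · exact fun P r n h => LiePair.Term.fil_eq_bot P h n
  · exact fun r hr => ⟨fun P => LiePair.ExtPow.ofGr P hr, fun P => LiePair.ExtPow.ofGr_grD P hr,
      fun P Q f => LiePair.ExtPow.ofGr_grMap P f hr⟩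
  · exact fun P Q f hP hQ hf =>
      LiePair.Term.isQuasiIso_complexMap (LiePair.ExtPow.totalMap_coneExact hP hQ hf)
  · intro P Q h
    induction h with
    | rel P Q h =>
      obtain ⟨hP, hQ, f, hf⟩ := h
      exact .rel _ _ ⟨LiePair.Term.complexMap f,
        LiePair.Term.isQuasiIso_complexMap (LiePair.ExtPow.totalMap_coneExact hP hQ hf)⟩
    | refl P => exact .refl _
    | symm P Q _ h => exact .symm _ _ h
    | trans P Q R _ _ h h' => exact .trans _ _ _ h h'
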